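/- Let $H\in(1/2,1)$, let $(W(t))_{t\in[0,1]}$ be a standard Brownian motion and let $I_2$ denote the double Wiener–Itô integral with respect to $W$ of kernels in $L^2([0,1]^2)$. Put $H'=\frac{H+1}{2}$ and $d(H)=\frac{(2(2H-1))^{1/2}}{(H+1)H^{1/2}}$, and let $$K^{H'}(t,s)=c_{H'}\,s^{1/2-H'}\int_s^t(u-s)^{H'-3/2}u^{H'-1/2}\,du\quad(0<s<t),\qquad c_{H'}=\left(\frac{H'(2H'-1)}{\beta(2-2H',\,H'-\frac12)}\right)^{1/2},$$ where $\beta$ is the Beta function, be the standard kernel of fractional Brownian motion of index $H'$ ($K^{H'}(t,s)=0$ for $s\ge t$). For $t\in[0,1]$ let $$L_t(y_1,y_2)=d(H)\left[\int_{y_1\vee y_2}^t\partial_1K^{H'}(u,y_1)\,\partial_1K^{H'}(u,y_2)\,du\right]1_{[0,t]^2}(y_1,y_2),$$ and let $Z(t)=I_2(L_t)$, $t\in[0,1]$, be the Rosenblatt process with self-similarity parameter $H$. For $N\ge1$ let $$V_N(2,a)=\frac1N\sum_{i=1}^N\left[\frac{\left(Z(\frac iN)-Z(\frac{i-1}N)\right)^2}{\mathbf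 E\left[\left(Z(\frac iN)-Z(\frac{i-1}N)\right)^2\right]}-1\right]$$ be its quadratic variation statistic, for the filter $a=\{-1,1\}$. Then $V_N(2,a)\in L^2(\Omega)$ for every $N\ge 1$, $Z(1)\in L^2(\Omega)$, and $$\frac{N^{1-H}}{4d(H)}\,V_N(2,a)\longrightarrow Z(1)\quad\text{in }L^2(\Omega)\text{ as }N\to\infty,$$ where $Z(1)$ is the observed value at time $1$ of the same process $Z$. -/

import Mathlib

open MeasureTheory ProbabilityTheory Filter Set
open scoped unitInterval Topology ENNReal NNReal

namespace RosenblattVariation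

/-- A standard Brownian motion with time horizon `[0,1]`: the variable at time `t` is `N(0,t)`
(in particular it vanishes almost surely at time `0`), the increments over consecutive time
intervals are independent, and almost every path is continuous. -/
structure IsBrownianUnit {Ω : Type*} [MeasurableSpace Ω] (W : I → Ω → ℝ) (P : Measure Ω) :
    Prop where
  hasLaw : ∀ t : I, HasLaw (W t) (gaussianReal 0 ⟨(t : ℝ), t.2.1⟩) P
  indep : HasIndepIncrements W P
  cont : ∀ᵐ ω ∂P, Continuous fun t => W t ω

/-- An elementary kernel of two variables on `[0,1]`: a subdivision `pt 0 ≤ ⋯ ≤ pt n` of points of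
`[0,1]` and a matrix of coefficients vanishing on the diagonal. -/
structure ElemKernel where
  n : ℕ
  pt : Fin (n + 1) → I
  mono : Monotone pt
  coef : Fin n → Fin n → ℝ
  diag : ∀ i, coef i i = 0

/-- The off-diagonal step function
`∑ i j, coef i j * 1_{(pt i, pt (i+1)]}(y₁) * 1_{(pt j, pt (j+1)]}(y₂)`. -/
noncomputable def ElemKernel.toFun (φ : ElemKernel) (y : ℝ × ℝ) : ℝ :=
  ∑ i : Fin φ.n, ∑ j : Fin φ.n, φ.coef i j *
    (Ioc (φ.pt i.castSucc : ℝ) (φ.pt i.succ)).indicator 1 y.1 *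
    (Ioc (φ.pt j.castSucc : ℝ) (φ.pt j.succ)).indicator 1 y.2

/-- The double Wiener-Itô integral of an elementary kernel:
`∑ i j, coef i j * (W (pt (i+1)) - W (pt i)) * (W (pt (j+1)) - W (pt j))`. -/
noncomputable def ElemKernel.wiener {Ω : Type*} (φ : ElemKernel) (W : I → Ω → ℝ) (ω : Ω) : ℝ :=
  ∑ i : Fin φ.n, ∑ j : Fin φ.n, φ.coef i j *
    (W (φ.pt i.succ) ω - W (φ.pt i.castSucc) ω) * (W (φ.pt j.succ) ω - W (φ.pt j.castSucc) ω)

/-- Lebesgue measure on the square `[0,1]²`. -/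
noncomputable def squareMeasure : Measure (ℝ × ℝ) :=
  volume.restrict (Icc (0 : ℝ) 1 ×ˢ Icc (0 : ℝ) 1)

/-- `X` is (a version of) the multiple Wiener-Itô integral of order two `I₂(f)` of
`f ∈ L²([0,1]²)` with respect to `W`. It is the `L²(Ω)` limit of the integrals of elementary
kernels that converge to `f` in `L²([0,1]²)`; by the Itô isometry it does not depend on the
sequence, up to almost sure equality. -/
def IsDoubleWienerIntegral {Ω : Type*} [MeasurableSpace Ω] (W : I → Ω → ℝ) (P : Measure Ω)
    (f : ℝ × ℝ → ℝ) (X : Ω → ℝ) : Prop :=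
  MemLp f 2 squareMeasure ∧ MemLp X 2 P ∧
    ∃ φ : ℕ → ElemKernel,
      Tendsto (fun k => eLpNorm (fun y => (φ k).toFun y - f y) 2 squareMeasure) atTop (𝓝 0) ∧
      Tendsto (fun k => eLpNorm (fun ω => (φ k).wiener W ω - X ω) 2 P) atTop (𝓝 0)

/-- The normalizing constant `c_h = (h(2h-1)/β(2-2h, h-1/2))^{1/2}` of the kernel of fractional
Brownian motion of Hurst index `h > 1/2`. -/
noncomputable def fbmConst (h : ℝ) : ℝ :=
  √(h * (2 * h - 1) / beta (2 - 2 * h) (h - 1 / 2))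

/-- The standard (Volterra) kernel of fractional Brownian motion of Hurst index `h > 1/2`:
`K^h(t,s) = c_h s^{1/2-h} ∫_s^t (u-s)^{h-3/2} u^{h-1/2} du` for `0 < s < t`, and `0` for `s ≥ t`. -/
noncomputable def fbmKernel (h t s : ℝ) : ℝ :=
  if s < t then
    fbmConst h * s ^ (1 / 2 - h) * ∫ u in s..t, (u - s) ^ (h - 3 / 2) * u ^ (h - 1 / 2)
  else 0

/-- `∂₁K^h(t,s)`, the partial derivative in the first (time) variable. -/
noncomputable def fbmKernelDeriv (h t s : ℝ) : ℝ :=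
  deriv (fun r => fbmKernel h r s) t

/-- The constant `d(H) = (2(2H-1))^{1/2} / ((H+1) H^{1/2})`. -/
noncomputable def rosenblattConst (H : ℝ) : ℝ :=
  √(2 * (2 * H - 1)) / ((H + 1) * √H)

/-- The kernel of the Rosenblatt process at time `t`,
`L_t(y₁,y₂) = d(H) (∫_{y₁ ∨ y₂}^t ∂₁K^h(u,y₁) ∂₁K^h(u,y₂) du) 1_{[0,t]²}(y₁,y₂)`
with `h = (H+1)/2`. (The value on the null set `y₁ = y₂`, where the integral diverges,
is irrelevant.) -/
noncomputable def rosenblattKernel (H t : ℝ) : ℝ × ℝ → ℝ :=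
  (Icc 0 t ×ˢ Icc 0 t).indicator fun y =>
    rosenblattConst H * ∫ u in (max y.1 y.2)..t,
      fbmKernelDeriv ((H + 1) / 2) u y.1 * fbmKernelDeriv ((H + 1) / 2) u y.2

/-- `Z` is the Rosenblatt process of self-similarity parameter `H` driven by the Brownian motion
`W`: for every `t ∈ [0,1]`, `Z(t) = I₂(L_t)`. -/
def IsRosenblattProcess {Ω : Type*} [MeasurableSpace Ω] (H : ℝ) (W : I → Ω → ℝ) (P : Measure Ω)
    (Z : I → Ω → ℝ) : Prop :=
  ∀ t : I, IsDoubleWienerIntegral W P (rosenblattKernel H t) (Z t)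

/-- The observation time `i/N`, `0 ≤ i ≤ N`. -/
noncomputable def gridPoint (N : ℕ) (i : Fin (N + 1)) : I :=
  ⟨(i : ℝ) / N, by positivity,
    div_le_one_of_le₀ (by exact_mod_cast Nat.lt_succ_iff.mp i.2) (by positivity)⟩

/-- The quadratic variation statistic for the filter `a = {-1,1}`:
`V_N(2,a) = (1/N) ∑_{i=1}^N [ (Z(i/N) - Z((i-1)/N))² / E[(Z(i/N) - Z((i-1)/N))²] - 1 ]`. -/
noncomputable def quadVariation {Ω : Type*} [MeasurableSpace Ω] (P : Measure Ω) (Z : I → Ω → ℝ)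
    (N : ℕ) (ω : Ω) : ℝ :=
  (1 / (N : ℝ)) * ∑ i : Fin N,
    ((Z (gridPoint N i.succ) ω - Z (gridPoint N i.castSucc) ω) ^ 2 /
      (∫ ω', (Z (gridPoint N i.succ) ω' - Z (gridPoint N i.castSucc) ω') ^ 2 ∂P) - 1)

end RosenblattVariation

namespace RosenblattVariation

/-! ### Moments of quadratic forms in a standard Gaussian vector. -/

section GaussianPolynomials

/-! The squared L² distance between the renormalized variation and `Z 1` is expanded and each term
is computed; no chaos decomposition of the variation is needed. Let k_i be the kernel of the i-th
increment, U_i the squared increment minus its mean N^(-2H), ∘ composition of kernels and L the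
kernel of `Z 1`. The moment formulas of the second chaos (`IsSymmDoubleWiener.moments`) give E[U_i
U_j] = 8⟨k_i,k_j⟩² + 32⟨k_i∘k_i, k_j∘k_j⟩ + 16⟨k_i∘k_j, k_j∘k_i⟩ and E[U_i Z(1)] = 8⟨k_i∘k_i, L⟩,
while E[Z(1)²] = 1.

These inner products are explicit because the Rosenblatt kernel is a superposition ∫ G_u ⊗ G_u du of
profiles whose overlap ∫ G_u G_v is θ|u-v|^p for u ≠ v, with p = H-1 and θ = `overlapConst H`
(`overlap_rosenblattVolterra`, a Beta integral). By Tonelli each inner product is a power of θ times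
an integral of |·|^p along the edges of a cycle of length two, three or four, with vertices in
prescribed cells.

Let κ and J be the integrals of |x-y|^p and |x-y|^(2p) over the unit square. Two points in the same
cell look like one macroscopic point, and the short link between them contributes a factor κ.
Accordingly N^(2H) times the sum of the four-cycles has limsup at most κ²J
(`limsup_sum_inner_cycle_le`), N^H times the sum of the triangles has liminf at least κJ
(`le_liminf_sum_triangle`), and N^(2H) times the sum of squared cell energies, which controls the
two other terms of E[U_i U_j], vanishes (`tendsto_sum_sq_cell_riesz`). Since θκ = d(H) and 2θ²J = 1,
the limiting contributions are 1, -2 and 1, with sum zero. The distance is nonnegative, so one-sided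
bounds suffice; this is why the AM-GM inequality and Fatou's lemma are enough.

The moment formulas are proved first for step kernels, where the double integral is a quadratic form
in a Gaussian vector and integration by parts produces traces of matrix products. A factorization A
Aᵀ of the covariance matrix turns these traces into inner products of composed kernels. The bound of
the L⁴ norm by the kernel norm (`IsElemPair.eLpNorm_four_le`) carries the formulas over to general
symmetric kernels. -/

lemma integrable_pow_stdGaussianReal (k : ℕ) :
    Integrable (fun x : ℝ => x ^ k) (gaussianReal 0 1) := by
  have := (memLp_id_gaussianReal' (μ := 0) (v := 1) (k : ℝ≥0∞) (by simp)).integrable_norm_pow'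
  refine (integrable_norm_iff (by fun_prop)).1 ?_
  simpa using this

/-- The moment recursion of the standard Gaussian law. -/
lemma integral_pow_succ_stdGaussianReal (n : ℕ) :
    ∫ x, x ^ (n + 1) ∂(gaussianReal 0 1) = n * ∫ x, x ^ (n - 1) ∂(gaussianReal 0 1) := by
  have hint : ∀ k : ℕ, Integrable (fun x : ℝ => x ^ k * gaussianPDFReal 0 1 x) := by
    intro k
    have h1 := integrable_pow_stdGaussianReal k
    rw [gaussianReal_of_var_ne_zero 0 one_ne_zero,
      integrable_withDensity_iff_integrable_smul₀' (by fun_prop) (by simp [gaussianPDF])] at h1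
    simpa [gaussianPDF, ENNReal.toReal_ofReal, gaussianPDFReal_nonneg, mul_comm] using h1
  have hderiv : ∀ x : ℝ, HasDerivAt (gaussianPDFReal 0 1) (-x * gaussianPDFReal 0 1 x) x := by
    intro x
    have : HasDerivAt (fun x : ℝ => -(x - 0) ^ 2 / (2 * ((1 : ℝ≥0) : ℝ))) (-x) x := by
      have := ((((hasDerivAt_id x).sub_const 0).pow 2).neg).div_const (2 * ((1 : ℝ≥0) : ℝ))
      refine this.congr_deriv ?_
      simp
      ring
    have := (this.exp).const_mul ((√(2 * Real.pi * ((1 : ℝ≥0) : ℝ)))⁻¹)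
    refine this.congr_deriv ?_
    simp [gaussianPDFReal]
    ring
  rw [integral_gaussianReal_eq_integral_smul one_ne_zero,
    integral_gaussianReal_eq_integral_smul one_ne_zero]
  -- Integration by parts of x^n against the density, whose derivative is -x times itself. For n = 0
  -- the truncated exponent n - 1 is harmless, being multiplied by n.
  have := integral_mul_deriv_eq_deriv_mul_of_integrable (u := fun x : ℝ => x ^ n)
    (u' := fun x : ℝ => n * x ^ (n - 1)) (v := gaussianPDFReal 0 1)
    (v' := fun x => -x * gaussianPDFReal 0 1 x) (fun x _ => by simpa using hasDerivAt_pow n x)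
    (fun x _ => hderiv x)
    (by refine (hint (n + 1)).neg.congr (ae_of_all _ fun x => ?_); simp; ring)
    (by refine ((hint (n - 1)).const_mul (n : ℝ)).congr (ae_of_all _ fun x => ?_); simp; ring)
    (hint n)
  simp only [smul_eq_mul]
  rw [← integral_const_mul]
  have e1 : ∫ x : ℝ, gaussianPDFReal 0 1 x * x ^ (n + 1)
      = - ∫ x : ℝ, x ^ n * (-x * gaussianPDFReal 0 1 x) := by
    rw [← integral_neg]; congr 1; ext x; ring
  rw [e1, this, neg_neg]
  congr 1; ext x; ring

variable {ι : Type*} [Fintype ι]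

/-- The standard Gaussian measure on `ι → ℝ`. -/
noncomputable def stdGaussianPi (ι : Type*) [Fintype ι] : Measure (ι → ℝ) :=
  Measure.pi fun _ => gaussianReal 0 1

instance : IsProbabilityMeasure (stdGaussianPi ι) := by
  unfold stdGaussianPi; infer_instance

lemma eval_monomial_eq_prod (s : ι →₀ ℕ) (c : ℝ) (x : ι → ℝ) :
    MvPolynomial.eval x (MvPolynomial.monomial s c) = c * ∏ i, x i ^ s i := by
  rw [MvPolynomial.eval_monomial, Finsupp.prod_fintype]; simp

lemma integrable_eval_stdGaussianPi (p : MvPolynomial ι ℝ) :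
    Integrable (fun x => MvPolynomial.eval x p) (stdGaussianPi ι) := by
  induction p using MvPolynomial.induction_on' with
  | monomial s c =>
    simp_rw [eval_monomial_eq_prod]
    exact (Integrable.fintype_prod fun i => integrable_pow_stdGaussianReal (s i)).const_mul c
  | add p q hp hq =>
    simp only [map_add]
    exact hp.add hq

/-- The expectation of a polynomial under the standard Gaussian measure. -/
noncomputable def gaussianMean : MvPolynomial ι ℝ →ₗ[ℝ] ℝ where
  toFun p := ∫ x, MvPolynomial.eval x p ∂(stdGaussianPi ι)
  map_add' p q := by
    simpa using integral_add (integrable_eval_stdGaussianPi p) (integrable_eval_stdGaussianPi q)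
  map_smul' c p := by simp [MvPolynomial.smul_eval, integral_const_mul]

lemma gaussianMean_apply (p : MvPolynomial ι ℝ) :
    gaussianMean p = ∫ x, MvPolynomial.eval x p ∂(stdGaussianPi ι) := rfl

lemma gaussianMean_one : gaussianMean (1 : MvPolynomial ι ℝ) = 1 := by
  simp [gaussianMean_apply]

lemma gaussianMean_monomial (s : ι →₀ ℕ) (c : ℝ) :
    gaussianMean (MvPolynomial.monomial s c) = c * ∏ i, ∫ x, x ^ s i ∂(gaussianReal 0 1) := by
  rw [gaussianMean_apply]
  simp_rw [eval_monomial_eq_prod]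
  rw [integral_const_mul, stdGaussianPi,
    integral_fintype_prod_eq_prod (fun i (x : ℝ) => x ^ s i)]

/-- Gaussian integration by parts. -/
lemma gaussianMean_X_mul [DecidableEq ι] (i : ι) (p : MvPolynomial ι ℝ) :
    gaussianMean (MvPolynomial.X i * p) = gaussianMean (MvPolynomial.pderiv i p) := by
  induction p using MvPolynomial.induction_on' with
  | monomial s c =>
    rw [MvPolynomial.pderiv_monomial, mul_comm, ← pow_one (MvPolynomial.X i),
      ← MvPolynomial.monomial_add_single, gaussianMean_monomial, gaussianMean_monomial,
      ← Finset.mul_prod_erase Finset.univ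
        (fun j => ∫ x, x ^ (s + Finsupp.single i 1 : ι →₀ ℕ) j ∂(gaussianReal 0 1))
        (Finset.mem_univ i),
      ← Finset.mul_prod_erase Finset.univ
        (fun j => ∫ x, x ^ (s - Finsupp.single i 1 : ι →₀ ℕ) j ∂(gaussianReal 0 1))
        (Finset.mem_univ i)]
    have e1 : ∏ j ∈ Finset.univ.erase i, ∫ x, x ^ (s + Finsupp.single i 1 : ι →₀ ℕ) j
        ∂(gaussianReal 0 1) = ∏ j ∈ Finset.univ.erase i, ∫ x, x ^ s j ∂(gaussianReal 0 1) := by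
      refine Finset.prod_congr rfl fun j hj => ?_
      simp [(Finset.ne_of_mem_erase hj).symm]
    have e2 : ∏ j ∈ Finset.univ.erase i, ∫ x, x ^ (s - Finsupp.single i 1 : ι →₀ ℕ) j
        ∂(gaussianReal 0 1) = ∏ j ∈ Finset.univ.erase i, ∫ x, x ^ s j ∂(gaussianReal 0 1) := by
      refine Finset.prod_congr rfl fun j hj => ?_
      simp [(Finset.ne_of_mem_erase hj).symm]
    rw [e1, e2]
    -- The factors at coordinates other than `i` agree on both sides, so only the one-dimensional
    -- recursion remains; when `s i = 0` the truncated subtraction is masked by the factor `s i`.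
    have := integral_pow_succ_stdGaussianReal (s i)
    simp only [Finsupp.coe_add, Pi.add_apply, Finsupp.single_eq_same, Finsupp.coe_tsub,
      Pi.sub_apply] at this ⊢
    rw [this]; ring
  | add p q hp hq => simp only [mul_add, map_add, hp, hq]

/-- The quadratic form of a matrix as a polynomial. -/
noncomputable def quadPoly (A : Matrix ι ι ℝ) : MvPolynomial ι ℝ :=
  ∑ i, ∑ j, MvPolynomial.C (A i j) * MvPolynomial.X i * MvPolynomial.X j

/-- The first-order differential operator `∑ i j, M i j * x j * ∂ i`. -/
noncomputable def linDeriv (M : Matrix ι ι ℝ) (p : MvPolynomial ι ℝ) : MvPolynomial ι ℝ :=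
  ∑ i, ∑ j, MvPolynomial.C (M i j) * MvPolynomial.X j * MvPolynomial.pderiv i p

lemma linDeriv_mul (M : Matrix ι ι ℝ) (p q : MvPolynomial ι ℝ) :
    linDeriv M (p * q) = linDeriv M p * q + p * linDeriv M q := by
  simp only [linDeriv, Finset.sum_mul, Finset.mul_sum, ← Finset.sum_add_distrib,
    MvPolynomial.pderiv_mul]
  refine Finset.sum_congr rfl fun i _ => Finset.sum_congr rfl fun j _ => ?_
  ring

/-- Integrating by parts in the variable `X i` of each monomial turns it into the i-th derivative of
`X j * p`; the Kronecker terms add up to the trace. Repeated use removes the quadratic factors of a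
product one at a time. -/
lemma gaussianMean_quadPoly_mul [DecidableEq ι] (M : Matrix ι ι ℝ) (p : MvPolynomial ι ℝ) :
    gaussianMean (quadPoly M * p) = M.trace * gaussianMean p + gaussianMean (linDeriv M p) := by
  have key : ∀ i j, gaussianMean (MvPolynomial.C (M i j) * MvPolynomial.X i * MvPolynomial.X j * p)
      = (if i = j then M i j * gaussianMean p else 0) + gaussianMean
        (MvPolynomial.C (M i j) * MvPolynomial.X j * MvPolynomial.pderiv i p) := by
    intro i j
    rw [mul_assoc, mul_assoc, MvPolynomial.C_mul', map_smul, gaussianMean_X_mul,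
      MvPolynomial.pderiv_mul, mul_assoc, MvPolynomial.C_mul', map_smul, map_add, smul_add,
      MvPolynomial.pderiv_X]
    congr 1
    by_cases h : i = j
    · subst h; simp
    · simp [h, Ne.symm h]
  simp only [quadPoly, linDeriv, Finset.sum_mul, map_sum, key, Finset.sum_add_distrib]
  simp [Matrix.trace, Finset.sum_mul]

/-- The gradient of xᵀAx is 2Ax, and pairing it with Mx gives 2xᵀMᵀAx. The operator thus preserves
quadratic forms, which closes the recursion for moments. -/
lemma linDeriv_quadPoly [DecidableEq ι] (M A : Matrix ι ι ℝ) (hA : A.IsSymm) :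
    linDeriv M (quadPoly A) = 2 * quadPoly (M.transpose * A) := by
  have hp : ∀ i, MvPolynomial.pderiv i (quadPoly A)
      = 2 * ∑ k, MvPolynomial.C (A i k) * MvPolynomial.X k := by
    intro i
    have e1 : ∀ k l, MvPolynomial.pderiv i
        (MvPolynomial.C (A k l) * MvPolynomial.X k * MvPolynomial.X l : MvPolynomial ι ℝ)
        = (if k = i then MvPolynomial.C (A k l) * MvPolynomial.X l else 0)
          + (if l = i then MvPolynomial.C (A k l) * MvPolynomial.X k else 0) := by
      intro k l
      rw [MvPolynomial.pderiv_mul, MvPolynomial.pderiv_mul, MvPolynomial.pderiv_C,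
        MvPolynomial.pderiv_X, MvPolynomial.pderiv_X]
      by_cases hk : k = i <;> by_cases hl : l = i <;> simp [hk, hl]
    simp only [quadPoly, map_sum, e1, Finset.sum_add_distrib]
    rw [Finset.sum_comm]
    simp only [Finset.sum_ite_eq', Finset.mem_univ, if_true]
    rw [two_mul]
    congr 1
    refine Finset.sum_congr rfl fun k _ => ?_
    rw [hA.apply]
  simp only [linDeriv, hp]
  simp only [quadPoly, Matrix.mul_apply, Matrix.transpose_apply, map_sum,
    Finset.mul_sum, Finset.sum_mul, map_mul]
  rw [Finset.sum_comm]
  refine Finset.sum_congr rfl fun j _ => ?_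
  rw [Finset.sum_comm]
  refine Finset.sum_congr rfl fun k _ => Finset.sum_congr rfl fun i _ => ?_
  ring

lemma gaussianMean_two_mul (p : MvPolynomial ι ℝ) : gaussianMean (2 * p) = 2 * gaussianMean p := by
  rw [two_mul, map_add, two_mul]

variable [DecidableEq ι]

lemma gaussianMean_quadPoly (M : Matrix ι ι ℝ) : gaussianMean (quadPoly M) = M.trace := by
  have := gaussianMean_quadPoly_mul M 1
  have h0 : linDeriv M (1 : MvPolynomial ι ℝ) = 0 := by simp [linDeriv]
  simpa [h0, gaussianMean_one] using this

/-- After one quadratic factor is removed, the trace condition on `A` eliminates the disconnected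
term. No symmetry or trace condition is put on `M`, because products of matrices are substituted for
it. -/
lemma gaussianMean_quadPoly_mul_quadPoly (M A : Matrix ι ι ℝ) (hA : A.IsSymm) (hA0 : A.trace = 0) :
    gaussianMean (quadPoly M * quadPoly A) = 2 * (M * A).trace := by
  rw [gaussianMean_quadPoly_mul, linDeriv_quadPoly M A hA, gaussianMean_two_mul,
    gaussianMean_quadPoly, gaussianMean_quadPoly, hA0, mul_zero, zero_add, ← Matrix.trace_transpose,
    Matrix.transpose_mul, Matrix.transpose_transpose, hA.eq, Matrix.trace_mul_comm]

/-- The derivation falls on either of the two remaining factors, whence two cyclic traces. The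
matrix `M` is left general since the fourth moment uses it with `A * A` and `A * B`. -/
lemma gaussianMean_quadPoly_mul_mul (M A B : Matrix ι ι ℝ) (hA : A.IsSymm) (hA0 : A.trace = 0)
    (hB : B.IsSymm) (hB0 : B.trace = 0) :
    gaussianMean (quadPoly M * (quadPoly A * quadPoly B)) =
      2 * M.trace * (A * B).trace + 4 * (A * M * B).trace + 4 * (B * M * A).trace := by
  have t : ∀ X Y : Matrix ι ι ℝ, X.IsSymm → Y.IsSymm →
      (M.transpose * X * Y).trace = (X * M * Y).trace := by
    intro X Y hX hY
    rw [← Matrix.trace_transpose]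
    simp only [Matrix.transpose_mul, Matrix.transpose_transpose, hX.eq, hY.eq]
    rw [Matrix.trace_mul_comm]
  rw [gaussianMean_quadPoly_mul, linDeriv_mul, linDeriv_quadPoly M A hA, linDeriv_quadPoly M B hB,
    map_add, gaussianMean_quadPoly_mul_quadPoly A B hB hB0, mul_assoc, gaussianMean_two_mul,
    gaussianMean_quadPoly_mul_quadPoly _ B hB hB0, mul_left_comm (quadPoly A), gaussianMean_two_mul,
    mul_comm (quadPoly A), gaussianMean_quadPoly_mul_quadPoly _ A hA hA0, t A B hA hB, t B A hB hA]
  ring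

/-- Removing one traceless factor A leaves a derivation that hits either the other A, giving the
form of A*A against two copies of B, or one of the two copies of B, giving the form of A*B twice. -/
lemma gaussianMean_sq_mul_sq (A B : Matrix ι ι ℝ) (hA : A.IsSymm) (hA0 : A.trace = 0)
    (hB : B.IsSymm) (hB0 : B.trace = 0) :
    gaussianMean (quadPoly A * (quadPoly A * (quadPoly B * quadPoly B))) =
      4 * (A * A).trace * (B * B).trace + 8 * (A * B).trace ^ 2
        + 32 * (A * A * (B * B)).trace + 16 * (A * B * (A * B)).trace := by
  have e : quadPoly A * (2 * quadPoly (A * B) * quadPoly B + quadPoly B * (2 * quadPoly (A * B)))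
      = 2 * (2 * (quadPoly (A * B) * (quadPoly A * quadPoly B))) := by ring
  rw [gaussianMean_quadPoly_mul, hA0, zero_mul, zero_add, linDeriv_mul, linDeriv_mul,
    linDeriv_quadPoly A A hA, linDeriv_quadPoly A B hB, hA.eq, map_add, e, mul_assoc,
    gaussianMean_two_mul, gaussianMean_two_mul, gaussianMean_two_mul,
    gaussianMean_quadPoly_mul_mul _ B B hB hB0 hB hB0,
    gaussianMean_quadPoly_mul_mul _ A B hA hA0 hB hB0]
  have t1 : (B * (A * A) * B).trace = (A * A * (B * B)).trace := by
    rw [Matrix.trace_mul_comm, ← Matrix.mul_assoc, Matrix.trace_mul_comm]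
  have t2 : (A * (A * B) * B).trace = (A * A * (B * B)).trace := by
    simp only [Matrix.mul_assoc]
  have t3 : (B * (A * B) * A).trace = (A * B * (A * B)).trace := by
    rw [Matrix.trace_mul_comm, ← Matrix.mul_assoc, ← Matrix.mul_assoc]
  rw [t1, t2, t3]
  ring

end GaussianPolynomials

/-! ### Brownian motion at finitely many times as a linear image of white noise. -/

section BrownianLaw

variable {ι : Type*} [Fintype ι]

/-- Centered Gaussian measures on `ι → ℝ` are determined by their covariance matrix. -/
lemma gaussian_ext_of_moments {μ ν : Measure (ι → ℝ)} [IsGaussian μ] [IsGaussian ν]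
    (h1 : ∀ i, ∫ x, x i ∂μ = 0) (h2 : ∀ i, ∫ x, x i ∂ν = 0)
    (h : ∀ i j, ∫ x, x i * x j ∂μ = ∫ x, x i * x j ∂ν) : μ = ν := by
  have mem : ∀ (ρ : Measure (ι → ℝ)) [IsGaussian ρ] (i : ι), MemLp (fun x => x i) 2 ρ :=
    fun ρ _ i => (IsGaussian.hasGaussianLaw_id.eval i).memLp_two
  classical
  have key : ∀ (ρ : Measure (ι → ℝ)) [IsGaussian ρ], (∀ i, ∫ x, x i ∂ρ = 0) →
      ∀ L : StrongDual ℝ (ι → ℝ), ρ[L] = 0 ∧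
        Var[L; ρ] = ∑ i, ∑ j, L (Pi.single i 1) * L (Pi.single j 1) * ∫ x, x i * x j ∂ρ := by
    intro ρ _ h0 L
    have hL : ∀ x, L x = ∑ i, L (Pi.single i 1) * x i := by
      intro x
      conv_lhs => rw [pi_eq_sum_univ' x, map_sum]
      refine Finset.sum_congr rfl fun i _ => ?_
      rw [map_smul, smul_eq_mul, mul_comm]
    have hm : ρ[L] = 0 := by
      rw [integral_congr_ae (ae_of_all _ hL)]
      rw [integral_finsetSum]
      · simp [integral_const_mul, h0]
      · exact fun i _ => ((mem ρ i).integrable (by norm_num)).const_mul _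
    refine ⟨hm, ?_⟩
    rw [variance_of_integral_eq_zero L.continuous.aemeasurable hm]
    have e : ∀ x, L x ^ 2
        = ∑ i, ∑ j, L (Pi.single i 1) * L (Pi.single j 1) * (x i * x j) := by
      intro x
      rw [hL, sq, Finset.sum_mul_sum]
      exact Finset.sum_congr rfl fun i _ => Finset.sum_congr rfl fun j _ => by ring
    have hi : ∀ i j, Integrable (fun x : ι → ℝ => x i * x j) ρ := fun i j =>
      (mem ρ i).integrable_mul (mem ρ j)
    simp_rw [e]
    rw [integral_finsetSum _ fun i _ => integrable_finsetSum _ fun j _ => (hi i j).const_mul _]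
    refine Finset.sum_congr rfl fun i _ => ?_
    rw [integral_finsetSum _ fun j _ => (hi i j).const_mul _]
    exact Finset.sum_congr rfl fun j _ => integral_const_mul _ _
  -- The characteristic function of a Gaussian law depends only on the mean and variance of each
  -- linear functional, and `key` expresses both through coordinate moments.
  apply Measure.ext_of_charFunDual
  ext L
  rw [IsGaussian.charFunDual_eq, IsGaussian.charFunDual_eq, integral_complex_ofReal,
    integral_complex_ofReal, (key μ h1 L).1,
    (key ν h2 L).1, (key μ h1 L).2, (key ν h2 L).2]
  simp_rw [h]

variable {Ω : Type*} [MeasurableSpace Ω] {P : Measure Ω} {W : I → Ω → ℝ}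

lemma IsBrownianUnit.hasLaw_toNNReal (hW : IsBrownianUnit W P) (t : I) :
    HasLaw (W t) (gaussianReal 0 (Real.toNNReal t)) P := by
  have : Real.toNNReal t = ⟨(t : ℝ), t.2.1⟩ := Real.toNNReal_of_nonneg t.2.1
  rw [this]
  exact hW.hasLaw t

lemma IsBrownianUnit.ae_zero (hW : IsBrownianUnit W P) : ∀ᵐ ω ∂P, W 0 ω = 0 := by
  apply HasLaw.ae_eq_of_dirac
  rw [← gaussianReal_zero_var]
  simpa using hW.hasLaw_toNNReal 0

lemma IsBrownianUnit.isGaussianProcess (hW : IsBrownianUnit W P) : IsGaussianProcess W P :=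
  hW.indep.isGaussianProcess (fun t => (hW.hasLaw_toNNReal t).hasGaussianLaw) hW.ae_zero

lemma IsBrownianUnit.memLp_two (hW : IsBrownianUnit W P) (t : I) : MemLp (W t) 2 P :=
  (hW.hasLaw_toNNReal t).hasGaussianLaw.memLp_two

lemma IsBrownianUnit.integral_eq_zero (hW : IsBrownianUnit W P) (t : I) :
    ∫ ω, W t ω ∂P = 0 := by
  rw [(hW.hasLaw_toNNReal t).integral_eq, integral_id_gaussianReal]

/-- The later value is the earlier one plus an independent centred increment, so only the variance
at the earlier time survives. -/
lemma IsBrownianUnit.integral_mul (hW : IsBrownianUnit W P) (s t : I) :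
    ∫ ω, W s ω * W t ω ∂P = min (s : ℝ) t := by
  wlog hst : s ≤ t generalizing s t
  · rw [min_comm, ← this t s (le_of_not_ge hst)]
    simp_rw [mul_comm]
  have := hW.isGaussianProcess.isProbabilityMeasure
  have h1 := hW.indep.indepFun_eval_sub (s := s) (t := t) (show ⊥ ≤ s from bot_le) hst hW.ae_zero
  have hs := hW.memLp_two s
  have ht := hW.memLp_two t
  have e : ∀ ω, W s ω * W t ω = W s ω * (W t ω - W s ω) + W s ω ^ 2 := fun ω => by ring
  simp_rw [e]
  rw [integral_add (f := fun ω => W s ω * (W t ω - W s ω)) (hs.integrable_mul (ht.sub hs))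
    hs.integrable_sq]
  have h2 : ∫ ω, W s ω * (W t ω - W s ω) ∂P = 0 := by
    have := h1.integral_mul_eq_mul_integral hs.aestronglyMeasurable
      (ht.sub hs).aestronglyMeasurable
    simp only [Pi.mul_apply, Pi.sub_apply] at this
    rw [this, hW.integral_eq_zero, zero_mul]
  have h3 := variance_of_integral_eq_zero (hW.hasLaw_toNNReal s).aemeasurable (hW.integral_eq_zero s)
  rw [(hW.hasLaw_toNNReal s).variance_eq, variance_id_gaussianReal] at h3
  rw [h2, ← h3, zero_add, min_eq_left (by exact_mod_cast hst),
    Real.coe_toNNReal _ s.2.1]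

/-- The covariance matrix of Brownian motion at the times `t i`. -/
def covMatrix (t : ι → I) : Matrix ι ι ℝ := fun i j => min (t i : ℝ) (t j)

/-- The matrix is the Gram matrix of the variables `W (t i)` in L²(P): its quadratic form is a
second moment. -/
lemma IsBrownianUnit.posSemidef_covMatrix (hW : IsBrownianUnit W P) (t : ι → I) :
    (covMatrix t).PosSemidef := by
  refine Matrix.PosSemidef.of_dotProduct_mulVec_nonneg ?_ fun x => ?_
  · ext i j; simp [covMatrix, min_comm]
  · have hm := fun i => hW.memLp_two (t i)
    have : star x ⬝ᵥ (covMatrix t).mulVec x = ∫ ω, (∑ i, x i * W (t i) ω) ^ 2 ∂P := by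
      have e : ∀ ω, (∑ i, x i * W (t i) ω) ^ 2
          = ∑ i, ∑ j, x i * x j * (W (t i) ω * W (t j) ω) := by
        intro ω
        rw [sq, Finset.sum_mul_sum]
        exact Finset.sum_congr rfl fun i _ => Finset.sum_congr rfl fun j _ => by ring
      have hi : ∀ i j, Integrable (fun ω => W (t i) ω * W (t j) ω) P := fun i j =>
        (hm i).integrable_mul (hm j)
      simp_rw [e]
      rw [integral_finsetSum _ fun i _ => integrable_finsetSum _ fun j _ => (hi i j).const_mul _]
      simp only [dotProduct, Matrix.mulVec, Finset.mul_sum]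
      refine Finset.sum_congr rfl fun i _ => ?_
      rw [integral_finsetSum _ fun j _ => (hi i j).const_mul _]
      refine Finset.sum_congr rfl fun j _ => ?_
      rw [integral_const_mul, hW.integral_mul]
      simp [covMatrix]; ring
    rw [this]
    exact integral_nonneg fun ω => sq_nonneg _

/-- The values of Brownian motion at finitely many times are a linear image of a standard
Gaussian vector. -/
lemma IsBrownianUnit.exists_map_eq [DecidableEq ι] (hW : IsBrownianUnit W P) (t : ι → I) :
    ∃ A : Matrix ι ι ℝ, A * A.transpose = covMatrix t ∧
      P.map (fun ω i => W (t i) ω) = (stdGaussianPi ι).map A.mulVec := by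
  -- The covariance matrix is singular when times repeat or equal 0, so only positive
  -- semidefiniteness is used for the factorization.
  obtain ⟨B, hB⟩ : ∃ B : Matrix ι ι ℝ, covMatrix t = star B * B := by
    open scoped MatrixOrder Matrix.Norms.L2Operator in
    exact CStarAlgebra.nonneg_iff_eq_star_mul_self.mp (hW.posSemidef_covMatrix t).nonneg
  refine ⟨B.transpose, by rw [hB]; simp [Matrix.star_eq_conjTranspose], ?_⟩
  have hm : AEMeasurable (fun ω i => W (t i) ω) P :=
    aemeasurable_pi_lambda _ fun i => (hW.hasLaw_toNNReal (t i)).aemeasurable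
  have g1 : IsGaussian (P.map (fun ω i => W (t i) ω)) := by
    have := (hW.isGaussianProcess.comp_right t).hasGaussianLaw Finset.univ
    let L : (↥(Finset.univ : Finset ι) → ℝ) →L[ℝ] (ι → ℝ) :=
      ContinuousLinearMap.pi fun i => ContinuousLinearMap.proj ⟨i, Finset.mem_univ i⟩
    exact (this.map L).isGaussian_map
  have g0 : IsGaussian (stdGaussianPi ι) := by 
    have h : (stdGaussianPi ι) = (stdGaussian (EuclideanSpace ℝ ι)).map
        (PiLp.continuousLinearEquiv 2 ℝ (fun _ : ι => ℝ)).toContinuousLinearMap := by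
      rw [← map_pi_eq_stdGaussian, Measure.map_map (by fun_prop) (by fun_prop)]
      exact Measure.map_id.symm
    rw [h]; infer_instance
  have hA : (B.transpose.mulVec : (ι → ℝ) → ι → ℝ)
      = (B.transpose.mulVecLin.toContinuousLinearMap : (ι → ℝ) →L[ℝ] (ι → ℝ)) := by
    ext x i; simp [Matrix.mulVec_transpose]
  have g2 : IsGaussian ((stdGaussianPi ι).map B.transpose.mulVec) := by
    rw [hA]; infer_instance
  have hAm : AEMeasurable B.transpose.mulVec (stdGaussianPi ι) := by
    rw [hA]; fun_prop
  have hX : ∀ i, Integrable (fun x : ι → ℝ => x i) (stdGaussianPi ι) := fun i => by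
    simpa using integrable_eval_stdGaussianPi (MvPolynomial.X i : MvPolynomial ι ℝ)
  have hXX : ∀ i j, Integrable (fun x : ι → ℝ => x i * x j) (stdGaussianPi ι) := fun i j => by
    refine (integrable_eval_stdGaussianPi
      (MvPolynomial.X i * MvPolynomial.X j : MvPolynomial ι ℝ)).congr (ae_of_all _ fun x => ?_)
    simp
  have eX : ∀ i, ∫ x : ι → ℝ, x i ∂(stdGaussianPi ι) = 0 := fun i => by
    have := gaussianMean_X_mul i (1 : MvPolynomial ι ℝ)
    simpa [gaussianMean_apply] using this
  have eXX : ∀ i j, ∫ x : ι → ℝ, x i * x j ∂(stdGaussianPi ι) = if i = j then 1 else 0 :=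
    fun i j => by
      have := gaussianMean_X_mul i (MvPolynomial.X j : MvPolynomial ι ℝ)
      rw [MvPolynomial.pderiv_X] at this
      by_cases h : i = j
      · subst h
        simpa [gaussianMean_apply] using this
      · simpa [gaussianMean_apply, h, Ne.symm h] using this
  refine gaussian_ext_of_moments (fun i => ?_) (fun i => ?_) (fun i j => ?_)
  · rw [integral_map hm (measurable_pi_apply i).aestronglyMeasurable]; exact hW.integral_eq_zero _
  · rw [integral_map hAm (measurable_pi_apply i).aestronglyMeasurable]
    simp only [Matrix.mulVec, dotProduct]
    rw [integral_finsetSum _ fun j _ => (hX j).const_mul _]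
    simp [integral_const_mul, eX]
  · have hij : Measurable fun x : ι → ℝ => x i * x j :=
      (measurable_pi_apply i).mul (measurable_pi_apply j)
    rw [integral_map hm hij.aestronglyMeasurable, integral_map hAm hij.aestronglyMeasurable, hW.integral_mul]
    have e : ∀ x : ι → ℝ, B.transpose.mulVec x i * B.transpose.mulVec x j
        = ∑ k, ∑ l, B.transpose i k * B.transpose j l * (x k * x l) := by
      intro x
      simp only [Matrix.mulVec, dotProduct, Finset.sum_mul_sum, mul_mul_mul_comm]
    simp_rw [e]
    rw [integral_finsetSum _ fun k _ => integrable_finsetSum _ fun l _ => (hXX k l).const_mul _]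
    have : ∀ k, ∫ x : ι → ℝ, ∑ l, B.transpose i k * B.transpose j l * (x k * x l)
        ∂(stdGaussianPi ι) = B.transpose i k * B.transpose j k := by
      intro k
      rw [integral_finsetSum _ fun l _ => (hXX k l).const_mul _]
      simp [integral_const_mul, eXX]
    simp_rw [this]
    have := congrFun (congrFun hB i) j
    rw [covMatrix] at this
    rw [this]
    simp [Matrix.mul_apply, Matrix.star_eq_conjTranspose]

end BrownianLaw

/-! ### Step kernels, their double integrals and the dictionary with matrices. -/

section ElementaryPairs

variable {ι : Type*} [Fintype ι]

/-- Lebesgue measure on `[0,1]`. -/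
noncomputable def unitMeasure : Measure ℝ := volume.restrict (Icc 0 1)

instance : IsProbabilityMeasure unitMeasure := ⟨by simp [unitMeasure]⟩

lemma squareMeasure_eq_prod : squareMeasure = unitMeasure.prod unitMeasure := by
  rw [squareMeasure, unitMeasure, Measure.prod_restrict, Measure.volume_eq_prod]

instance : IsProbabilityMeasure squareMeasure := by
  rw [squareMeasure_eq_prod]; infer_instance

/-- The composition of two kernels on `[0,1]²`. -/
noncomputable def comp (f g : ℝ × ℝ → ℝ) (y : ℝ × ℝ) : ℝ :=
  ∫ z, f (y.1, z) * g (z, y.2) ∂unitMeasure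

/-- The indicator function of `(0, t]`. -/
noncomputable def stepFun (t : I) : ℝ → ℝ := (Ioc (0 : ℝ) t).indicator 1

lemma measurable_stepFun (t : I) : Measurable (stepFun t) :=
  measurable_one.indicator measurableSet_Ioc

lemma stepFun_mul_stepFun (s t : I) (x : ℝ) :
    stepFun s x * stepFun t x = (Ioc (0 : ℝ) (min (s : ℝ) t)).indicator 1 x := by
  simp only [stepFun, ← inter_indicator_mul, Ioc_inter_Ioc, max_self]
  simp only [Pi.one_apply, mul_one]
  rfl

lemma integral_stepFun_mul (s t : I) :
    ∫ x, stepFun s x * stepFun t x ∂unitMeasure = min (s : ℝ) t := by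
  simp_rw [stepFun_mul_stepFun]
  rw [integral_indicator_one measurableSet_Ioc, unitMeasure, measureReal_restrict_apply
    measurableSet_Ioc, inter_eq_left.2]
  · rw [Real.volume_real_Ioc_of_le (le_min s.2.1 t.2.1), sub_zero]
  · exact fun x hx => ⟨hx.1.le, hx.2.trans ((min_le_left _ _).trans s.2.2)⟩

lemma integrable_stepFun_mul (s t : I) :
    Integrable (fun x => stepFun s x * stepFun t x) unitMeasure := by
  simp_rw [stepFun_mul_stepFun]
  exact (integrable_const (1 : ℝ)).indicator measurableSet_Ioc

/-- The kernel `∑ i j, M i j * 1_{(0, t i]}(y₁) * 1_{(0, t j]}(y₂)`. -/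
noncomputable def quadKer (t : ι → I) (M : Matrix ι ι ℝ) (y : ℝ × ℝ) : ℝ :=
  ∑ i, ∑ j, M i j * (stepFun (t i) y.1 * stepFun (t j) y.2)

/-- The random variable `∑ i j, M i j * W (t i) * W (t j)`. -/
noncomputable def quadRV {Ω : Type*} (t : ι → I) (M : Matrix ι ι ℝ) (W : I → Ω → ℝ) (ω : Ω) : ℝ :=
  ∑ i, ∑ j, M i j * (W (t i) ω * W (t j) ω)

lemma measurable_quadKer (t : ι → I) (M : Matrix ι ι ℝ) : Measurable (quadKer t M) :=
  Finset.measurable_sum _ fun _ _ => Finset.measurable_sum _ fun _ _ =>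
    (((measurable_stepFun _).comp measurable_fst).mul
      ((measurable_stepFun _).comp measurable_snd)).const_mul _

lemma abs_stepFun_le (t : I) (x : ℝ) : |stepFun t x| ≤ 1 := by
  unfold stepFun
  by_cases h : x ∈ Ioc (0 : ℝ) t <;> simp [h]

lemma memLp_quadKer (t : ι → I) (M : Matrix ι ι ℝ) (p : ℝ≥0∞) :
    MemLp (quadKer t M) p squareMeasure := by
  refine MemLp.of_bound (measurable_quadKer t M).aestronglyMeasurable (∑ i, ∑ j, |M i j|)
    (ae_of_all _ fun y => ?_)
  refine (Finset.abs_sum_le_sum_abs _ _).trans (Finset.sum_le_sum fun i _ => ?_)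
  refine (Finset.abs_sum_le_sum_abs _ _).trans (Finset.sum_le_sum fun j _ => ?_)
  rw [abs_mul, abs_mul]
  have h1 := abs_stepFun_le (t i) y.1
  have h2 := abs_stepFun_le (t j) y.2
  have := mul_le_one₀ h1 (abs_nonneg _) h2
  exact mul_le_of_le_one_right (abs_nonneg _) this

lemma quadKer_eq_dotProduct (t : ι → I) (M : Matrix ι ι ℝ) (y : ℝ × ℝ) :
    quadKer t M y = (fun i => stepFun (t i) y.1) ⬝ᵥ M.mulVec fun i => stepFun (t i) y.2 := by
  simp only [quadKer, dotProduct, Matrix.mulVec, Finset.mul_sum]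
  exact Finset.sum_congr rfl fun i _ => Finset.sum_congr rfl fun j _ => by ring

/-- Integrating out the middle variable pairs step functions, whose inner products are the entries
of `covMatrix`. Composition is therefore the product of matrices twisted by the covariance, the same
twist that appears when forms are conjugated by a factor A with A Aᵀ equal to the covariance. -/
lemma comp_quadKer (t : ι → I) (M N : Matrix ι ι ℝ) :
    comp (quadKer t M) (quadKer t N) = quadKer t (M * covMatrix t * N) := by
  ext y
  have e : ∀ z, quadKer t M (y.1, z) * quadKer t N (z, y.2) = ∑ i, ∑ j,
      ((Matrix.vecMul (fun i => stepFun (t i) y.1) M) i *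
        (N.mulVec fun i => stepFun (t i) y.2) j) * (stepFun (t i) z * stepFun (t j) z) := by
    intro z
    rw [quadKer_eq_dotProduct, quadKer_eq_dotProduct, Matrix.dotProduct_mulVec]
    simp only [dotProduct, Finset.sum_mul_sum]
    exact Finset.sum_congr rfl fun i _ => Finset.sum_congr rfl fun j _ => by ring
  have hi := fun i j => integrable_stepFun_mul (t i) (t j)
  simp only [comp, e]
  rw [integral_finsetSum _ fun i _ => integrable_finsetSum _ fun j _ => (hi i j).const_mul _,
    quadKer_eq_dotProduct, ← Matrix.mulVec_mulVec, ← Matrix.mulVec_mulVec, Matrix.dotProduct_mulVec]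
  rw [dotProduct]
  refine Finset.sum_congr rfl fun i _ => ?_
  rw [integral_finsetSum _ fun j _ => (hi i j).const_mul _, Matrix.mulVec, dotProduct,
    Finset.mul_sum]
  refine Finset.sum_congr rfl fun j _ => ?_
  rw [integral_const_mul, integral_stepFun_mul, covMatrix]
  ring

/-- The Hilbert–Schmidt pairing factorizes in the two variables, and each variable contributes one
covariance matrix. -/
lemma integral_quadKer_mul (t : ι → I) (M N : Matrix ι ι ℝ) :
    ∫ y, quadKer t M y * quadKer t N y ∂squareMeasure
      = (M * covMatrix t * N.transpose * covMatrix t).trace := by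
  have e : ∀ y : ℝ × ℝ, quadKer t M y * quadKer t N y = ∑ i, ∑ k, ∑ j, ∑ l, (M i j * N k l) *
      ((stepFun (t i) y.1 * stepFun (t k) y.1) * (stepFun (t j) y.2 * stepFun (t l) y.2)) := by
    intro y
    simp only [quadKer, Finset.sum_mul_sum]
    refine Finset.sum_congr rfl fun i _ => Finset.sum_congr rfl fun k _ =>
      Finset.sum_congr rfl fun j _ => Finset.sum_congr rfl fun l _ => ?_
    ring
  have hi : ∀ i j k l, Integrable (fun y : ℝ × ℝ => (stepFun (t i) y.1 * stepFun (t k) y.1) *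
      (stepFun (t j) y.2 * stepFun (t l) y.2)) (unitMeasure.prod unitMeasure) := fun i j k l =>
    (integrable_stepFun_mul (t i) (t k)).mul_prod (integrable_stepFun_mul (t j) (t l))
  have hv : ∀ i j k l, ∫ y : ℝ × ℝ, (stepFun (t i) y.1 * stepFun (t k) y.1) *
      (stepFun (t j) y.2 * stepFun (t l) y.2) ∂(unitMeasure.prod unitMeasure)
      = covMatrix t i k * covMatrix t j l := by
    intro i j k l
    rw [integral_prod_mul (fun x => stepFun (t i) x * stepFun (t k) x)
      (fun x => stepFun (t j) x * stepFun (t l) x), integral_stepFun_mul, integral_stepFun_mul]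
    rfl
  simp only [e, squareMeasure_eq_prod]
  rw [integral_finsetSum _ fun i _ => integrable_finsetSum _ fun k _ => integrable_finsetSum _
    fun j _ => integrable_finsetSum _ fun l _ => (hi i j k l).const_mul _]
  rw [Matrix.mul_assoc, Matrix.mul_assoc]
  simp only [Matrix.trace, Matrix.diag, Matrix.mul_apply, Finset.mul_sum,
    Matrix.transpose_apply]
  refine Finset.sum_congr rfl fun i _ => ?_
  rw [integral_finsetSum _ fun k _ => integrable_finsetSum _
    fun j _ => integrable_finsetSum _ fun l _ => (hi i j k l).const_mul _]
  have e2 : ∀ k, ∫ y : ℝ × ℝ, ∑ j, ∑ l, (M i j * N k l) *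
      ((stepFun (t i) y.1 * stepFun (t k) y.1) * (stepFun (t j) y.2 * stepFun (t l) y.2))
      ∂(unitMeasure.prod unitMeasure)
      = ∑ j, ∑ l, M i j * (covMatrix t j l * (N k l * covMatrix t k i)) := by
    intro k
    rw [integral_finsetSum _
      fun j _ => integrable_finsetSum _ fun l _ => (hi i j k l).const_mul _]
    refine Finset.sum_congr rfl fun j _ => ?_
    rw [integral_finsetSum _ fun l _ => (hi i j k l).const_mul _]
    refine Finset.sum_congr rfl fun l _ => ?_
    rw [integral_const_mul, hv, show covMatrix t i k = covMatrix t k i from min_comm _ _]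
    ring
  simp only [e2]
  rw [Finset.sum_comm]
  exact Finset.sum_congr rfl fun j _ => Finset.sum_comm

variable {Ω : Type*} [MeasurableSpace Ω] {P : Measure Ω} {W : I → Ω → ℝ}

omit [Fintype ι] in
lemma eval_aeval {τ : Type*} (x : ι → ℝ) (g : τ → MvPolynomial ι ℝ) (p : MvPolynomial τ ℝ) :
    MvPolynomial.eval x (MvPolynomial.aeval g p)
      = MvPolynomial.eval (fun M => MvPolynomial.eval x (g M)) p := by
  induction p using MvPolynomial.induction_on with
  | C a => simp
  | add p q hp hq => rw [map_add, map_add, hp, hq, map_add]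
  | mul_X p i hp => simp only [map_mul, hp, MvPolynomial.aeval_X, MvPolynomial.eval_X]

lemma eval_quadPoly (M : Matrix ι ι ℝ) (x : ι → ℝ) :
    MvPolynomial.eval x (quadPoly M) = ∑ i, ∑ j, M i j * (x i * x j) := by
  simp [quadPoly, mul_assoc]

lemma eval_quadPoly_mulVec (M A : Matrix ι ι ℝ) (x : ι → ℝ) :
    MvPolynomial.eval (A.mulVec x) (quadPoly M)
      = MvPolynomial.eval x (quadPoly (A.transpose * M * A)) := by
  have h : ∀ (B : Matrix ι ι ℝ) (z : ι → ℝ), MvPolynomial.eval z (quadPoly B)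
      = z ⬝ᵥ B.mulVec z := by
    intro B z
    rw [eval_quadPoly]
    simp only [dotProduct, Matrix.mulVec, Finset.mul_sum]
    exact Finset.sum_congr rfl fun i _ => Finset.sum_congr rfl fun j _ => by ring
  rw [h, h, ← Matrix.mulVec_mulVec, ← Matrix.mulVec_mulVec, Matrix.dotProduct_mulVec x,
    Matrix.vecMul_transpose]

variable [DecidableEq ι]

/-- Expectations of polynomials in Brownian quadratic forms reduce to Gaussian means. -/
lemma IsBrownianUnit.exists_gaussian_repr (hW : IsBrownianUnit W P) (t : ι → I) :
    ∃ A : Matrix ι ι ℝ, A * A.transpose = covMatrix t ∧ ∀ p : MvPolynomial (Matrix ι ι ℝ) ℝ,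
      Integrable (fun ω => MvPolynomial.eval (fun M => quadRV t M W ω) p) P ∧
      ∫ ω, MvPolynomial.eval (fun M => quadRV t M W ω) p ∂P =
        gaussianMean (MvPolynomial.aeval (fun M => quadPoly (A.transpose * M * A)) p) := by
  obtain ⟨A, hA, hmap⟩ := hW.exists_map_eq t
  refine ⟨A, hA, fun p => ?_⟩
  have hm : AEMeasurable (fun ω i => W (t i) ω) P :=
    aemeasurable_pi_lambda _ fun i => (hW.hasLaw_toNNReal (t i)).aemeasurable
  have hAm : Measurable A.mulVec := by
    have : (A.mulVec : (ι → ℝ) → ι → ℝ)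
        = (A.mulVecLin.toContinuousLinearMap : (ι → ℝ) →L[ℝ] (ι → ℝ)) := by
      ext x i; simp
    rw [this]; fun_prop
  set F : (ι → ℝ) → ℝ := fun x =>
    MvPolynomial.eval x (MvPolynomial.aeval (fun M => quadPoly M) p) with hF
  have hFm : Continuous F := MvPolynomial.continuous_eval _
  have e1 : ∀ ω, MvPolynomial.eval (fun M => quadRV t M W ω) p = F fun i => W (t i) ω := by
    intro ω
    simp only [hF, eval_aeval, eval_quadPoly]
    rfl
  have e2 : ∀ x, F (A.mulVec x) = MvPolynomial.eval x
      (MvPolynomial.aeval (fun M => quadPoly (A.transpose * M * A)) p) := by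
    intro x
    simp only [hF, eval_aeval, eval_quadPoly_mulVec]
  simp_rw [e1]
  constructor
  · have : Integrable F (P.map fun ω i => W (t i) ω) := by
      rw [hmap, integrable_map_measure hFm.aestronglyMeasurable hAm.aemeasurable]
      simp only [Function.comp_def, e2]
      exact integrable_eval_stdGaussianPi _
    exact this.comp_aemeasurable hm
  · rw [← integral_map hm hFm.aestronglyMeasurable, hmap,
      integral_map hAm.aemeasurable hFm.aestronglyMeasurable, gaussianMean_apply]
    simp_rw [e2]

/-- `(k, X)` is an elementary pair if `X` is the double Wiener integral of the symmetric
step kernel `k`. -/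
def IsElemPair (W : I → Ω → ℝ) (k : ℝ × ℝ → ℝ) (X : Ω → ℝ) : Prop :=
  ∃ (ι : Type) (_ : Fintype ι) (_ : DecidableEq ι) (t : ι → I) (M : Matrix ι ι ℝ),
    M.IsSymm ∧ (M * covMatrix t).trace = 0 ∧ k = quadKer t M ∧ X = quadRV t M W

omit [MeasurableSpace Ω] in
/-- Two elementary pairs can be written with the same times. -/
lemma IsElemPair.exists_common {k l : ℝ × ℝ → ℝ} {X Y : Ω → ℝ} (h : IsElemPair W k X)
    (h' : IsElemPair W l Y) :
    ∃ (ι : Type) (_ : Fintype ι) (_ : DecidableEq ι) (t : ι → I) (M N : Matrix ι ι ℝ),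
      M.IsSymm ∧ (M * covMatrix t).trace = 0 ∧ k = quadKer t M ∧ X = quadRV t M W ∧
      N.IsSymm ∧ (N * covMatrix t).trace = 0 ∧ l = quadKer t N ∧ Y = quadRV t N W := by
  obtain ⟨ι₁, _, _, t₁, M, hM, hM0, rfl, rfl⟩ := h
  obtain ⟨ι₂, _, _, t₂, N, hN, hN0, rfl, rfl⟩ := h'
  have hC : covMatrix (Sum.elim t₁ t₂) = Matrix.fromBlocks (covMatrix t₁)
      (Matrix.of fun i j => min (t₁ i : ℝ) (t₂ j))
      (Matrix.of fun i j => min (t₂ i : ℝ) (t₁ j)) (covMatrix t₂) := by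
    ext i j
    rcases i with i | i <;> rcases j with j | j <;> rfl
  -- Both families of times are placed on a disjoint union and the matrices are padded by zeros;
  -- covariances between the two families then never enter the trace conditions.
  refine ⟨ι₁ ⊕ ι₂, inferInstance, inferInstance, Sum.elim t₁ t₂, Matrix.fromBlocks M 0 0 0,
    Matrix.fromBlocks 0 0 0 N, ?_, ?_, ?_, ?_, ?_, ?_, ?_, ?_⟩
  · exact hM.fromBlocks (by simp) (by simp [Matrix.IsSymm])
  · rw [hC, Matrix.fromBlocks_multiply]; simpa [Matrix.trace] using hM0
  · ext y; simp [quadKer]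
  · ext y; simp [quadRV]
  · exact Matrix.IsSymm.fromBlocks (by simp [Matrix.IsSymm]) (by simp) hN
  · rw [hC, Matrix.fromBlocks_multiply]; simpa [Matrix.trace] using hN0
  · ext y; simp [quadKer]
  · ext y; simp [quadRV]

omit [MeasurableSpace Ω] in
lemma IsElemPair.sub {k l : ℝ × ℝ → ℝ} {X Y : Ω → ℝ} (h : IsElemPair W k X)
    (h' : IsElemPair W l Y) : IsElemPair W (fun y => k y - l y) (fun ω => X ω - Y ω) := by
  obtain ⟨ι, _, _, t, M, N, hM, hM0, rfl, rfl, hN, hN0, rfl, rfl⟩ := h.exists_common h'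
  refine ⟨ι, inferInstance, inferInstance, t, M - N, hM.sub hN, ?_, ?_, ?_⟩
  · rw [Matrix.sub_mul, Matrix.trace_sub, hM0, hN0, sub_zero]
  · ext y; simp [quadKer, sub_mul]
  · ext y; simp [quadRV, sub_mul]

omit [MeasurableSpace Ω] in
lemma IsElemPair.memLp {k : ℝ × ℝ → ℝ} {X : Ω → ℝ} (h : IsElemPair W k X) (p : ℝ≥0∞) :
    MemLp k p squareMeasure := by
  obtain ⟨ι, _, _, t, M, hM, hM0, rfl, rfl⟩ := h
  exact memLp_quadKer t M p

/-- Moments of elementary double Wiener integrals. -/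
lemma IsElemPair.moments (hW : IsBrownianUnit W P) {k l : ℝ × ℝ → ℝ} {X Y : Ω → ℝ}
    (h : IsElemPair W k X) (h' : IsElemPair W l Y) :
    Integrable (fun ω => X ω ^ 4) P ∧ ∫ ω, X ω ∂P = 0 ∧
    ∫ ω, X ω * Y ω ∂P = 2 * ∫ y, k y * l y ∂squareMeasure ∧
    ∫ ω, X ω ^ 2 * Y ω ∂P = 8 * ∫ y, comp k k y * l y ∂squareMeasure ∧
    ∫ ω, X ω ^ 2 * Y ω ^ 2 ∂P =
      4 * (∫ y, k y * k y ∂squareMeasure) * (∫ y, l y * l y ∂squareMeasure) +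
      8 * (∫ y, k y * l y ∂squareMeasure) ^ 2 +
      32 * ∫ y, comp k k y * comp l l y ∂squareMeasure +
      16 * ∫ y, comp k l y * comp l k y ∂squareMeasure := by
  obtain ⟨ι, _, _, t, M, N, hM, hM0, rfl, rfl, hN, hN0, rfl, rfl⟩ := h.exists_common h'
  obtain ⟨A, hA, hp⟩ := hW.exists_gaussian_repr t
  have hS : ∀ B : Matrix ι ι ℝ, B.IsSymm → (A.transpose * B * A).IsSymm := by
    intro B hB
    simp [Matrix.IsSymm, Matrix.mul_assoc, hB.eq]
  have hT : ∀ B : Matrix ι ι ℝ, (A.transpose * B * A).trace = (B * covMatrix t).trace := by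
    intro B
    rw [← hA, Matrix.mul_assoc, Matrix.trace_mul_comm, Matrix.mul_assoc]
  -- Conjugation by the factor A turns the twisted product into the ordinary one, so every trace in
  -- the Gaussian formulas becomes an integral of composed kernels.
  have hMul : ∀ B D : Matrix ι ι ℝ, A.transpose * B * A * (A.transpose * D * A)
      = A.transpose * (B * covMatrix t * D) * A := by
    intro B D
    rw [← hA]; simp only [Matrix.mul_assoc]
  have hM' := hT M ▸ hM0
  have hN' := hT N ▸ hN0
  have hCs : (covMatrix t).transpose = covMatrix t := by
    ext i j; exact min_comm _ _
  refine ⟨?_, ?_, ?_, ?_, ?_⟩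
  · refine (hp (MvPolynomial.X M ^ 4)).1.congr (ae_of_all _ fun ω => ?_)
    simp
  · have := (hp (MvPolynomial.X M)).2
    simp only [MvPolynomial.eval_X, MvPolynomial.aeval_X, gaussianMean_quadPoly] at this
    rw [this, hM']
  · have := (hp (MvPolynomial.X M * MvPolynomial.X N)).2
    simp only [map_mul, MvPolynomial.eval_X, MvPolynomial.aeval_X] at this
    rw [this, gaussianMean_quadPoly_mul_quadPoly _ _ (hS N hN) hN', hMul, hT,
      integral_quadKer_mul, hN.eq]
  · have := (hp (MvPolynomial.X M * (MvPolynomial.X M * MvPolynomial.X N))).2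
    simp only [map_mul, MvPolynomial.eval_X, MvPolynomial.aeval_X] at this
    have e : ∀ ω, quadRV t M W ω ^ 2 * quadRV t N W ω
        = quadRV t M W ω * (quadRV t M W ω * quadRV t N W ω) := fun ω => by ring
    simp_rw [e]
    rw [this, gaussianMean_quadPoly_mul_mul _ _ _ (hS M hM) hM' (hS N hN) hN', hM', comp_quadKer,
      integral_quadKer_mul, hN.eq]
    simp only [hMul, hT]
    -- The two traces in the third moment agree by cyclicity, which accounts for the coefficient 8 =
    -- 4 + 4.
    have : (N * covMatrix t * M * covMatrix t * M * covMatrix t).trace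
        = (M * covMatrix t * M * covMatrix t * N * covMatrix t).trace := by
      simp only [Matrix.mul_assoc]
      rw [Matrix.trace_mul_comm, Matrix.mul_assoc, Matrix.mul_assoc, Matrix.mul_assoc,
        Matrix.mul_assoc, Matrix.trace_mul_comm]
      simp only [Matrix.mul_assoc]
    rw [this]
    ring
  · have := (hp (MvPolynomial.X M * (MvPolynomial.X M * (MvPolynomial.X N * MvPolynomial.X N)))).2
    simp only [map_mul, MvPolynomial.eval_X, MvPolynomial.aeval_X] at this
    have e : ∀ ω, quadRV t M W ω ^ 2 * quadRV t N W ω ^ 2 = quadRV t M W ω *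
        (quadRV t M W ω * (quadRV t N W ω * quadRV t N W ω)) := fun ω => by ring
    simp_rw [e]
    rw [this, gaussianMean_sq_mul_sq _ _ (hS M hM) hM' (hS N hN) hN']
    simp only [comp_quadKer, integral_quadKer_mul, hMul, hT, hN.eq, hM.eq, Matrix.transpose_mul,
      hCs]
    simp only [Matrix.mul_assoc]

end ElementaryPairs

/-! ### Composition of square-integrable kernels and its continuity. -/

section Composition

/-- The integrand of a composition lives on triples (y₁, y₂, z). This projection and the one to (z,
y₂) preserve measure, so a.e. identities and L² bounds on the square lift to triples and return to
slices by Fubini. -/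
lemma measurePreserving_fst_third : MeasurePreserving (fun p : (ℝ × ℝ) × ℝ => (p.1.1, p.2))
    (squareMeasure.prod unitMeasure) squareMeasure := by
  simp only [squareMeasure_eq_prod]
  exact measurePreserving_fst.prod (MeasurePreserving.id _)

lemma measurePreserving_third_snd : MeasurePreserving (fun p : (ℝ × ℝ) × ℝ => (p.2, p.1.2))
    (squareMeasure.prod unitMeasure) squareMeasure := by
  simp only [squareMeasure_eq_prod]
  exact Measure.measurePreserving_swap.comp (measurePreserving_snd.prod (MeasurePreserving.id _))

lemma comp_congr_ae {f f' g g' : ℝ × ℝ → ℝ} (hf : f =ᵐ[squareMeasure] f')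
    (hg : g =ᵐ[squareMeasure] g') : comp f g =ᵐ[squareMeasure] comp f' g' := by
  have h1 := measurePreserving_fst_third.quasiMeasurePreserving.ae_eq_comp hf
  have h2 := measurePreserving_third_snd.quasiMeasurePreserving.ae_eq_comp hg
  filter_upwards [Measure.ae_ae_of_ae_prod (h1.and h2)] with y hy
  refine integral_congr_ae ?_
  filter_upwards [hy] with z hz
  simp only [Function.comp_apply] at hz
  rw [hz.1, hz.2]

lemma integrable_comp_integrand {f g : ℝ × ℝ → ℝ} (hf : MemLp f 2 squareMeasure)
    (hg : MemLp g 2 squareMeasure) :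
    Integrable (fun p : (ℝ × ℝ) × ℝ => f (p.1.1, p.2) * g (p.2, p.1.2))
      (squareMeasure.prod unitMeasure) :=
  (hf.comp_measurePreserving measurePreserving_fst_third).integrable_mul
    (hg.comp_measurePreserving measurePreserving_third_snd)

lemma ae_integrable_comp {f g : ℝ × ℝ → ℝ} (hf : MemLp f 2 squareMeasure)
    (hg : MemLp g 2 squareMeasure) :
    ∀ᵐ y ∂squareMeasure, Integrable (fun z => f (y.1, z) * g (z, y.2)) unitMeasure :=
  (integrable_comp_integrand hf hg).prod_right_ae

lemma aestronglyMeasurable_comp {f g : ℝ × ℝ → ℝ} (hf : MemLp f 2 squareMeasure)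
    (hg : MemLp g 2 squareMeasure) : AEStronglyMeasurable (comp f g) squareMeasure :=
  (integrable_comp_integrand hf hg).aestronglyMeasurable.integral_prod_right'

lemma eLpNorm_two_sq {α : Type*} [MeasurableSpace α] (μ : Measure α) (f : α → ℝ) :
    eLpNorm f 2 μ ^ 2 = ∫⁻ x, ‖f x‖ₑ ^ 2 ∂μ := by
  have := eLpNorm_nnreal_pow_eq_lintegral (f := f) (μ := μ) (p := 2) (by norm_num)
  simpa using this

/-- The Hilbert–Schmidt norm is submultiplicative. -/
lemma eLpNorm_comp_le {f g : ℝ × ℝ → ℝ} (hf : MemLp f 2 squareMeasure)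
    (hg : MemLp g 2 squareMeasure) :
    eLpNorm (comp f g) 2 squareMeasure ≤ eLpNorm f 2 squareMeasure * eLpNorm g 2 squareMeasure := by
  -- Measurable representatives make every slice measurable, as the pointwise Cauchy–Schwarz bound
  -- and Tonelli require.
  wlog hm : Measurable f ∧ Measurable g generalizing f g
  · have e1 := hf.1.ae_eq_mk
    have e2 := hg.1.ae_eq_mk
    have := this (f := hf.1.mk f) (g := hg.1.mk g) (hf.ae_eq e1) (hg.ae_eq e2)
      ⟨hf.1.stronglyMeasurable_mk.measurable, hg.1.stronglyMeasurable_mk.measurable⟩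
    rwa [← eLpNorm_congr_ae (comp_congr_ae e1 e2), ← eLpNorm_congr_ae e1,
      ← eLpNorm_congr_ae e2] at this
  obtain ⟨mf, mg⟩ := hm
  rw [← ENNReal.pow_le_pow_left_iff two_ne_zero, mul_pow, eLpNorm_two_sq, eLpNorm_two_sq,
    eLpNorm_two_sq]
  -- Cauchy–Schwarz in the middle variable; the bound is a function of y₁ times a function of y₂, so
  -- its integral over the square factorizes.
  have cs : ∀ y : ℝ × ℝ, ‖comp f g y‖ₑ ^ 2 ≤
      (∫⁻ z, ‖f (y.1, z)‖ₑ ^ 2 ∂unitMeasure) * ∫⁻ z, ‖g (z, y.2)‖ₑ ^ 2 ∂unitMeasure := by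
    intro y
    have h1 : ‖comp f g y‖ₑ ≤ ∫⁻ z, ‖f (y.1, z)‖ₑ * ‖g (z, y.2)‖ₑ ∂unitMeasure := by
      refine (enorm_integral_le_lintegral_enorm _).trans_eq ?_
      simp_rw [enorm_mul]
    have h2 := ENNReal.lintegral_mul_le_Lp_mul_Lq unitMeasure Real.HolderConjugate.two_two
      (f := fun z => ‖f (y.1, z)‖ₑ) (g := fun z => ‖g (z, y.2)‖ₑ)
      (by fun_prop) (by fun_prop)
    have h3 := h1.trans h2
    calc ‖comp f g y‖ₑ ^ 2 ≤ _ := pow_le_pow_left₀ zero_le h3 2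
      _ = _ := by
        rw [mul_pow, ← ENNReal.rpow_natCast, ← ENNReal.rpow_natCast, ← ENNReal.rpow_mul,
          ← ENNReal.rpow_mul]
        simp
  refine (lintegral_mono cs).trans_eq ?_
  simp only [squareMeasure_eq_prod]
  rw [lintegral_prod_mul (f := fun a => ∫⁻ z, ‖f (a, z)‖ₑ ^ 2 ∂unitMeasure)
    (g := fun b => ∫⁻ z, ‖g (z, b)‖ₑ ^ 2 ∂unitMeasure)
    (Measurable.lintegral_prod_right' (f := fun p : ℝ × ℝ => ‖f p‖ₑ ^ 2) (by fun_prop)).aemeasurable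
    (Measurable.lintegral_prod_left' (f := fun p : ℝ × ℝ => ‖g p‖ₑ ^ 2) (by fun_prop)).aemeasurable,
    lintegral_prod _ (by fun_prop), lintegral_prod_symm _ (by fun_prop)]

lemma memLp_comp {f g : ℝ × ℝ → ℝ} (hf : MemLp f 2 squareMeasure)
    (hg : MemLp g 2 squareMeasure) : MemLp (comp f g) 2 squareMeasure :=
  ⟨aestronglyMeasurable_comp hf hg,
    (eLpNorm_comp_le hf hg).trans_lt (ENNReal.mul_lt_top hf.2 hg.2)⟩

/-- Bilinearity in telescoping form. It holds only almost everywhere because the slices must be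
integrable before the integrals can be split. -/
lemma comp_sub_comp_ae {f f' g g' : ℝ × ℝ → ℝ} (hf : MemLp f 2 squareMeasure)
    (hf' : MemLp f' 2 squareMeasure) (hg : MemLp g 2 squareMeasure)
    (hg' : MemLp g' 2 squareMeasure) :
    (fun y => comp f g y - comp f' g' y) =ᵐ[squareMeasure]
      comp (fun y => f y - f' y) g + comp f' (fun y => g y - g' y) := by
  filter_upwards [ae_integrable_comp hf hg, ae_integrable_comp hf' hg, ae_integrable_comp hf' hg']
    with y h1 h2 h3
  simp only [comp, Pi.add_apply, sub_mul, mul_sub]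
  rw [integral_sub h1 h2, integral_sub h2 h3]
  ring

lemma tendsto_eLpNorm_of_sub {α : Type*} [MeasurableSpace α] {μ : Measure α} {p : ℝ≥0∞}
    (hp : 1 ≤ p) {u : ℕ → α → ℝ} {v : α → ℝ} (hu : ∀ n, MemLp (u n) p μ) (hv : MemLp v p μ)
    (h : Tendsto (fun n => eLpNorm (fun x => u n x - v x) p μ) atTop (𝓝 0)) :
    Tendsto (fun n => eLpNorm (u n) p μ) atTop (𝓝 (eLpNorm v p μ)) := by
  have h1 : Tendsto (fun n => eLpNorm v p μ + eLpNorm (fun x => u n x - v x) p μ) atTop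
      (𝓝 (eLpNorm v p μ)) := by simpa using h.const_add (eLpNorm v p μ)
  have h2 : Tendsto (fun n => eLpNorm v p μ - eLpNorm (fun x => u n x - v x) p μ) atTop
      (𝓝 (eLpNorm v p μ)) := by
    simpa using ENNReal.Tendsto.sub tendsto_const_nhds h (Or.inl hv.2.ne)
  refine tendsto_of_tendsto_of_tendsto_of_le_of_le h2 h1 (fun n => ?_) (fun n => ?_)
  · rw [tsub_le_iff_right]
    calc eLpNorm v p μ = eLpNorm (u n - fun x => u n x - v x) p μ := by
          congr 1; ext x; simp
      _ ≤ _ := eLpNorm_sub_le (hu n).1 ((hu n).1.sub hv.1) hp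
  · calc eLpNorm (u n) p μ = eLpNorm (v + fun x => u n x - v x) p μ := by
          congr 1; ext x; simp
      _ ≤ _ := eLpNorm_add_le hv.1 ((hu n).1.sub hv.1) hp

lemma tendsto_mul_add_mul {a b c d : ℕ → ℝ≥0∞} {x y : ℝ≥0∞} (hx : x ≠ ∞) (hy : y ≠ ∞)
    (ha : Tendsto a atTop (𝓝 0)) (hb : Tendsto b atTop (𝓝 x)) (hc : Tendsto c atTop (𝓝 y))
    (hd : Tendsto d atTop (𝓝 0)) : Tendsto (fun n => a n * b n + c n * d n) atTop (𝓝 0) := by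
  have h1 := ENNReal.Tendsto.mul ha (Or.inr hx) hb (Or.inr ENNReal.zero_ne_top)
  have h2 := ENNReal.Tendsto.mul hc (Or.inr ENNReal.zero_ne_top) hd (Or.inr hy)
  simpa using h1.add h2

lemma tendsto_comp {f g : ℕ → ℝ × ℝ → ℝ} {f₀ g₀ : ℝ × ℝ → ℝ}
    (hf : ∀ n, MemLp (f n) 2 squareMeasure) (hg : ∀ n, MemLp (g n) 2 squareMeasure)
    (hf₀ : MemLp f₀ 2 squareMeasure) (hg₀ : MemLp g₀ 2 squareMeasure)
    (h1 : Tendsto (fun n => eLpNorm (fun y => f n y - f₀ y) 2 squareMeasure) atTop (𝓝 0))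
    (h2 : Tendsto (fun n => eLpNorm (fun y => g n y - g₀ y) 2 squareMeasure) atTop (𝓝 0)) :
    Tendsto (fun n => eLpNorm (fun y => comp (f n) (g n) y - comp f₀ g₀ y) 2 squareMeasure)
      atTop (𝓝 0) := by
  refine tendsto_of_tendsto_of_tendsto_of_le_of_le tendsto_const_nhds
    (tendsto_mul_add_mul hg₀.2.ne hf₀.2.ne h1
      (tendsto_eLpNorm_of_sub one_le_two hg hg₀ h2) tendsto_const_nhds h2)
    (fun n => zero_le) (fun n => ?_)
  simp only
  rw [eLpNorm_congr_ae (comp_sub_comp_ae (hf n) hf₀ (hg n) hg₀)]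
  refine (eLpNorm_add_le (aestronglyMeasurable_comp ((hf n).sub hf₀) (hg n))
    (aestronglyMeasurable_comp hf₀ ((hg n).sub hg₀)) one_le_two).trans ?_
  exact add_le_add (eLpNorm_comp_le ((hf n).sub hf₀) (hg n))
    (eLpNorm_comp_le hf₀ ((hg n).sub hg₀))

/-- The difference of products telescopes and Hölder's inequality bounds each piece. It serves with
exponents (2, 2; 1) for integrals of products and (4, 4; 2) for squares of double integrals. -/
lemma tendsto_eLpNorm_mul_sub_mul {α : Type*} [MeasurableSpace α] {μ : Measure α} {p q r : ℝ≥0∞}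
    [p.HolderTriple q r] (hq : 1 ≤ q) (hr : 1 ≤ r)
    {u v : ℕ → α → ℝ} {u₀ v₀ : α → ℝ} (hu : ∀ n, MemLp (u n) p μ) (hv : ∀ n, MemLp (v n) q μ)
    (hu₀ : MemLp u₀ p μ) (hv₀ : MemLp v₀ q μ)
    (h1 : Tendsto (fun n => eLpNorm (fun x => u n x - u₀ x) p μ) atTop (𝓝 0))
    (h2 : Tendsto (fun n => eLpNorm (fun x => v n x - v₀ x) q μ) atTop (𝓝 0)) :
    Tendsto (fun n => eLpNorm (fun x => u n x * v n x - u₀ x * v₀ x) r μ) atTop (𝓝 0) := by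
  refine tendsto_of_tendsto_of_tendsto_of_le_of_le tendsto_const_nhds
    (tendsto_mul_add_mul hv₀.2.ne hu₀.2.ne h1
      (tendsto_eLpNorm_of_sub hq hv hv₀ h2) tendsto_const_nhds h2)
    (fun n => zero_le) (fun n => ?_)
  have e : (fun x => u n x * v n x - u₀ x * v₀ x)
      = (fun x => u n x - u₀ x) • v n + u₀ • fun x => v n x - v₀ x := by
    ext x; simp; ring
  simp only [e]
  have m1 := (hu n).1.sub hu₀.1
  have m2 := (hv n).1.sub hv₀.1
  refine (eLpNorm_add_le (m1.smul (hv n).1) (hu₀.1.smul m2) hr).trans ?_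
  exact add_le_add (eLpNorm_smul_le_mul_eLpNorm (hv n).1 m1) (eLpNorm_smul_le_mul_eLpNorm m2 hu₀.1)

lemma tendsto_integral_mul {α : Type*} [MeasurableSpace α] {μ : Measure α}
    {u v : ℕ → α → ℝ} {u₀ v₀ : α → ℝ} (hu : ∀ n, MemLp (u n) 2 μ) (hv : ∀ n, MemLp (v n) 2 μ)
    (hu₀ : MemLp u₀ 2 μ) (hv₀ : MemLp v₀ 2 μ)
    (h1 : Tendsto (fun n => eLpNorm (fun x => u n x - u₀ x) 2 μ) atTop (𝓝 0))
    (h2 : Tendsto (fun n => eLpNorm (fun x => v n x - v₀ x) 2 μ) atTop (𝓝 0)) :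
    Tendsto (fun n => ∫ x, u n x * v n x ∂μ) atTop (𝓝 (∫ x, u₀ x * v₀ x ∂μ)) :=
  tendsto_integral_of_L1' _ (hu₀.integrable_mul hv₀).1
    (Eventually.of_forall fun n => (hu n).integrable_mul (hv n))
    (tendsto_eLpNorm_mul_sub_mul one_le_two le_rfl hu hv hu₀ hv₀ h1 h2)

end Composition

/-! ### Moments of double Wiener integrals, by approximation. -/

section DoubleWiener

variable {Ω : Type*} [MeasurableSpace Ω] {P : Measure Ω} {W : I → Ω → ℝ}

/-- `X` is an `L²` limit of elementary double Wiener integrals whose symmetric kernels converge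
to `f`. -/
def IsSymmDoubleWiener (W : I → Ω → ℝ) (P : Measure Ω) (f : ℝ × ℝ → ℝ) (X : Ω → ℝ) : Prop :=
  MemLp f 2 squareMeasure ∧ MemLp X 2 P ∧
    ∃ (k : ℕ → ℝ × ℝ → ℝ) (Y : ℕ → Ω → ℝ), (∀ n, IsElemPair W (k n) (Y n)) ∧
      Tendsto (fun n => eLpNorm (fun y => k n y - f y) 2 squareMeasure) atTop (𝓝 0) ∧
      Tendsto (fun n => eLpNorm (fun ω => Y n ω - X ω) 2 P) atTop (𝓝 0)

lemma IsElemPair.memLp_four (hW : IsBrownianUnit W P) {k : ℝ × ℝ → ℝ} {X : Ω → ℝ}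
    (h : IsElemPair W k X) : MemLp X 4 P := by
  have hi := (h.moments hW h).1
  have hm : AEStronglyMeasurable X P := by
    obtain ⟨ι, _, _, t, M, hM, hM0, rfl, rfl⟩ := h
    have : quadRV t M W = fun ω => ∑ i, ∑ j, M i j * (W (t i) ω * W (t j) ω) := rfl
    rw [this]
    refine Finset.aestronglyMeasurable_fun_sum _ fun i _ =>
      Finset.aestronglyMeasurable_fun_sum _ fun j _ => ?_
    exact ((hW.memLp_two _).1.mul (hW.memLp_two _).1).const_mul _
  rw [← integrable_norm_rpow_iff hm (by norm_num) (by norm_num)]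
  refine hi.congr (ae_of_all _ fun ω => ?_)
  have : (4 : ℝ≥0∞).toReal = ((4 : ℕ) : ℝ) := by norm_num
  simp only [this]
  rw [Real.rpow_natCast, Real.norm_eq_abs, Even.pow_abs (by decide)]

lemma integral_mul_self_eq_eLpNorm {α : Type*} [MeasurableSpace α] {μ : Measure α} {f : α → ℝ}
    (hf : MemLp f 2 μ) : ENNReal.ofReal (∫ x, f x * f x ∂μ) = eLpNorm f 2 μ ^ 2 := by
  rw [eLpNorm_two_sq, ofReal_integral_eq_lintegral_ofReal (f := fun x => f x * f x) (hf.integrable_mul hf)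
    (ae_of_all _ fun x => mul_self_nonneg _)]
  refine lintegral_congr fun x => ?_
  rw [← sq, ← sq_abs, ENNReal.ofReal_pow (abs_nonneg _), Real.enorm_eq_ofReal_abs]

/-- Hypercontractivity in the second chaos, for elementary integrals. -/
lemma IsElemPair.eLpNorm_four_le (hW : IsBrownianUnit W P) {k : ℝ × ℝ → ℝ} {X : Ω → ℝ}
    (h : IsElemPair W k X) : eLpNorm X 4 P ≤ 3 * eLpNorm k 2 squareMeasure := by
  have hk := h.memLp 2
  obtain ⟨hi, -, -, -, h4⟩ := h.moments hW h
  have hX := h.memLp_four hW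
  rw [← ENNReal.pow_le_pow_left_iff (four_ne_zero)]
  have e1 : eLpNorm X 4 P ^ 4 = ENNReal.ofReal (∫ ω, X ω ^ 2 * X ω ^ 2 ∂P) := by
    have := eLpNorm_nnreal_pow_eq_lintegral (f := X) (μ := P) (p := 4) (by norm_num)
    have e : ∀ ω, X ω ^ 2 * X ω ^ 2 = X ω ^ 4 := fun ω => by ring
    simp_rw [e]
    rw [ofReal_integral_eq_lintegral_ofReal hi (ae_of_all _ fun ω => by positivity)]
    have e4 : (((4 : ℝ≥0) : ℝ)) = ((4 : ℕ) : ℝ) := by norm_num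
    rw [e4] at this
    simp only [ENNReal.rpow_natCast] at this
    refine this.trans (lintegral_congr fun ω => ?_)
    rw [Real.enorm_eq_ofReal_abs, ← ENNReal.ofReal_pow (abs_nonneg _), Even.pow_abs (by decide)]
  have hn : 0 ≤ ∫ y, k y * k y ∂squareMeasure := integral_nonneg fun y => mul_self_nonneg _
  -- With equal kernels both contraction terms of the fourth moment are this integral, controlled by
  -- submultiplicativity of the Hilbert–Schmidt norm.
  have hc : ∫ y, comp k k y * comp k k y ∂squareMeasure
      ≤ (∫ y, k y * k y ∂squareMeasure) ^ 2 := by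
    rw [← ENNReal.ofReal_le_ofReal_iff (sq_nonneg _),
      integral_mul_self_eq_eLpNorm (memLp_comp hk hk), ENNReal.ofReal_pow hn,
      integral_mul_self_eq_eLpNorm hk]
    refine pow_le_pow_left₀ zero_le ((eLpNorm_comp_le hk hk).trans_eq (sq _).symm) 2
  rw [e1, mul_pow, show eLpNorm k 2 squareMeasure ^ 4 = (eLpNorm k 2 squareMeasure ^ 2) ^ 2 by ring,
    ← integral_mul_self_eq_eLpNorm hk, ← ENNReal.ofReal_pow hn,
    show (3 : ℝ≥0∞) ^ 4 = ENNReal.ofReal 81 by norm_num, ← ENNReal.ofReal_mul (by norm_num)]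
  refine ENNReal.ofReal_le_ofReal ?_
  rw [h4]
  -- The fourth moment is at most (4 + 8 + 32 + 16) = 60 times the fourth power of the kernel norm,
  -- and 60 ≤ 3⁴.
  nlinarith [sq_nonneg (∫ y, k y * k y ∂squareMeasure)]

lemma eLpNorm_sub_symm {α : Type*} [MeasurableSpace α] {μ : Measure α} {p : ℝ≥0∞} (f g : α → ℝ) :
    eLpNorm (fun x => f x - g x) p μ = eLpNorm (fun x => g x - f x) p μ :=
  eLpNorm_sub_comm f g p μ

/-- Differences of elementary integrals are elementary, so the L⁴ bound applies to them. Passing to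
an a.e. convergent subsequence and using Fatou for the L⁴ norm upgrades L² convergence to L⁴
convergence. -/
lemma eLpNorm_four_sub_le [IsProbabilityMeasure P] (hW : IsBrownianUnit W P)
    {f : ℝ × ℝ → ℝ} {X : Ω → ℝ} (hf : MemLp f 2 squareMeasure) (hX : MemLp X 2 P)
    {k : ℕ → ℝ × ℝ → ℝ} {Y : ℕ → Ω → ℝ} (h : ∀ n, IsElemPair W (k n) (Y n))
    (hk : Tendsto (fun n => eLpNorm (fun y => k n y - f y) 2 squareMeasure) atTop (𝓝 0))
    (hY : Tendsto (fun n => eLpNorm (fun ω => Y n ω - X ω) 2 P) atTop (𝓝 0)) (n : ℕ) :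
    eLpNorm (fun ω => Y n ω - X ω) 4 P
      ≤ 3 * eLpNorm (fun y => k n y - f y) 2 squareMeasure := by
  have hY2 : ∀ n, AEStronglyMeasurable (Y n) P := fun n => ((h n).memLp_four hW).1
  obtain ⟨φ, hφ, hae⟩ := (tendstoInMeasure_of_tendsto_eLpNorm two_ne_zero hY2 hX.1
    hY).exists_seq_tendsto_ae
  have hlim : ∀ᵐ ω ∂P, Tendsto (fun m => Y n ω - Y (φ m) ω) atTop (𝓝 (Y n ω - X ω)) := by
    filter_upwards [hae] with ω hω using hω.const_sub _
  refine (Lp.eLpNorm_lim_le_liminf_eLpNorm (f := fun m ω => Y n ω - Y (φ m) ω)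
    (fun m => (hY2 n).sub (hY2 _)) _ hlim).trans ?_
  have hb : ∀ m, eLpNorm (fun ω => Y n ω - Y (φ m) ω) 4 P
      ≤ 3 * (eLpNorm (fun y => k n y - f y) 2 squareMeasure
        + eLpNorm (fun y => k (φ m) y - f y) 2 squareMeasure) := by
    intro m
    refine (((h n).sub (h (φ m))).eLpNorm_four_le hW).trans ?_
    gcongr
    rw [eLpNorm_sub_symm (k (φ m)) f]
    have e : (fun y => k n y - k (φ m) y)
        = (fun y => k n y - f y) + fun y => f y - k (φ m) y := by ext y; simp
    rw [e]
    exact eLpNorm_add_le (((h n).memLp 2).sub hf).1 (hf.sub ((h _).memLp 2)).1 one_le_two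
  have ht : Tendsto (fun m => 3 * (eLpNorm (fun y => k n y - f y) 2 squareMeasure
        + eLpNorm (fun y => k (φ m) y - f y) 2 squareMeasure)) atTop
      (𝓝 (3 * eLpNorm (fun y => k n y - f y) 2 squareMeasure)) := by
    have h1 := (hk.comp hφ.tendsto_atTop).const_add
      (eLpNorm (fun y => k n y - f y) 2 squareMeasure)
    rw [add_zero] at h1
    exact ENNReal.Tendsto.const_mul h1 (Or.inr (by norm_num))
  exact (liminf_le_liminf (Eventually.of_forall hb)).trans_eq ht.liminf_eq

/-- Moments of double Wiener integrals with symmetric kernels. -/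
lemma IsSymmDoubleWiener.moments [IsProbabilityMeasure P] (hW : IsBrownianUnit W P)
    {f g : ℝ × ℝ → ℝ} {X Y : Ω → ℝ}
    (h : IsSymmDoubleWiener W P f X) (h' : IsSymmDoubleWiener W P g Y) :
    MemLp X 4 P ∧ ∫ ω, X ω ∂P = 0 ∧
    ∫ ω, X ω * Y ω ∂P = 2 * ∫ y, f y * g y ∂squareMeasure ∧
    ∫ ω, X ω ^ 2 * Y ω ∂P = 8 * ∫ y, comp f f y * g y ∂squareMeasure ∧
    ∫ ω, X ω ^ 2 * Y ω ^ 2 ∂P =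
      4 * (∫ y, f y * f y ∂squareMeasure) * (∫ y, g y * g y ∂squareMeasure) +
      8 * (∫ y, f y * g y ∂squareMeasure) ^ 2 +
      32 * ∫ y, comp f f y * comp g g y ∂squareMeasure +
      16 * ∫ y, comp f g y * comp g f y ∂squareMeasure := by
  have lim : ∀ {f : ℝ × ℝ → ℝ} {X : Ω → ℝ}, MemLp f 2 squareMeasure → MemLp X 2 P →
      ∀ {k : ℕ → ℝ × ℝ → ℝ} {U : ℕ → Ω → ℝ}, (∀ n, IsElemPair W (k n) (U n)) →
      Tendsto (fun n => eLpNorm (fun y => k n y - f y) 2 squareMeasure) atTop (𝓝 0) →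
      Tendsto (fun n => eLpNorm (fun ω => U n ω - X ω) 2 P) atTop (𝓝 0) →
      MemLp X 4 P ∧ Tendsto (fun n => eLpNorm (fun ω => U n ω - X ω) 4 P) atTop (𝓝 0) := by
    intro f X hf hX k U hU hk hUX
    have hle := eLpNorm_four_sub_le hW hf hX hU hk hUX
    constructor
    · have h1 : MemLp (fun ω => U 0 ω - X ω) 4 P := by
        refine ⟨((hU 0).memLp_four hW).1.sub hX.1, (hle 0).trans_lt ?_⟩
        exact ENNReal.mul_lt_top (by norm_num) (((hU 0).memLp 2).sub hf).2
      have := ((hU 0).memLp_four hW).sub h1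
      refine this.ae_eq (ae_of_all _ fun ω => ?_)
      simp
    · have h3 := ENNReal.Tendsto.const_mul (a := 3) hk (Or.inr (by norm_num))
      rw [mul_zero] at h3
      exact tendsto_of_tendsto_of_tendsto_of_le_of_le tendsto_const_nhds h3
        (fun n => zero_le) hle
  obtain ⟨hf, hX, k, U, hU, hkf, hUX⟩ := h
  obtain ⟨hg, hY, l, V, hV, hlg, hVY⟩ := h'
  obtain ⟨hX4, hUX4⟩ := lim hf hX hU hkf hUX
  obtain ⟨hY4, hVY4⟩ := lim hg hY hV hlg hVY
  have hU4 := fun n => (hU n).memLp_four hW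
  have hV4 := fun n => (hV n).memLp_four hW
  have hk := fun n => (hU n).memLp 2
  have hl := fun n => (hV n).memLp 2
  have hU2 := fun n => (hU4 n).mono_exponent (p := 2) (by norm_num)
  have hV2 := fun n => (hV4 n).mono_exponent (p := 2) (by norm_num)
  have : ENNReal.HolderTriple 4 4 2 := ⟨by
    rw [← two_mul, show (4 : ℝ≥0∞) = 2 * 2 by norm_num,
      ENNReal.mul_inv (by norm_num) (by norm_num), ← mul_assoc,
      ENNReal.mul_inv_cancel (by norm_num) (by norm_num), one_mul]⟩
  have sqU : ∀ n, MemLp (fun ω => U n ω * U n ω) 2 P := fun n => (hU4 n).mul (hU4 n)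
  have sqV : ∀ n, MemLp (fun ω => V n ω * V n ω) 2 P := fun n => (hV4 n).mul (hV4 n)
  have sqX : MemLp (fun ω => X ω * X ω) 2 P := hX4.mul hX4
  have sqY : MemLp (fun ω => Y ω * Y ω) 2 P := hY4.mul hY4
  -- Convergence in L⁴ makes the squares converge in L², so all mixed moments of order up to four
  -- pass to the limit.
  have tU := tendsto_eLpNorm_mul_sub_mul (r := 2) (by norm_num) (by norm_num)
    hU4 hU4 hX4 hX4 hUX4 hUX4
  have tV := tendsto_eLpNorm_mul_sub_mul (r := 2) (by norm_num) (by norm_num)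
    hV4 hV4 hY4 hY4 hVY4 hVY4
  have tkk := tendsto_comp hk hk hf hf hkf hkf
  have tll := tendsto_comp hl hl hg hg hlg hlg
  have tkl := tendsto_comp hk hl hf hg hkf hlg
  have tlk := tendsto_comp hl hk hg hf hlg hkf
  have ckk := fun n => memLp_comp (hk n) (hk n)
  have cll := fun n => memLp_comp (hl n) (hl n)
  have ckl := fun n => memLp_comp (hk n) (hl n)
  have clk := fun n => memLp_comp (hl n) (hk n)
  have mom := fun n => (hU n).moments hW (hV n)
  refine ⟨hX4, ?_, ?_, ?_, ?_⟩
  · have h1 := tendsto_integral_mul hU2 (fun _ => memLp_const (1 : ℝ)) hX (memLp_const 1) hUX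
      (by simp)
    simp only [mul_one, (mom _).2.1] at h1
    exact (tendsto_nhds_unique h1 tendsto_const_nhds)
  · have h1 := tendsto_integral_mul hU2 hV2 hX hY hUX hVY
    simp only [(mom _).2.2.1] at h1
    exact tendsto_nhds_unique h1
      ((tendsto_integral_mul hk hl hf hg hkf hlg).const_mul 2)
  · have h1 := tendsto_integral_mul sqU hV2 sqX hY tU hVY
    simp only [← sq] at h1
    simp only [(mom _).2.2.2.1] at h1
    exact tendsto_nhds_unique h1
      ((tendsto_integral_mul ckk hl (memLp_comp hf hf) hg tkk hlg).const_mul 8)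
  · have h1 := tendsto_integral_mul sqU sqV sqX sqY tU tV
    simp only [← sq] at h1
    simp only [(mom _).2.2.2.2] at h1
    refine tendsto_nhds_unique h1 ?_
    exact ((((tendsto_integral_mul hk hk hf hf hkf hkf).const_mul 4).mul
      (tendsto_integral_mul hl hl hg hg hlg hlg)).add
      (((tendsto_integral_mul hk hl hf hg hkf hlg).pow 2).const_mul 8)).add
      ((tendsto_integral_mul ckk cll (memLp_comp hf hf) (memLp_comp hg hg) tkk tll).const_mul 32)
      |>.add ((tendsto_integral_mul ckl clk (memLp_comp hf hg) (memLp_comp hg hf) tkl tlk).const_mul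
        16)

lemma IsSymmDoubleWiener.sub [IsProbabilityMeasure P] (hW : IsBrownianUnit W P)
    {f g : ℝ × ℝ → ℝ} {X Y : Ω → ℝ}
    (h : IsSymmDoubleWiener W P f X) (h' : IsSymmDoubleWiener W P g Y) :
    IsSymmDoubleWiener W P (fun y => f y - g y) (fun ω => X ω - Y ω) := by
  obtain ⟨hf, hX, k, U, hU, hkf, hUX⟩ := h
  obtain ⟨hg, hY, l, V, hV, hlg, hVY⟩ := h'
  refine ⟨hf.sub hg, hX.sub hY, fun n y => k n y - l n y, fun n ω => U n ω - V n ω,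
    fun n => (hU n).sub (hV n), ?_, ?_⟩
  · refine tendsto_of_tendsto_of_tendsto_of_le_of_le tendsto_const_nhds
      (by simpa using hkf.add hlg) (fun n => zero_le) (fun n => ?_)
    have e : (fun y => k n y - l n y - (f y - g y))
        = (fun y => k n y - f y) - fun y => l n y - g y := by ext y; simp; ring
    simp only [e]
    exact eLpNorm_sub_le (((hU n).memLp 2).sub hf).1 (((hV n).memLp 2).sub hg).1 one_le_two
  · refine tendsto_of_tendsto_of_tendsto_of_le_of_le tendsto_const_nhds
      (by simpa using hUX.add hVY) (fun n => zero_le) (fun n => ?_)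
    have e : (fun ω => U n ω - V n ω - (X ω - Y ω))
        = (fun ω => U n ω - X ω) - fun ω => V n ω - Y ω := by ext y; simp; ring
    simp only [e]
    exact eLpNorm_sub_le (((hU n).memLp_four hW).1.sub hX.1) (((hV n).memLp_four hW).1.sub hY.1)
      one_le_two

/-- The matrix taking the values at the points of a subdivision to the increments. -/
def incrMatrix (n : ℕ) : Matrix (Fin n) (Fin (n + 1)) ℝ :=
  Matrix.of fun i k => (if k = i.succ then 1 else 0) - if k = i.castSucc then 1 else 0

lemma incrMatrix_mulVec {n : ℕ} (v : Fin (n + 1) → ℝ) (i : Fin n) :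
    (incrMatrix n).mulVec v i = v i.succ - v i.castSucc := by
  simp [incrMatrix, Matrix.mulVec, dotProduct, sub_mul, Finset.sum_sub_distrib]

/-- The symmetrized coefficient matrix of an elementary kernel, at the points of its
subdivision. -/
noncomputable def ElemKernel.symmMatrix (φ : ElemKernel) :
    Matrix (Fin (φ.n + 1)) (Fin (φ.n + 1)) ℝ :=
  (incrMatrix φ.n).transpose *
    Matrix.of (fun i j => (φ.coef i j + φ.coef j i) / 2) * incrMatrix φ.n

lemma dotProduct_symmMatrix_mulVec (φ : ElemKernel) (v w : Fin (φ.n + 1) → ℝ) :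
    v ⬝ᵥ φ.symmMatrix.mulVec w = ∑ i, ∑ j, (φ.coef i j + φ.coef j i) / 2 *
      (v i.succ - v i.castSucc) * (w j.succ - w j.castSucc) := by
  rw [ElemKernel.symmMatrix, ← Matrix.mulVec_mulVec, ← Matrix.mulVec_mulVec,
    Matrix.dotProduct_mulVec v, Matrix.vecMul_transpose]
  rw [dotProduct]
  refine Finset.sum_congr rfl fun i _ => ?_
  rw [incrMatrix_mulVec, Matrix.mulVec, dotProduct, Finset.mul_sum]
  refine Finset.sum_congr rfl fun j _ => ?_
  rw [incrMatrix_mulVec, Matrix.of_apply]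
  ring

lemma stepFun_sub_stepFun {s t : I} (h : s ≤ t) (x : ℝ) :
    stepFun t x - stepFun s x = (Ioc (s : ℝ) t).indicator 1 x := by
  have h' : (s : ℝ) ≤ t := h
  have h0 := s.2.1
  simp only [stepFun, indicator_apply, mem_Ioc, Pi.one_apply]
  split_ifs <;> grind

-- A quadratic form sees only the symmetric part of its coefficients: symmetrization leaves the
-- random variable unchanged, while it replaces the kernel by its symmetrization in
-- `quadKer_symmMatrix`.
omit [MeasurableSpace Ω] in
lemma quadRV_symmMatrix (φ : ElemKernel) (W : I → Ω → ℝ) :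
    quadRV φ.pt φ.symmMatrix W = φ.wiener W := by
  ext ω
  have e : quadRV φ.pt φ.symmMatrix W ω
      = (fun i => W (φ.pt i) ω) ⬝ᵥ φ.symmMatrix.mulVec fun i => W (φ.pt i) ω := by
    simp only [quadRV, dotProduct, Matrix.mulVec, Finset.mul_sum]
    exact Finset.sum_congr rfl fun i _ => Finset.sum_congr rfl fun j _ => by ring
  rw [e, dotProduct_symmMatrix_mulVec, ElemKernel.wiener]
  have e1 : ∀ i j, (φ.coef i j + φ.coef j i) / 2 *
      (W (φ.pt i.succ) ω - W (φ.pt i.castSucc) ω) * (W (φ.pt j.succ) ω - W (φ.pt j.castSucc) ω)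
      = φ.coef i j / 2 * (W (φ.pt i.succ) ω - W (φ.pt i.castSucc) ω) *
          (W (φ.pt j.succ) ω - W (φ.pt j.castSucc) ω)
        + φ.coef j i / 2 * (W (φ.pt j.succ) ω - W (φ.pt j.castSucc) ω) *
          (W (φ.pt i.succ) ω - W (φ.pt i.castSucc) ω) := fun i j => by ring
  simp only [e1, Finset.sum_add_distrib]
  rw [Finset.sum_comm (f := fun i j => φ.coef j i / 2 * _ * _), ← Finset.sum_add_distrib]
  refine Finset.sum_congr rfl fun i _ => ?_
  rw [← Finset.sum_add_distrib]
  exact Finset.sum_congr rfl fun j _ => by ring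

lemma quadKer_symmMatrix (φ : ElemKernel) (y : ℝ × ℝ) :
    quadKer φ.pt φ.symmMatrix y = (φ.toFun y + φ.toFun y.swap) / 2 := by
  rw [quadKer_eq_dotProduct, dotProduct_symmMatrix_mulVec]
  simp only [stepFun_sub_stepFun (φ.mono (Fin.castSucc_le_succ _))]
  rw [ElemKernel.toFun, ElemKernel.toFun,
    Finset.sum_comm (f := fun i j => φ.coef i j * _ * (Ioc (φ.pt j.castSucc : ℝ) _).indicator 1
      y.swap.2), ← Finset.sum_add_distrib, Finset.sum_div]
  refine Finset.sum_congr rfl fun i _ => ?_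
  rw [← Finset.sum_add_distrib, Finset.sum_div]
  refine Finset.sum_congr rfl fun j _ => ?_
  simp only [Prod.fst_swap, Prod.snd_swap]
  ring

-- The trace condition comes from disjointness: increments over different subintervals are
-- uncorrelated, so their covariance matrix is diagonal, whereas the coefficients vanish on the
-- diagonal.
omit [MeasurableSpace Ω] in
lemma ElemKernel.isElemPair (φ : ElemKernel) (W : I → Ω → ℝ) :
    IsElemPair W (fun y => (φ.toFun y + φ.toFun y.swap) / 2) (φ.wiener W) := by
  refine ⟨Fin (φ.n + 1), inferInstance, inferInstance, φ.pt, φ.symmMatrix, ?_, ?_, ?_, ?_⟩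
  · rw [Matrix.IsSymm, ElemKernel.symmMatrix]
    simp only [Matrix.transpose_mul, Matrix.transpose_transpose, Matrix.mul_assoc]
    congr 2
    ext i j
    simp [add_comm]
  · rw [ElemKernel.symmMatrix, Matrix.mul_assoc, Matrix.mul_assoc, Matrix.trace_mul_comm,
      Matrix.mul_assoc]
    -- The covariance matrix of the increments of the subdivision.
    set G := incrMatrix φ.n * covMatrix φ.pt * (incrMatrix φ.n).transpose with hG
    have hG' : ∀ i j, G i j = min (φ.pt i.succ : ℝ) (φ.pt j.succ)
        - min (φ.pt i.castSucc : ℝ) (φ.pt j.succ) - (min (φ.pt i.succ : ℝ) (φ.pt j.castSucc)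
        - min (φ.pt i.castSucc : ℝ) (φ.pt j.castSucc)) := by
      intro i j
      have h1 : G i j = (incrMatrix φ.n).mulVec
          (fun k => (incrMatrix φ.n).mulVec (fun l => covMatrix φ.pt l k) i) j := by
        rw [hG, Matrix.mul_apply]
        simp only [Matrix.mul_apply, Matrix.mulVec, dotProduct, Matrix.transpose_apply]
        exact Finset.sum_congr rfl fun k _ => mul_comm _ _
      rw [h1, incrMatrix_mulVec, incrMatrix_mulVec, incrMatrix_mulVec]
      rfl
    have hG0 : ∀ i j, i < j → G i j = 0 ∧ G j i = 0 := by
      intro i j hij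
      have a1 : (φ.pt i.castSucc : ℝ) ≤ φ.pt i.succ := φ.mono (Fin.castSucc_le_succ _)
      have a2 : (φ.pt i.succ : ℝ) ≤ φ.pt j.castSucc := φ.mono (by
        simpa [Fin.le_def] using hij)
      have a3 : (φ.pt j.castSucc : ℝ) ≤ φ.pt j.succ := φ.mono (Fin.castSucc_le_succ _)
      rw [hG', hG']
      constructor <;> grind
    rw [Matrix.trace]
    refine Finset.sum_eq_zero fun i _ => ?_
    rw [Matrix.diag, Matrix.mul_apply]
    refine Finset.sum_eq_zero fun j _ => ?_
    rcases lt_trichotomy i j with h | h | h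
    · simp [(hG0 i j h).2]
    · subst h; simp [φ.diag]
    · simp [(hG0 j i h).1]
  · ext y; exact (quadKer_symmMatrix φ y).symm
  · exact (quadRV_symmMatrix φ W).symm

lemma measurePreserving_swap_square :
    MeasurePreserving (Prod.swap : ℝ × ℝ → ℝ × ℝ) squareMeasure squareMeasure := by
  rw [squareMeasure_eq_prod]; exact Measure.measurePreserving_swap

/-- For a symmetric kernel the double Wiener integral is a limit of integrals of symmetric
elementary kernels. -/
lemma IsDoubleWienerIntegral.isSymmDoubleWiener {f : ℝ × ℝ → ℝ} {X : Ω → ℝ}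
    (h : IsDoubleWienerIntegral W P f X) (hf : ∀ y, f y.swap = f y) :
    IsSymmDoubleWiener W P f X := by
  obtain ⟨hf2, hX, φ, h1, h2⟩ := h
  refine ⟨hf2, hX, _, _, fun n => (φ n).isElemPair W, ?_, h2⟩
  refine tendsto_of_tendsto_of_tendsto_of_le_of_le tendsto_const_nhds h1 (fun n => zero_le)
    (fun n => ?_)
  have hmeas : Measurable (φ n).toFun := by
    unfold ElemKernel.toFun
    refine Finset.measurable_sum _ fun i _ => Finset.measurable_sum _ fun j _ => ?_
    exact (((measurable_one.indicator measurableSet_Ioc).comp measurable_fst).const_mul _).mul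
      ((measurable_one.indicator measurableSet_Ioc).comp measurable_snd)
  set u : ℝ × ℝ → ℝ := fun y => (φ n).toFun y - f y with hu
  have hum : AEStronglyMeasurable u squareMeasure := hmeas.aestronglyMeasurable.sub hf2.1
  have hus : eLpNorm (u ∘ Prod.swap) 2 squareMeasure = eLpNorm u 2 squareMeasure :=
    eLpNorm_comp_measurePreserving hum measurePreserving_swap_square
  -- As the target is symmetric, the symmetrized error is the average of the error and its swap, so
  -- its L² norm does not increase.
  have e : (fun y => ((φ n).toFun y + (φ n).toFun y.swap) / 2 - f y)
      = (2 : ℝ)⁻¹ • (u + u ∘ Prod.swap) := by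
    ext y
    simp [hu, hf]; ring
  simp only [e]
  rw [eLpNorm_const_smul]
  calc ‖(2 : ℝ)⁻¹‖ₑ * eLpNorm (u + u ∘ Prod.swap) 2 squareMeasure
      ≤ ‖(2 : ℝ)⁻¹‖ₑ * (eLpNorm u 2 squareMeasure + eLpNorm (u ∘ Prod.swap) 2 squareMeasure) := by
        gcongr
        exact eLpNorm_add_le hum
          (hum.comp_quasiMeasurePreserving measurePreserving_swap_square.quasiMeasurePreserving)
          one_le_two
    _ = eLpNorm u 2 squareMeasure := by
        rw [hus, ← two_mul, ← mul_assoc, enorm_inv two_ne_zero]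
        have : ‖(2 : ℝ)‖ₑ = 2 := by simp [enorm_eq_nnnorm]
        rw [this, ENNReal.inv_mul_cancel (by norm_num) (by norm_num), one_mul]

end DoubleWiener

/-! ### The fractional Volterra kernel and the overlap of its time derivatives. -/

section Volterra

/-- The time derivative of the kernel of fractional Brownian motion in closed form. -/
noncomputable def volterra (h u y : ℝ) : ℝ :=
  if 0 < y ∧ y < u then
    fbmConst h * y ^ (1 / 2 - h) * ((u - y) ^ (h - 3 / 2) * u ^ (h - 1 / 2))
  else 0

lemma fbmConst_nonneg (h : ℝ) : 0 ≤ fbmConst h := Real.sqrt_nonneg _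

lemma volterra_nonneg (h u y : ℝ) : 0 ≤ volterra h u y := by
  unfold volterra
  split_ifs with hy
  · have h1 := hy.1
    have h2 : 0 < u - y := sub_pos.2 hy.2
    have h3 : 0 < u := h1.trans hy.2
    have := fbmConst_nonneg h
    positivity
  · exact le_rfl

lemma measurable_volterra (h : ℝ) : Measurable fun p : ℝ × ℝ => volterra h p.1 p.2 := by
  unfold volterra
  refine Measurable.ite ?_ (by fun_prop) measurable_const
  exact (measurableSet_lt measurable_const measurable_snd).inter
    (measurableSet_lt measurable_snd measurable_fst)

/-- For u > y this is the fundamental theorem of calculus: the integrand is continuous at u, and its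
singularity at y has exponent h - 3/2 > -1, hence is integrable. For u < y the kernel vanishes near
u. -/
lemma fbmKernelDeriv_eq_volterra {h u y : ℝ} (hh : 1 / 2 < h) (hy : 0 < y) (huy : u ≠ y) :
    fbmKernelDeriv h u y = volterra h u y := by
  rcases lt_or_gt_of_ne huy with huy | huy
  · have h1 : (fun r => fbmKernel h r y) =ᶠ[𝓝 u] fun _ => 0 := by
      filter_upwards [eventually_lt_nhds huy] with r hr
      rw [fbmKernel, if_neg (not_lt.2 hr.le)]
    rw [fbmKernelDeriv, h1.deriv_eq, deriv_const, volterra, if_neg (fun hc => not_lt.2 huy.le hc.2)]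
  · have h1 : (fun r => fbmKernel h r y) =ᶠ[𝓝 u] fun r =>
        fbmConst h * y ^ (1 / 2 - h) * ∫ x in y..r, (x - y) ^ (h - 3 / 2) * x ^ (h - 1 / 2) := by
      filter_upwards [eventually_gt_nhds huy] with r hr
      rw [fbmKernel, if_pos hr]
    have hint : IntervalIntegrable (fun x => (x - y) ^ (h - 3 / 2) * x ^ (h - 1 / 2))
        volume y u := by
      have h2 : IntervalIntegrable (fun x : ℝ => (x - y) ^ (h - 3 / 2)) volume y u := by
        have := (intervalIntegral.intervalIntegrable_rpow' (a := y - y) (b := u - y)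
          (r := h - 3 / 2) (by linarith)).comp_sub_right y
        simpa using this
      refine h2.mul_continuousOn fun x hx => ?_
      rw [uIcc_of_le huy.le] at hx
      exact (Real.continuousAt_rpow_const _ _ (Or.inl (hy.trans_le hx.1).ne')).continuousWithinAt
    have hc : ContinuousAt (fun x => (x - y) ^ (h - 3 / 2) * x ^ (h - 1 / 2)) u := by
      refine ContinuousAt.mul ?_ (Real.continuousAt_rpow_const _ _ (Or.inl (hy.trans huy).ne'))
      exact ContinuousAt.rpow_const (by fun_prop) (Or.inl (sub_pos.2 huy).ne')
    have hm : StronglyMeasurableAtFilter (fun x => (x - y) ^ (h - 3 / 2) * x ^ (h - 1 / 2))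
        (𝓝 u) volume :=
      (show Measurable fun x : ℝ => (x - y) ^ (h - 3 / 2) * x ^ (h - 1 / 2) by
        fun_prop).stronglyMeasurable.stronglyMeasurableAtFilter
    have := (intervalIntegral.integral_hasDerivAt_right hint hm hc).const_mul
      (fbmConst h * y ^ (1 / 2 - h))
    rw [fbmKernelDeriv, h1.deriv_eq, this.deriv, volterra, if_pos ⟨hy, huy⟩]

/-- The change of variables behind the covariance of fractional Brownian motion. -/
lemma beta_substitution_identity {h u v y : ℝ} (hy : 0 < y) (hyu : y < u) (huv : u < v) :
    y ^ (1 / 2 - h) * ((u - y) ^ (h - 3 / 2) * u ^ (h - 1 / 2)) *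
      (y ^ (1 / 2 - h) * ((v - y) ^ (h - 3 / 2) * v ^ (h - 1 / 2))) =
    (v - u) ^ (2 * h - 2) * ((v - u) * v / (u * (v - y) ^ 2) *
      ((y * (v - u) / (u * (v - y))) ^ (2 - 2 * h - 1) *
        (v * (u - y) / (u * (v - y))) ^ (h - 1 / 2 - 1))) := by
  have hu : 0 < u := hy.trans hyu
  have hv : 0 < v := hu.trans huv
  have h1 : 0 < u - y := sub_pos.2 hyu
  have h2 : 0 < v - u := sub_pos.2 huv
  have h3 : 0 < v - y := by linarith
  have e : ∀ x : ℝ, 0 < x → x = Real.exp (Real.log x) := fun x hx => (Real.exp_log hx).symm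
  -- The identity is purely multiplicative: it persists when the three differences are treated as
  -- independent positive quantities, so comparing logarithms reduces it to a linear identity.
  generalize u - y = A at *
  generalize v - u = B at *
  generalize v - y = D at *
  rw [Real.rpow_def_of_pos hy, Real.rpow_def_of_pos h1, Real.rpow_def_of_pos hu,
    Real.rpow_def_of_pos h3, Real.rpow_def_of_pos hv, Real.rpow_def_of_pos h2,
    Real.rpow_def_of_pos (by positivity), Real.rpow_def_of_pos (by positivity),
    e (B * v / (u * D ^ 2)) (by positivity)]
  rw [Real.log_div (by positivity) (by positivity), Real.log_div (by positivity) (by positivity),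
    Real.log_div (by positivity) (by positivity), Real.log_mul h2.ne' hv.ne',
    Real.log_mul hu.ne' (by positivity), Real.log_pow, Real.log_mul hy.ne' h2.ne',
    Real.log_mul hu.ne' h3.ne', Real.log_mul hv.ne' h1.ne']
  simp only [← Real.exp_add]
  congr 1
  push_cast
  ring

/-- The substitution φ(y) = y(v-u)/(u(v-y)) maps (0,u) bijectively to (0,1) and turns the product of
the two profiles into (v-u)^(2h-2) times the Beta(2-2h, h-1/2) density. The normalization `fbmConst`
contains exactly the reciprocal Beta value, and the density has mass one. -/
lemma lintegral_volterra_mul_of_lt {h u v : ℝ} (hh : 1 / 2 < h) (hh1 : h < 1) (hu : 0 < u)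
    (huv : u < v) (hv1 : v ≤ 1) :
    ∫⁻ y, ENNReal.ofReal (volterra h u y) * ENNReal.ofReal (volterra h v y) ∂unitMeasure =
      ENNReal.ofReal (h * (2 * h - 1) * (v - u) ^ (2 * h - 2)) := by
  have hv : 0 < v := hu.trans huv
  have hB : 0 < beta (2 - 2 * h) (h - 1 / 2) := beta_pos (by linarith) (by linarith)
  have hc : fbmConst h ^ 2 = h * (2 * h - 1) * (1 / beta (2 - 2 * h) (h - 1 / 2)) := by
    rw [fbmConst, Real.sq_sqrt]
    · ring
    · have : 0 < h * (2 * h - 1) := mul_pos (by linarith) (by linarith)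
      positivity
  set φ : ℝ → ℝ := fun y => y * (v - u) / (u * (v - y)) with hφ
  have hφd : ∀ y ∈ Ioo 0 u, HasDerivWithinAt φ ((v - u) * v / (u * (v - y) ^ 2)) (Ioo 0 u) y := by
    intro y hy
    have h3 : v - y ≠ 0 := by have := hy.2; linarith
    have := ((hasDerivAt_id y).mul_const (v - u)).div
      (((hasDerivAt_id y).const_sub v).const_mul u) (mul_ne_zero hu.ne' h3)
    refine HasDerivAt.hasDerivWithinAt (this.congr_deriv ?_)
    simp only [id]
    field_simp
    ring
  have h1φ : ∀ y ∈ Ioo 0 u, 1 - φ y = v * (u - y) / (u * (v - y)) := by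
    intro y hy
    have h3 : v - y ≠ 0 := by have := hy.2; linarith
    simp only [hφ]
    field_simp
    ring
  have hinj : InjOn φ (Ioo 0 u) := by
    intro y hy z hz hyz
    have h3 : v - y ≠ 0 := by have := hy.2; linarith
    have h4 : v - z ≠ 0 := by have := hz.2; linarith
    have h5 : v - u ≠ 0 := by linarith
    simp only [hφ] at hyz
    field_simp at hyz
    nlinarith [hyz]
  have himg : φ '' Ioo 0 u = Ioo 0 1 := by
    ext x
    constructor
    · rintro ⟨y, hy, rfl⟩
      have h3 : 0 < v - y := by have := hy.2; linarith
      have h5 : 0 < v - u := by linarith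
      have h6 : 0 < u - y := by have := hy.2; linarith
      have h7 := hy.1
      refine ⟨by positivity, ?_⟩
      have : 0 < 1 - φ y := by rw [h1φ y hy]; positivity
      linarith
    · rintro ⟨hx0, hx1⟩
      have h5 : 0 < v - u := by linarith
      have h6 : 0 < v - u + x * u := by positivity
      -- The preimage is obtained by solving φ(y) = x, which is linear in y.
      refine ⟨x * u * v / (v - u + x * u), ⟨by positivity, ?_⟩, ?_⟩
      · rw [div_lt_iff₀ h6]
        have : 0 < u * ((1 - x) * (v - u)) := mul_pos hu (mul_pos (by linarith) h5)
        nlinarith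
      · have h7 : v - x * u * v / (v - u + x * u) = v * (v - u) / (v - u + x * u) := by
          field_simp; ring
        simp only [hφ]
        rw [h7]
        field_simp
  have key := lintegral_image_eq_lintegral_abs_deriv_mul measurableSet_Ioo hφd hinj
    (fun x => ENNReal.ofReal (1 / beta (2 - 2 * h) (h - 1 / 2) * x ^ (2 - 2 * h - 1) *
      (1 - x) ^ (h - 1 / 2 - 1)))
  rw [himg, ← lintegral_betaPDF, lintegral_betaPDF_eq_one (by linarith) (by linarith)] at key
  have hsupp : ∫⁻ y, ENNReal.ofReal (volterra h u y) * ENNReal.ofReal (volterra h v y) ∂unitMeasure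
      = ∫⁻ y in Ioo 0 u, ENNReal.ofReal (volterra h u y) * ENNReal.ofReal (volterra h v y) := by
    have hsub : Ioo 0 u ⊆ Icc (0 : ℝ) 1 := fun y hy =>
      ⟨hy.1.le, hy.2.le.trans (huv.le.trans hv1)⟩
    rw [unitMeasure, ← lintegral_indicator measurableSet_Icc, ← lintegral_indicator
      measurableSet_Ioo]
    congr 1
    ext y
    by_cases hy : y ∈ Ioo 0 u
    · rw [indicator_of_mem hy, indicator_of_mem (hsub hy)]
    · rw [indicator_of_notMem hy]
      have : volterra h u y = 0 := by rw [volterra, if_neg (show ¬(0 < y ∧ y < u) from hy)]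
      by_cases hy' : y ∈ Icc (0 : ℝ) 1
      · rw [indicator_of_mem hy', this]; simp
      · rw [indicator_of_notMem hy']
  have hK : 0 ≤ h * (2 * h - 1) * (v - u) ^ (2 * h - 2) :=
    mul_nonneg (mul_nonneg (by linarith) (by linarith)) (Real.rpow_nonneg (by linarith) _)
  rw [hsupp, ← mul_one (ENNReal.ofReal (h * (2 * h - 1) * (v - u) ^ (2 * h - 2))), key,
    ← lintegral_const_mul' _ _ ENNReal.ofReal_ne_top]
  refine setLIntegral_congr_fun measurableSet_Ioo fun y hy => ?_
  have hid := beta_substitution_identity (h := h) hy.1 hy.2 huv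
  have h3 : 0 < v - y := by have := hy.2; linarith
  have h5 : 0 < v - u := by linarith
  rw [← ENNReal.ofReal_mul (volterra_nonneg _ _ _), ← ENNReal.ofReal_mul (abs_nonneg _),
    ← ENNReal.ofReal_mul hK, abs_of_nonneg (by positivity), h1φ y hy]
  congr 1
  have e : volterra h u y * volterra h v y = fbmConst h ^ 2 *
      (y ^ (1 / 2 - h) * ((u - y) ^ (h - 3 / 2) * u ^ (h - 1 / 2)) *
      (y ^ (1 / 2 - h) * ((v - y) ^ (h - 3 / 2) * v ^ (h - 1 / 2)))) := by
    rw [volterra, volterra, if_pos ⟨hy.1, hy.2⟩, if_pos ⟨hy.1, hy.2.trans huv⟩]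
    ring
  rw [e, hid, hc]
  simp only [hφ]
  ring

lemma lintegral_volterra_mul {h u v : ℝ} (hh : 1 / 2 < h) (hh1 : h < 1) (hu : u ∈ Ioc (0 : ℝ) 1)
    (hv : v ∈ Ioc (0 : ℝ) 1) (huv : u ≠ v) :
    ∫⁻ y, ENNReal.ofReal (volterra h u y) * ENNReal.ofReal (volterra h v y) ∂unitMeasure =
      ENNReal.ofReal (h * (2 * h - 1) * |u - v| ^ (2 * h - 2)) := by
  rcases lt_or_gt_of_ne huv with huv | huv
  · rw [lintegral_volterra_mul_of_lt hh hh1 hu.1 huv hv.2, abs_sub_comm,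
      abs_of_pos (sub_pos.2 huv)]
  · simp_rw [mul_comm (ENNReal.ofReal (volterra h u _))]
    rw [lintegral_volterra_mul_of_lt hh hh1 hv.1 huv hu.2, abs_of_pos (sub_pos.2 huv)]

lemma rosenblattConst_pos {H : ℝ} (hH : 1 / 2 < H) : 0 < rosenblattConst H := by
  unfold rosenblattConst
  have : 0 < 2 * (2 * H - 1) := by linarith
  have : 0 < H := by linarith
  positivity

/-- The Volterra kernel normalized for the Rosenblatt process. -/
noncomputable def rosenblattVolterra (H u y : ℝ) : ℝ≥0∞ :=
  ENNReal.ofReal (√(rosenblattConst H) * volterra ((H + 1) / 2) u y)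

lemma measurable_rosenblattVolterra (H : ℝ) :
    Measurable fun p : ℝ × ℝ => rosenblattVolterra H p.1 p.2 :=
  ((measurable_volterra _).const_mul _).ennreal_ofReal

lemma rosenblattKernel_swap (H t : ℝ) (y : ℝ × ℝ) :
    rosenblattKernel H t y.swap = rosenblattKernel H t y := by
  simp only [rosenblattKernel, indicator_apply, Prod.fst_swap, Prod.snd_swap, mem_prod,
    max_comm y.2 y.1, and_comm (a := y.2 ∈ Icc 0 t)]
  simp_rw [mul_comm (fbmKernelDeriv _ _ y.2)]

/-- The profile at time u vanishes at y unless y < u, so the lower limit max(y₁, y₂) may be lowered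
to 0 and the indicator of the square is automatic. In this form the kernel is additive in the time
interval. Where the integral diverges both sides are 0 by convention. -/
lemma rosenblattKernel_eq {H t : ℝ} (hH : 1 / 2 < H) {y : ℝ × ℝ}
    (hy : y ∈ Ioc (0 : ℝ) 1 ×ˢ Ioc (0 : ℝ) 1) :
    rosenblattKernel H t y =
      (∫⁻ u in Ioc 0 t, rosenblattVolterra H u y.1 * rosenblattVolterra H u y.2).toReal := by
  have hd := (rosenblattConst_pos hH).le
  set h := (H + 1) / 2 with hh
  have h1 := hy.1.1
  have h2 := hy.2.1
  have e : ∀ u, rosenblattVolterra H u y.1 * rosenblattVolterra H u y.2 =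
      ENNReal.ofReal (rosenblattConst H * (volterra h u y.1 * volterra h u y.2)) := by
    intro u
    rw [rosenblattVolterra, rosenblattVolterra, ← ENNReal.ofReal_mul
      (mul_nonneg (Real.sqrt_nonneg _) (volterra_nonneg _ _ _)), mul_mul_mul_comm,
      Real.mul_self_sqrt hd]
  have hz : ∀ u, u ≤ max y.1 y.2 → volterra h u y.1 * volterra h u y.2 = 0 := by
    intro u hu
    rcases le_max_iff.1 hu with hu | hu
    · rw [volterra, if_neg (fun hc => not_lt.2 hu hc.2), zero_mul]
    · rw [mul_comm, volterra, if_neg (fun hc => not_lt.2 hu hc.2), zero_mul]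
  simp_rw [e]
  by_cases hyt : y ∈ Icc 0 t ×ˢ Icc 0 t
  · have hmax : max y.1 y.2 ≤ t := max_le hyt.1.2 hyt.2.2
    have hmax0 : 0 < max y.1 y.2 := lt_max_of_lt_left h1
    rw [rosenblattKernel, indicator_of_mem hyt, intervalIntegral.integral_of_le hmax,
      ← integral_const_mul]
    have e1 : ∫ u in Ioc (max y.1 y.2) t, rosenblattConst H *
        (fbmKernelDeriv h u y.1 * fbmKernelDeriv h u y.2) =
        ∫ u in Ioc 0 t, rosenblattConst H * (volterra h u y.1 * volterra h u y.2) := by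
      rw [← integral_indicator measurableSet_Ioc, ← integral_indicator measurableSet_Ioc]
      congr 1
      ext u
      by_cases hu : u ∈ Ioc (max y.1 y.2) t
      · rw [indicator_of_mem hu,
          indicator_of_mem (show u ∈ Ioc 0 t from ⟨hmax0.trans hu.1, hu.2⟩),
          fbmKernelDeriv_eq_volterra (by linarith) h1 ((le_max_left _ _).trans_lt hu.1).ne',
          fbmKernelDeriv_eq_volterra (by linarith) h2 ((le_max_right _ _).trans_lt hu.1).ne']
      · rw [indicator_of_notMem hu]
        by_cases hu' : u ∈ Ioc 0 t
        · rw [indicator_of_mem hu', hz u (not_lt.1 fun hc => hu ⟨hc, hu'.2⟩), mul_zero]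
        · rw [indicator_of_notMem hu']
    rw [e1, integral_eq_lintegral_of_nonneg_ae]
    · exact ae_of_all _ fun u => mul_nonneg hd
        (mul_nonneg (volterra_nonneg _ _ _) (volterra_nonneg _ _ _))
    · have m : ∀ z, Measurable fun u => volterra h u z := fun z =>
        (measurable_volterra h).comp (measurable_id.prodMk measurable_const)
      exact (((m _).mul (m _)).const_mul _).aestronglyMeasurable
  · rw [rosenblattKernel, indicator_of_notMem hyt]
    have hmax : t ≤ max y.1 y.2 := by
      by_contra hc
      have hc := max_lt_iff.1 (not_le.1 hc)
      exact hyt ⟨⟨h1.le, hc.1.le⟩, ⟨h2.le, hc.2.le⟩⟩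
    rw [setLIntegral_congr_fun (g := fun _ => 0) measurableSet_Ioc
      fun u hu => by simp [hz u (hu.2.trans hmax)]]
    simp

end Volterra

/-! ### Superpositions of tensor squares: inner products as integrals of overlaps. -/

section Mixtures

/-- The overlap `∫ G u y * G v y dy` of two profiles of the family `G`. -/
noncomputable def overlap (G : ℝ → ℝ → ℝ≥0∞) (u v : ℝ) : ℝ≥0∞ :=
  ∫⁻ y, G u y * G v y ∂unitMeasure

/-- The mixture `∫_S G u ⊗ G u du` of diagonal tensors. -/
noncomputable def diagMix (G : ℝ → ℝ → ℝ≥0∞) (S : Set ℝ) (y : ℝ × ℝ) : ℝ≥0∞ :=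
  ∫⁻ u in S, G u y.1 * G u y.2

/-- Composition of `ℝ≥0∞`-valued kernels. -/
noncomputable def lcomp (F F' : ℝ × ℝ → ℝ≥0∞) (y : ℝ × ℝ) : ℝ≥0∞ :=
  ∫⁻ z, F (y.1, z) * F' (z, y.2) ∂unitMeasure

variable {G : ℝ → ℝ → ℝ≥0∞}

lemma measurable_family {γ : Type*} [MeasurableSpace γ] {f g : γ → ℝ}
    (hG : Measurable fun p : ℝ × ℝ => G p.1 p.2) (hf : Measurable f) (hg : Measurable g) :
    Measurable fun c => G (f c) (g c) :=
  hG.comp (hf.prodMk hg)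

lemma measurable_overlap (hG : Measurable fun p : ℝ × ℝ => G p.1 p.2) :
    Measurable fun p : ℝ × ℝ => overlap G p.1 p.2 := by
  have h : Measurable fun q : (ℝ × ℝ) × ℝ => G q.1.1 q.2 * G q.1.2 q.2 :=
    (hG.comp (measurable_fst.fst.prodMk measurable_snd)).mul
      (hG.comp (measurable_fst.snd.prodMk measurable_snd))
  exact h.lintegral_prod_right'

lemma measurable_diagMix (hG : Measurable fun p : ℝ × ℝ => G p.1 p.2) (S : Set ℝ) :
    Measurable (diagMix G S) := by
  have h : Measurable fun q : (ℝ × ℝ) × ℝ => G q.2 q.1.1 * G q.2 q.1.2 :=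
    (hG.comp (measurable_snd.prodMk measurable_fst.fst)).mul
      (hG.comp (measurable_snd.prodMk measurable_fst.snd))
  exact h.lintegral_prod_right'

/-- Tonelli's theorem moves the integral over y inside, where it splits into one overlap for each
coordinate. The weights φ, ψ cover diagonal mixtures (weight 1) as well as their compositions
(weight an overlap), and working in `ℝ≥0∞` removes all integrability conditions. -/
lemma lintegral_mixture_mul {α β : Type*} [MeasurableSpace α] [MeasurableSpace β]
    {m : Measure α} {n : Measure β} [SFinite m] [SFinite n]
    (hG : Measurable fun p : ℝ × ℝ => G p.1 p.2) {φ : α → ℝ≥0∞} {ψ : β → ℝ≥0∞}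
    {u v : α → ℝ} {u' v' : β → ℝ} (hφ : Measurable φ) (hψ : Measurable ψ) (hu : Measurable u)
    (hv : Measurable v) (hu' : Measurable u') (hv' : Measurable v') :
    ∫⁻ y, (∫⁻ a, φ a * (G (u a) y.1 * G (v a) y.2) ∂m) *
      (∫⁻ b, ψ b * (G (u' b) y.1 * G (v' b) y.2) ∂n) ∂squareMeasure =
    ∫⁻ a, ∫⁻ b, φ a * ψ b * (overlap G (u a) (u' b) * overlap G (v a) (v' b)) ∂n ∂m := by
  have mK : Measurable fun q : ((ℝ × ℝ) × α) × β =>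
      (φ q.1.2 * (G (u q.1.2) q.1.1.1 * G (v q.1.2) q.1.1.2)) *
        (ψ q.2 * (G (u' q.2) q.1.1.1 * G (v' q.2) q.1.1.2)) := by
    refine ((hφ.comp measurable_fst.snd).mul ((measurable_family hG (hu.comp measurable_fst.snd)
      measurable_fst.fst.fst).mul (measurable_family hG (hv.comp measurable_fst.snd) measurable_fst.fst.snd))).mul
      ((hψ.comp measurable_snd).mul ((measurable_family hG (hu'.comp measurable_snd)
      measurable_fst.fst.fst).mul (measurable_family hG (hv'.comp measurable_snd) measurable_fst.fst.snd)))
  have ma : ∀ y : ℝ × ℝ, Measurable fun a => φ a * (G (u a) y.1 * G (v a) y.2) := fun y =>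
    hφ.mul ((measurable_family hG hu measurable_const).mul (measurable_family hG hv measurable_const))
  have mb : ∀ y : ℝ × ℝ, Measurable fun b => ψ b * (G (u' b) y.1 * G (v' b) y.2) := fun y =>
    hψ.mul ((measurable_family hG hu' measurable_const).mul (measurable_family hG hv' measurable_const))
  have e1 : ∀ y : ℝ × ℝ, (∫⁻ a, φ a * (G (u a) y.1 * G (v a) y.2) ∂m) *
      (∫⁻ b, ψ b * (G (u' b) y.1 * G (v' b) y.2) ∂n) = ∫⁻ a, ∫⁻ b,
        (φ a * (G (u a) y.1 * G (v a) y.2)) * (ψ b * (G (u' b) y.1 * G (v' b) y.2)) ∂n ∂m := by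
    intro y
    rw [← lintegral_mul_const _ (ma y)]
    refine lintegral_congr fun a => ?_
    rw [← lintegral_const_mul _ (mb y)]
  simp_rw [e1]
  rw [lintegral_lintegral_swap]
  swap
  · exact (mK.lintegral_prod_right').aemeasurable
  refine lintegral_congr fun a => ?_
  rw [lintegral_lintegral_swap]
  swap
  · refine Measurable.aemeasurable ?_
    exact mK.comp ((measurable_fst.prodMk measurable_const).prodMk measurable_snd)
  refine lintegral_congr fun b => ?_
  have e2 : ∀ y : ℝ × ℝ, φ a * (G (u a) y.1 * G (v a) y.2) * (ψ b * (G (u' b) y.1 * G (v' b) y.2))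
      = φ a * ψ b * ((G (u a) y.1 * G (u' b) y.1) * (G (v a) y.2 * G (v' b) y.2)) := fun y => by
    ring
  have g1 : ∀ c, Measurable fun z => G c z := fun c => measurable_family hG measurable_const measurable_id
  simp_rw [e2]
  rw [lintegral_const_mul, squareMeasure_eq_prod,
    lintegral_prod_mul (f := fun z => G (u a) z * G (u' b) z) (g := fun z => G (v a) z * G (v' b) z)
      ((g1 _).mul (g1 _)).aemeasurable ((g1 _).mul (g1 _)).aemeasurable]
  · rfl
  · exact (((g1 _).comp measurable_fst).mul ((g1 _).comp measurable_fst)).mul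
      (((g1 _).comp measurable_snd).mul ((g1 _).comp measurable_snd))

/-- Integrating out the middle variable joins two profiles into an overlap, so a composition is
again a mixture, now of tensors G u ⊗ G v with weight `overlap G u v`. -/
lemma lcomp_diagMix (hG : Measurable fun p : ℝ × ℝ => G p.1 p.2) (S T : Set ℝ) (y : ℝ × ℝ) :
    lcomp (diagMix G S) (diagMix G T) y =
      ∫⁻ p, overlap G p.1 p.2 * (G p.1 y.1 * G p.2 y.2)
        ∂((volume.restrict S).prod (volume.restrict T)) := by
  have mK : Measurable fun q : (ℝ × ℝ) × ℝ =>
      G q.1.2 y.1 * G q.1.2 q.1.1 * (G q.2 q.1.1 * G q.2 y.2) :=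
    ((measurable_family hG measurable_fst.snd measurable_const).mul (measurable_family hG measurable_fst.snd measurable_fst.fst)).mul
      ((measurable_family hG measurable_snd measurable_fst.fst).mul (measurable_family hG measurable_snd measurable_const))
  have e1 : ∀ z, diagMix G S (y.1, z) * diagMix G T (z, y.2) = ∫⁻ u in S, ∫⁻ v in T,
      G u y.1 * G u z * (G v z * G v y.2) := by
    intro z
    have m1 : ∀ a b, Measurable fun u => G u a * G u b := fun a b =>
      (measurable_family hG measurable_id measurable_const).mul
        (measurable_family hG measurable_id measurable_const)
    rw [diagMix, diagMix, ← lintegral_mul_const _ (m1 _ _)]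
    refine lintegral_congr fun u => ?_
    rw [← lintegral_const_mul _ (m1 _ _)]
  have mR := measurable_overlap hG
  simp_rw [lcomp, e1]
  rw [lintegral_lintegral_swap mK.lintegral_prod_right'.aemeasurable, lintegral_prod]
  swap
  · exact (mR.mul ((measurable_family hG measurable_fst measurable_const).mul
      (measurable_family hG measurable_snd measurable_const))).aemeasurable
  refine lintegral_congr fun u => ?_
  rw [lintegral_lintegral_swap]
  swap
  · exact (mK.comp ((measurable_fst.prodMk measurable_const).prodMk
      measurable_snd)).aemeasurable
  refine lintegral_congr fun v => ?_
  have e2 : ∀ z, G u y.1 * G u z * (G v z * G v y.2) = G u z * G v z * (G u y.1 * G v y.2) :=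
    fun z => by ring
  simp_rw [e2]
  have m2 : Measurable fun z => G u z * G v z :=
    (measurable_family hG measurable_const measurable_id).mul
      (measurable_family hG measurable_const measurable_id)
  rw [lintegral_mul_const _ m2]
  rfl

lemma lintegral_diagMix_mul (hG : Measurable fun p : ℝ × ℝ => G p.1 p.2) (S T : Set ℝ) :
    ∫⁻ y, diagMix G S y * diagMix G T y ∂squareMeasure =
      ∫⁻ u in S, ∫⁻ v in T, overlap G u v * overlap G u v := by
  have := lintegral_mixture_mul (m := volume.restrict S) (n := volume.restrict T) hG
    (φ := fun _ => 1) (ψ := fun _ => 1) (u := id) (v := id) (u' := id) (v' := id)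
    measurable_const measurable_const measurable_id measurable_id measurable_id measurable_id
  simpa only [diagMix, one_mul, id] using this

/-- The three overlaps are the edges of a triangle with vertices u, v, w. -/
lemma lintegral_lcomp_mul_diagMix (hG : Measurable fun p : ℝ × ℝ => G p.1 p.2) (S S' T : Set ℝ) :
    ∫⁻ y, lcomp (diagMix G S) (diagMix G S') y * diagMix G T y ∂squareMeasure =
      ∫⁻ u in S, ∫⁻ v in S', ∫⁻ w in T, overlap G u v * (overlap G u w * overlap G v w) := by
  have mR := measurable_overlap hG
  have := lintegral_mixture_mul (m := (volume.restrict S).prod (volume.restrict S'))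
    (n := volume.restrict T) hG
    (φ := fun p => overlap G p.1 p.2) (ψ := fun _ => 1) (u := Prod.fst) (v := Prod.snd)
    (u' := id) (v' := id)
    mR measurable_const measurable_fst measurable_snd measurable_id measurable_id
  simp only [one_mul, mul_one, id] at this
  simp_rw [lcomp_diagMix hG]
  refine this.trans ?_
  rw [lintegral_prod]
  refine Measurable.aemeasurable ?_
  have h : Measurable fun q : (ℝ × ℝ) × ℝ =>
      overlap G q.1.1 q.1.2 * (overlap G q.1.1 q.2 * overlap G q.1.2 q.2) :=
    (mR.comp measurable_fst).mul ((mR.comp (measurable_fst.fst.prodMk measurable_snd)).mul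
      (mR.comp (measurable_fst.snd.prodMk measurable_snd)))
  exact h.lintegral_prod_right'

/-- The four overlaps are the edges of the cycle u, v, v', u'. Which vertex ranges over which set
distinguishes the two contractions in the fourth moment. -/
lemma lintegral_lcomp_mul_lcomp (hG : Measurable fun p : ℝ × ℝ => G p.1 p.2)
    (S S' T T' : Set ℝ) :
    ∫⁻ y, lcomp (diagMix G S) (diagMix G S') y * lcomp (diagMix G T) (diagMix G T') y
      ∂squareMeasure =
      ∫⁻ u in S, ∫⁻ v in S', ∫⁻ u' in T, ∫⁻ v' in T',
        overlap G u v * overlap G u' v' * (overlap G u u' * overlap G v v') := by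
  have mR := measurable_overlap hG
  have := lintegral_mixture_mul (m := (volume.restrict S).prod (volume.restrict S'))
    (n := (volume.restrict T).prod (volume.restrict T')) hG
    (φ := fun p => overlap G p.1 p.2) (ψ := fun p => overlap G p.1 p.2) (u := Prod.fst)
    (v := Prod.snd) (u' := Prod.fst) (v' := Prod.snd)
    mR mR measurable_fst measurable_snd measurable_fst measurable_snd
  simp_rw [lcomp_diagMix hG]
  refine this.trans ?_
  have h : Measurable fun q : (ℝ × ℝ) × (ℝ × ℝ) => overlap G q.1.1 q.1.2 *
      overlap G q.2.1 q.2.2 * (overlap G q.1.1 q.2.1 * overlap G q.1.2 q.2.2) :=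
    ((mR.comp measurable_fst).mul (mR.comp measurable_snd)).mul
      ((mR.comp (measurable_fst.fst.prodMk measurable_snd.fst)).mul
      (mR.comp (measurable_fst.snd.prodMk measurable_snd.snd)))
  rw [lintegral_prod _ h.lintegral_prod_right'.aemeasurable]
  refine lintegral_congr fun u => lintegral_congr fun v => ?_
  exact lintegral_prod (f := fun p : ℝ × ℝ => overlap G u v * overlap G p.1 p.2 *
    (overlap G u p.1 * overlap G v p.2))
    (h.comp ((measurable_const (a := (u, v))).prodMk measurable_id)).aemeasurable

end Mixtures

/-! ### Passage between real kernels and kernels with values in `ℝ≥0∞`. -/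

section RealVersions

/-- `f` is a nonnegative real version of the `ℝ≥0∞`-valued kernel `F`. -/
def IsRealVersion (f : ℝ × ℝ → ℝ) (F : ℝ × ℝ → ℝ≥0∞) : Prop :=
  ∀ᵐ y ∂squareMeasure, 0 ≤ f y ∧ ENNReal.ofReal (f y) = F y

lemma IsRealVersion.comp {f g : ℝ × ℝ → ℝ} {F F' : ℝ × ℝ → ℝ≥0∞} (hf : IsRealVersion f F)
    (hg : IsRealVersion g F') (hf2 : MemLp f 2 squareMeasure) (hg2 : MemLp g 2 squareMeasure) :
    IsRealVersion (comp f g) (lcomp F F') := by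
  have h1 := measurePreserving_fst_third.quasiMeasurePreserving.ae hf
  have h2 := measurePreserving_third_snd.quasiMeasurePreserving.ae hg
  filter_upwards [Measure.ae_ae_of_ae_prod (h1.and h2), ae_integrable_comp hf2 hg2] with y hy hi
  have hnn : 0 ≤ᵐ[unitMeasure] fun z => f (y.1, z) * g (z, y.2) := by
    filter_upwards [hy] with z hz using mul_nonneg hz.1.1 hz.2.1
  refine ⟨integral_nonneg_of_ae hnn, ?_⟩
  rw [RosenblattVariation.comp, ofReal_integral_eq_lintegral_ofReal hi hnn, lcomp]
  refine lintegral_congr_ae ?_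
  filter_upwards [hy] with z hz
  rw [ENNReal.ofReal_mul hz.1.1, hz.1.2, hz.2.2]

/-- Nonnegativity is recorded together with the value so that the real integral can be recovered
from its image in `ℝ≥0∞`. -/
lemma IsRealVersion.ofReal_integral_mul {f g : ℝ × ℝ → ℝ} {F F' : ℝ × ℝ → ℝ≥0∞}
    (hf : IsRealVersion f F) (hg : IsRealVersion g F') (hf2 : MemLp f 2 squareMeasure)
    (hg2 : MemLp g 2 squareMeasure) :
    0 ≤ ∫ y, f y * g y ∂squareMeasure ∧
      ENNReal.ofReal (∫ y, f y * g y ∂squareMeasure) = ∫⁻ y, F y * F' y ∂squareMeasure := by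
  have hnn : 0 ≤ᵐ[squareMeasure] fun y => f y * g y := by
    filter_upwards [hf, hg] with y h1 h2 using mul_nonneg h1.1 h2.1
  refine ⟨integral_nonneg_of_ae hnn, ?_⟩
  rw [ofReal_integral_eq_lintegral_ofReal (f := fun y => f y * g y) (hf2.integrable_mul hg2) hnn]
  refine lintegral_congr_ae ?_
  filter_upwards [hf, hg] with y h1 h2
  rw [ENNReal.ofReal_mul h1.1, h1.2, h2.2]

end RealVersions

/-! ### Integrals of the Riesz kernel over intervals. -/

section Riesz

/-- The kernel `|x| ^ q` with values in `ℝ≥0∞`; for `q < 0` it is infinite at the origin. -/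
noncomputable def riesz (q x : ℝ) : ℝ≥0∞ := ENNReal.ofReal |x| ^ q

lemma continuous_riesz (q : ℝ) : Continuous (riesz q) :=
  ENNReal.continuous_rpow_const.comp (ENNReal.continuous_ofReal.comp continuous_abs)

lemma measurable_riesz (q : ℝ) : Measurable (riesz q) := (continuous_riesz q).measurable

lemma riesz_neg (q x : ℝ) : riesz q (-x) = riesz q x := by rw [riesz, abs_neg, riesz]

lemma riesz_sub_comm (q x y : ℝ) : riesz q (x - y) = riesz q (y - x) := by
  rw [← riesz_neg, neg_sub]

lemma riesz_of_ne {q x : ℝ} (hx : x ≠ 0) : riesz q x = ENNReal.ofReal (|x| ^ q) :=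
  ENNReal.ofReal_rpow_of_pos (abs_pos.2 hx)

lemma riesz_mul_self (q x : ℝ) : riesz q x * riesz q x = riesz (2 * q) x := by
  rw [riesz, riesz, mul_comm 2 q, ENNReal.rpow_mul, ENNReal.rpow_two, sq]

lemma riesz_div {N : ℕ} (hN : N ≠ 0) (q x : ℝ) :
    riesz q (x / N) = ENNReal.ofReal ((N : ℝ) ^ (-q)) * riesz q x := by
  have hN' : (0 : ℝ) < N := by positivity
  rw [riesz, riesz, abs_div, Nat.abs_cast, div_eq_inv_mul, ENNReal.ofReal_mul (by positivity),
    ENNReal.mul_rpow_of_ne_top (by simp) (by simp), ENNReal.ofReal_rpow_of_pos (by positivity),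
    Real.rpow_neg hN'.le, Real.inv_rpow hN'.le]

lemma lintegral_Ioc_ofReal {f : ℝ → ℝ} {a b : ℝ} (hab : a ≤ b)
    (hf : IntervalIntegrable f volume a b) (h0 : ∀ x ∈ Ioc a b, 0 ≤ f x) :
    ∫⁻ x in Ioc a b, ENNReal.ofReal (f x) = ENNReal.ofReal (∫ x in a..b, f x) := by
  rw [intervalIntegral.integral_of_le hab, ofReal_integral_eq_lintegral_ofReal
    ((intervalIntegrable_iff_integrableOn_Ioc_of_le hab).1 hf)
    ((ae_restrict_iff' measurableSet_Ioc).2 (ae_of_all _ h0))]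

/-- The interval is split at the singularity x, and each side is an integrable power. -/
lemma lintegral_riesz_sub_of_mem {q x : ℝ} (hq : -1 < q) (hx : x ∈ Ioc (0 : ℝ) 1) :
    ∫⁻ y in Ioc 0 1, riesz q (x - y) =
      ENNReal.ofReal (x ^ (q + 1) / (q + 1) + (1 - x) ^ (q + 1) / (q + 1)) := by
  have hq1 : q + 1 ≠ 0 := by linarith
  have hne : ∀ᵐ y : ℝ, y ≠ x := Measure.ae_ne _ _
  have hL : ∫⁻ y in Ioc 0 x, riesz q (x - y) = ENNReal.ofReal (x ^ (q + 1) / (q + 1)) := by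
    have hi : IntervalIntegrable (fun y => (x - y) ^ q) volume 0 x := by
      have := (intervalIntegral.intervalIntegrable_rpow' (a := 0) (b := x) hq).comp_sub_left x
      simpa using this.symm
    have h0 : ∀ y ∈ Ioc 0 x, 0 ≤ (x - y) ^ q := fun y hy =>
      Real.rpow_nonneg (sub_nonneg.2 hy.2) _
    have e : ∫⁻ y in Ioc 0 x, riesz q (x - y) =
        ∫⁻ y in Ioc 0 x, ENNReal.ofReal ((x - y) ^ q) := by
      refine lintegral_congr_ae ?_
      filter_upwards [ae_restrict_of_ae hne, ae_restrict_mem measurableSet_Ioc] with y hy hy'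
      rw [riesz_of_ne (sub_ne_zero.2 hy.symm), abs_of_nonneg (sub_nonneg.2 hy'.2)]
    rw [e, lintegral_Ioc_ofReal hx.1.le hi h0,
      intervalIntegral.integral_comp_sub_left (fun y => y ^ q), sub_self, sub_zero,
      integral_rpow (Or.inl hq), Real.zero_rpow hq1, sub_zero]
  have hR : ∫⁻ y in Ioc x 1, riesz q (x - y) =
      ENNReal.ofReal ((1 - x) ^ (q + 1) / (q + 1)) := by
    have hi : IntervalIntegrable (fun y => (y - x) ^ q) volume x 1 := by
      have := (intervalIntegral.intervalIntegrable_rpow' (a := 0) (b := 1 - x) hq).comp_sub_right x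
      simpa using this
    have h0 : ∀ y ∈ Ioc x 1, 0 ≤ (y - x) ^ q := fun y hy =>
      Real.rpow_nonneg (sub_nonneg.2 hy.1.le) _
    have e : ∫⁻ y in Ioc x 1, riesz q (x - y) =
        ∫⁻ y in Ioc x 1, ENNReal.ofReal ((y - x) ^ q) := by
      refine lintegral_congr_ae ?_
      filter_upwards [ae_restrict_mem measurableSet_Ioc] with y hy
      rw [riesz_sub_comm, riesz_of_ne (sub_ne_zero.2 hy.1.ne'), abs_of_pos (sub_pos.2 hy.1)]
    rw [e, lintegral_Ioc_ofReal hx.2 hi h0,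
      intervalIntegral.integral_comp_sub_right (fun y => y ^ q), sub_self,
      integral_rpow (Or.inl hq), Real.zero_rpow hq1, sub_zero]
  rw [← Ioc_union_Ioc_eq_Ioc hx.1.le hx.2, lintegral_union measurableSet_Ioc
    (Ioc_disjoint_Ioc_of_le le_rfl), hL, hR, ENNReal.ofReal_add]
  · exact div_nonneg (Real.rpow_nonneg hx.1.le _) (by linarith)
  · exact div_nonneg (Real.rpow_nonneg (sub_nonneg.2 hx.2) _) (by linarith)

lemma lintegral_lintegral_riesz {q : ℝ} (hq : -1 < q) :
    ∫⁻ x in Ioc 0 1, ∫⁻ y in Ioc 0 1, riesz q (x - y) =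
      ENNReal.ofReal (2 / ((q + 1) * (q + 2))) := by
  have hq1 : 0 < q + 1 := by linarith
  have i1 : IntervalIntegrable (fun x : ℝ => x ^ (q + 1) / (q + 1)) volume 0 1 :=
    (intervalIntegral.intervalIntegrable_rpow' (by linarith)).div_const _
  have i2 : IntervalIntegrable (fun x : ℝ => (1 - x) ^ (q + 1) / (q + 1)) volume 0 1 := by
    have := (i1.comp_sub_left 1).symm
    simpa using this
  rw [setLIntegral_congr_fun measurableSet_Ioc fun x hx => lintegral_riesz_sub_of_mem hq hx,
    lintegral_Ioc_ofReal zero_le_one (i1.add i2)]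
  · congr 1
    rw [intervalIntegral.integral_add i1 i2,
      intervalIntegral.integral_comp_sub_left (fun x => x ^ (q + 1) / (q + 1)), sub_self, sub_zero,
      intervalIntegral.integral_div, integral_rpow (Or.inl (by linarith)), Real.one_rpow,
      Real.zero_rpow (by linarith)]
    have hq2 : q + 2 ≠ 0 := by linarith
    rw [show q + 1 + 1 = q + 2 by ring]
    field_simp
    ring
  · intro x hx
    have := Real.rpow_nonneg hx.1.le (q + 1)
    have := Real.rpow_nonneg (sub_nonneg.2 hx.2) (q + 1)
    positivity

/-- At distance at least 1 a negative power is at most 1, and near the origin it is integrable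
because q > -1. Translation invariance makes the resulting bound independent of a. -/
lemma exists_lintegral_riesz_sub_le {q : ℝ} (hq : -1 < q) (hq0 : q < 0) :
    ∃ C : ℝ≥0∞, C ≠ ∞ ∧ ∀ a, ∫⁻ y in Ioc 0 1, riesz q (a - y) ≤ C := by
  have hfin : ∫⁻ y in Ioc (-1) 1, riesz q y ≠ ∞ := by
    rw [← Ioc_union_Ioc_eq_Ioc (show (-1 : ℝ) ≤ 0 by norm_num) zero_le_one,
      lintegral_union measurableSet_Ioc (Ioc_disjoint_Ioc_of_le le_rfl)]
    have h1 : ∫⁻ y in Ioc 0 1, riesz q y ≠ ∞ := by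
      have h := lintegral_riesz_sub_of_mem (q := q) (x := 1) hq ⟨one_pos, le_rfl⟩
      have hp : MeasurePreserving (fun y : ℝ => 1 - y) volume volume :=
        Measure.measurePreserving_sub_left volume 1
      have h' := hp.setLIntegral_comp_emb (MeasurableEquiv.subLeft (1 : ℝ)).measurableEmbedding
        (riesz q) (Ioc 0 1)
      rw [setLIntegral_congr (Ico_ae_eq_Ioc (a := (0 : ℝ)) (b := 1)).symm]
      have e : (fun y : ℝ => 1 - y) '' Ioc 0 1 = Ico 0 1 := by simp
      rw [e] at h'
      rw [← h', h]
      exact ENNReal.ofReal_ne_top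
    refine ENNReal.add_ne_top.2 ⟨?_, h1⟩
    have hp : MeasurePreserving (fun y : ℝ => -y) volume volume :=
      Measure.measurePreserving_neg volume
    have h' := hp.setLIntegral_comp_emb (MeasurableEquiv.neg ℝ).measurableEmbedding
      (riesz q) (Ioc 0 1)
    rw [setLIntegral_congr (Ico_ae_eq_Ioc (a := (-1 : ℝ)) (b := 0)).symm]
    have e : (fun y : ℝ => -y) '' Ioc 0 1 = Ico (-1) 0 := by simp
    rw [e] at h'
    simp_rw [riesz_neg] at h'
    rw [← h']
    exact h1
  refine ⟨1 + ∫⁻ y in Ioc (-1) 1, riesz q y, ENNReal.add_ne_top.2 ⟨ENNReal.one_ne_top, hfin⟩,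
    fun a => ?_⟩
  have hle : ∀ y, riesz q (a - y) ≤ 1 + indicator (Ioc (-1) 1) (riesz q) (a - y) := by
    intro y
    by_cases hy : a - y ∈ Ioc (-1 : ℝ) 1
    · rw [indicator_of_mem hy]
      exact le_add_self
    · refine le_trans ?_ le_self_add
      refine ENNReal.rpow_le_one_of_one_le_of_neg ?_ hq0
      rw [ENNReal.one_le_ofReal]
      by_contra hc
      have := abs_lt.1 (not_le.1 hc)
      exact hy ⟨this.1, this.2.le⟩
  calc ∫⁻ y in Ioc 0 1, riesz q (a - y)
      ≤ ∫⁻ y in Ioc 0 1, (1 + indicator (Ioc (-1) 1) (riesz q) (a - y)) := lintegral_mono hle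
    _ = 1 + ∫⁻ y in Ioc 0 1, indicator (Ioc (-1) 1) (riesz q) (a - y) := by
        rw [lintegral_add_left measurable_const]; simp
    _ ≤ 1 + ∫⁻ y, indicator (Ioc (-1) 1) (riesz q) (a - y) := by
        gcongr; exact Measure.restrict_le_self
    _ = 1 + ∫⁻ y in Ioc (-1) 1, riesz q y := by
        rw [lintegral_sub_left_eq_self (μ := volume) (indicator (Ioc (-1) 1) (riesz q)) a,
          lintegral_indicator measurableSet_Ioc]

end Riesz

/-! ### The regular subdivision and the conversion of sums into integrals. -/

section Cells

/-- The `i`-th cell `(i/N, (i+1)/N]` of the regular subdivision of `(0,1]`. -/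
def cell (N i : ℕ) : Set ℝ := Ioc ((i : ℝ) / N) (((i : ℝ) + 1) / N)

/-- The index of the cell containing `s`. -/
noncomputable def cellIdx (N : ℕ) (s : ℝ) : ℕ := ⌈(N : ℝ) * s⌉₊ - 1

/-- The point at relative position `x` in the cell containing `s`. -/
noncomputable def rescale (N : ℕ) (s x : ℝ) : ℝ := ((cellIdx N s : ℝ) + x) / N

lemma measurableSet_cell (N i : ℕ) : MeasurableSet (cell N i) := measurableSet_Ioc

lemma measurable_cellIdx (N : ℕ) : Measurable (cellIdx N) := by
  have : Measurable fun s : ℝ => ⌈(N : ℝ) * s⌉₊ := Nat.measurable_ceil.comp (measurable_id.const_mul _)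
  exact this.sub_const 1

lemma measurable_rescale (N : ℕ) : Measurable fun p : ℝ × ℝ => rescale N p.1 p.2 := by
  have h : Measurable fun s : ℝ => (cellIdx N s : ℝ) :=
    (measurable_from_top (f := fun n : ℕ => (n : ℝ))).comp (measurable_cellIdx N)
  exact ((h.comp measurable_fst).add measurable_snd).div_const _

lemma cell_subset {N i : ℕ} (hi : i < N) : cell N i ⊆ Ioc 0 1 := by
  have hN : (0 : ℝ) < N := by exact_mod_cast (Nat.zero_le i).trans_lt hi
  refine Ioc_subset_Ioc (by positivity) ((div_le_one hN).2 ?_)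
  exact_mod_cast hi

lemma cellIdx_of_mem {N i : ℕ} (hN : N ≠ 0) {u : ℝ} (hu : u ∈ cell N i) : cellIdx N u = i := by
  have hN' : (0 : ℝ) < N := by positivity
  have h1 := (div_lt_iff₀' hN').1 hu.1
  have h2 := (le_div_iff₀' hN').1 hu.2
  -- Cells are open on the left and closed on the right, so N u lies in (i, i+1] and its ceiling is
  -- i + 1.
  have : ⌈(N : ℝ) * u⌉₊ = i + 1 := by
    rw [Nat.ceil_eq_iff (by omega)]
    exact ⟨by simpa using h1, by simpa using h2⟩
  rw [cellIdx, this, Nat.add_sub_cancel]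

lemma cellIdx_bounds {N : ℕ} (hN : N ≠ 0) {s : ℝ} (hs : 0 < s) :
    (cellIdx N s : ℝ) ≤ N * s ∧ N * s ≤ cellIdx N s + 1 := by
  have hN' : (0 : ℝ) < N := by positivity
  have hpos : 0 < ⌈(N : ℝ) * s⌉₊ := Nat.ceil_pos.2 (by positivity)
  have e : (cellIdx N s : ℝ) + 1 = ⌈(N : ℝ) * s⌉₊ := by
    rw [cellIdx]
    exact_mod_cast Nat.sub_add_cancel hpos
  have h1 := Nat.ceil_lt_add_one (show (0 : ℝ) ≤ N * s by positivity)
  have h2 := Nat.le_ceil ((N : ℝ) * s)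
  constructor <;> linarith

/-- Both s and its rescaled point belong to the same cell, of length 1/N. -/
lemma tendsto_rescale {s x : ℝ} (hs : 0 < s) (hx : x ∈ Ioc (0 : ℝ) 1) :
    Tendsto (fun N => rescale N s x) atTop (𝓝 s) := by
  refine tendsto_iff_dist_tendsto_zero.2 (squeeze_zero' (Eventually.of_forall fun _ => dist_nonneg)
    ?_ tendsto_one_div_atTop_nhds_zero_nat)
  filter_upwards [eventually_ne_atTop 0] with N hN
  have hN' : (0 : ℝ) < N := by positivity
  obtain ⟨h1, h2⟩ := cellIdx_bounds hN hs
  have e : rescale N s x - s = (cellIdx N s + x - N * s) / N := by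
    rw [rescale]
    field_simp
  rw [Real.dist_eq, e, abs_div, Nat.abs_cast]
  gcongr
  rw [abs_le]
  constructor <;> linarith [hx.1, hx.2]

lemma lintegral_cell {N : ℕ} (hN : N ≠ 0) (i : ℕ) (f : ℝ → ℝ≥0∞) :
    ∫⁻ u in cell N i, f u =
      ENNReal.ofReal (N : ℝ)⁻¹ * ∫⁻ x in Ioc 0 1, f ((i + x) / N) := by
  have hN' : (0 : ℝ) < N := by positivity
  have himg : (fun x : ℝ => (i + x) / N) '' Ioc 0 1 = cell N i := by
    ext u
    constructor
    · rintro ⟨x, hx, rfl⟩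
      exact ⟨by dsimp only; gcongr; linarith [hx.1], by dsimp only; gcongr; exact hx.2⟩
    · intro hu
      have h1 := (div_lt_iff₀' hN').1 hu.1
      have h2 := (le_div_iff₀' hN').1 hu.2
      refine ⟨N * u - i, ⟨by linarith, by linarith⟩, ?_⟩
      dsimp only
      field_simp
      ring
  have hd : ∀ x ∈ Ioc (0 : ℝ) 1, HasDerivWithinAt (fun x : ℝ => (i + x) / N) ((N : ℝ)⁻¹)
      (Ioc 0 1) x := by
    intro x _
    have := (((hasDerivAt_id x).const_add (i : ℝ)).div_const (N : ℝ)).hasDerivWithinAt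
      (s := Ioc (0 : ℝ) 1)
    simpa using this
  have hinj : InjOn (fun x : ℝ => (i + x) / N) (Ioc 0 1) := by
    intro x _ y _ hxy
    have := (div_left_inj' hN'.ne').1 hxy
    linarith
  rw [← himg, lintegral_image_eq_lintegral_abs_deriv_mul measurableSet_Ioc hd hinj,
    lintegral_const_mul' _ _ ENNReal.ofReal_ne_top, abs_of_pos (inv_pos.2 hN')]

lemma lintegral_eq_sum_cell {N : ℕ} (hN : N ≠ 0) (f : ℝ → ℝ≥0∞) :
    ∫⁻ u in Ioc 0 1, f u = ∑ i ∈ Finset.range N, ∫⁻ u in cell N i, f u := by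
  have hN' : (0 : ℝ) < N := by positivity
  have key : ∀ k : ℕ, ∫⁻ u in Ioc 0 ((k : ℝ) / N), f u =
      ∑ i ∈ Finset.range k, ∫⁻ u in cell N i, f u := by
    intro k
    induction k with
    | zero => simp
    | succ k ih =>
      rw [Finset.sum_range_succ, ← ih, cell, ← lintegral_union measurableSet_Ioc
        (Ioc_disjoint_Ioc_of_le le_rfl), Ioc_union_Ioc_eq_Ioc (by positivity) (by gcongr; simp)]
      push_cast
      rfl
  have := key N
  rwa [div_self hN'.ne'] at this

lemma sum_lintegral_cell {N : ℕ} (hN : N ≠ 0) (f : ℕ → ℝ → ℝ≥0∞) :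
    ∑ i ∈ Finset.range N, ∫⁻ u in cell N i, f i u = ∫⁻ u in Ioc 0 1, f (cellIdx N u) u := by
  rw [lintegral_eq_sum_cell hN]
  refine Finset.sum_congr rfl fun i _ => setLIntegral_congr_fun (measurableSet_cell N i) fun u hu => ?_
  simp only [cellIdx_of_mem hN hu]

lemma sum_cell_mul {N : ℕ} (hN : N ≠ 0) (φ : ℕ → ℝ≥0∞) :
    ∑ i ∈ Finset.range N, ENNReal.ofReal (N : ℝ)⁻¹ * φ i = ∫⁻ s in Ioc 0 1, φ (cellIdx N s) := by
  rw [← sum_lintegral_cell hN fun i _ => φ i]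
  refine Finset.sum_congr rfl fun i _ => ?_
  rw [lintegral_cell hN]
  simp

/-- The Jacobian 1/N of each cell turns the sum over cells into an integral over a macroscopic
position s, leaving the relative position x inside the cell. The domain is then independent of N,
and limit theorems for integrals apply. -/
lemma sum_lintegral_cell_eq {N : ℕ} (hN : N ≠ 0) (f : ℕ → ℝ → ℝ≥0∞) :
    ∑ i ∈ Finset.range N, ∫⁻ u in cell N i, f i u =
      ∫⁻ s in Ioc 0 1, ∫⁻ x in Ioc 0 1, f (cellIdx N s) (rescale N s x) := by
  simp_rw [lintegral_cell hN]
  exact sum_cell_mul hN fun i => ∫⁻ x in Ioc 0 1, f i ((i + x) / N)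

lemma lintegral_prod_prod {ν₁ ν₂ ν₃ ν₄ : Measure ℝ} [SFinite ν₁] [SFinite ν₂] [SFinite ν₃]
    [SFinite ν₄] {Φ : (ℝ × ℝ) × (ℝ × ℝ) → ℝ≥0∞} (hΦ : Measurable Φ) :
    ∫⁻ z, Φ z ∂((ν₁.prod ν₂).prod (ν₃.prod ν₄)) =
      ∫⁻ a, ∫⁻ b, ∫⁻ c, ∫⁻ d, Φ ((a, b), (c, d)) ∂ν₄ ∂ν₃ ∂ν₂ ∂ν₁ := by
  rw [lintegral_prod _ hΦ.aemeasurable, lintegral_prod _ hΦ.lintegral_prod_right'.aemeasurable]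
  refine lintegral_congr fun a => lintegral_congr fun b => ?_
  exact lintegral_prod (fun p : ℝ × ℝ => Φ ((a, b), p))
    (hΦ.comp (measurable_const.prodMk measurable_id)).aemeasurable

end Cells

/-! ### Interaction energies of cells and the vanishing of their squared sum. -/

section CellEnergy

lemma sub_div_riesz {N : ℕ} (hN : N ≠ 0) (q a b : ℝ) :
    riesz q (a / N - b / N) = ENNReal.ofReal ((N : ℝ) ^ (-q)) * riesz q (a - b) := by
  rw [← sub_div, riesz_div hN]

lemma ofReal_inv_mul_rpow {N : ℕ} (hN : N ≠ 0) (q : ℝ) :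
    ENNReal.ofReal (N : ℝ)⁻¹ * ENNReal.ofReal ((N : ℝ) ^ q) = ENNReal.ofReal ((N : ℝ) ^ (q - 1)) := by
  have hN' : (0 : ℝ) < N := by positivity
  rw [← ENNReal.ofReal_mul (by positivity), Real.rpow_sub_one hN'.ne', div_eq_inv_mul]

lemma ofReal_rpow_mul_rpow {N : ℕ} (hN : N ≠ 0) (q r : ℝ) :
    ENNReal.ofReal ((N : ℝ) ^ q) * ENNReal.ofReal ((N : ℝ) ^ r) =
      ENNReal.ofReal ((N : ℝ) ^ (q + r)) := by
  have hN' : (0 : ℝ) < N := by positivity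
  rw [← ENNReal.ofReal_mul (by positivity), Real.rpow_add hN']

lemma lintegral_cell_riesz {N : ℕ} (hN : N ≠ 0) (q : ℝ) (i : ℕ) (a : ℝ) :
    ∫⁻ v in cell N i, riesz q (a / N - v) =
      ENNReal.ofReal ((N : ℝ) ^ (-q - 1)) * ∫⁻ z in Ioc 0 1, riesz q (a - (i + z)) := by
  rw [lintegral_cell hN]
  simp_rw [sub_div_riesz hN]
  rw [lintegral_const_mul' _ _ ENNReal.ofReal_ne_top, ← mul_assoc, ofReal_inv_mul_rpow hN]

/-- Each of the two integrations contributes N^(-1) and the link contributes N^(-q). -/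
lemma lintegral_cell_cell_riesz {N : ℕ} (hN : N ≠ 0) (q : ℝ) (i j : ℕ) :
    ∫⁻ u in cell N i, ∫⁻ v in cell N j, riesz q (u - v) = ENNReal.ofReal ((N : ℝ) ^ (-q - 2)) *
      ∫⁻ x in Ioc 0 1, ∫⁻ y in Ioc 0 1, riesz q (i + x - (j + y)) := by
  rw [lintegral_cell hN]
  simp_rw [lintegral_cell_riesz hN]
  rw [lintegral_const_mul' _ _ ENNReal.ofReal_ne_top, ← mul_assoc, ofReal_inv_mul_rpow hN,
    show -q - 1 - 1 = -q - 2 by ring]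

lemma lintegral_cell_self_riesz {N : ℕ} (hN : N ≠ 0) {q : ℝ} (hq : -1 < q) (i : ℕ) :
    ∫⁻ u in cell N i, ∫⁻ v in cell N i, riesz q (u - v) =
      ENNReal.ofReal ((N : ℝ) ^ (-q - 2)) * ENNReal.ofReal (2 / ((q + 1) * (q + 2))) := by
  rw [lintegral_cell_cell_riesz hN, ← lintegral_lintegral_riesz hq]
  simp only [add_sub_add_left_eq_sub]

lemma antitone_rpow_of_neg {q : ℝ} (hq : q < 0) : Antitone fun x : ℝ≥0∞ => x ^ q := by
  intro x y hxy
  dsimp only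
  have h : ∀ z : ℝ≥0∞, z ^ q = (z ^ (-q))⁻¹ := fun z => by rw [← ENNReal.rpow_neg, neg_neg]
  rw [h, h]
  exact ENNReal.inv_le_inv.2 (ENNReal.rpow_le_rpow hxy (neg_pos.2 hq).le)

lemma measurable_comp_cellIdx (Q : ℕ → ℕ → ℝ≥0∞) (N : ℕ) :
    Measurable fun z : ℝ × ℝ => Q (cellIdx N z.1) (cellIdx N z.2) := by
  have h : Measurable fun p : ℕ × ℕ => Q p.1 p.2 := Measurable.of_discrete
  exact h.comp (((measurable_cellIdx N).comp measurable_fst).prodMk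
    ((measurable_cellIdx N).comp measurable_snd))

lemma ae_prod_mem_Ioc_ne :
    ∀ᵐ z ∂((volume.restrict (Ioc (0 : ℝ) 1)).prod (volume.restrict (Ioc (0 : ℝ) 1))),
      (z.1 ∈ Ioc (0 : ℝ) 1 ∧ z.2 ∈ Ioc (0 : ℝ) 1) ∧ z.2 ≠ z.1 := by
  set m : Measure ℝ := volume.restrict (Ioc 0 1)
  have hmem : ∀ᵐ x ∂m, x ∈ Ioc (0 : ℝ) 1 := ae_restrict_mem measurableSet_Ioc
  have hms : MeasurableSet {z : ℝ × ℝ | (z.1 ∈ Ioc (0 : ℝ) 1 ∧ z.2 ∈ Ioc (0 : ℝ) 1) ∧ z.2 ≠ z.1} :=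
    ((measurable_fst measurableSet_Ioc).inter (measurable_snd measurableSet_Ioc)).inter
      (measurableSet_eq_fun measurable_snd measurable_fst).compl
  refine (Measure.ae_prod_iff_ae_ae hms).2 ?_
  filter_upwards [hmem] with x hx
  filter_upwards [hmem, Measure.ae_ne m x] with y hy hxy using ⟨⟨hx, hy⟩, hxy⟩

/-- Distinct points s and t lie in cells whose index distance grows like N|s-t|, where a negative
power tends to zero uniformly in the relative positions. -/
lemma tendsto_lintegral_riesz_cellIdx {q s t : ℝ} (hq0 : q < 0) (hs : 0 < s) (ht : 0 < t)
    (hst : s ≠ t) :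
    Tendsto (fun N => ∫⁻ x in Ioc 0 1, ∫⁻ y in Ioc 0 1,
      riesz q (cellIdx N s + x - (cellIdx N t + y))) atTop (𝓝 0) := by
  have hz0 : 0 < |s - t| := abs_pos.2 (sub_ne_zero.2 hst)
  have h0 : Tendsto (fun N : ℕ => ENNReal.ofReal (N * |s - t| - 3) ^ q) atTop (𝓝 0) := by
    have h1 : Tendsto (fun N : ℕ => ENNReal.ofReal (N * |s - t| - 3)) atTop (𝓝 ∞) :=
      ENNReal.tendsto_ofReal_atTop.comp (tendsto_atTop_add_const_right _ _
        (tendsto_natCast_atTop_atTop.atTop_mul_const hz0))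
    have := (ENNReal.continuous_rpow_const (y := q)).continuousAt.tendsto.comp h1
    rwa [ENNReal.top_rpow_of_neg hq0] at this
  refine tendsto_of_tendsto_of_tendsto_of_le_of_le' tendsto_const_nhds h0
    (Eventually.of_forall fun _ => zero_le) ?_
  filter_upwards [eventually_ne_atTop 0] with N hN
  have hb : ∀ x ∈ Ioc (0 : ℝ) 1, ∀ y ∈ Ioc (0 : ℝ) 1,
      riesz q (cellIdx N s + x - (cellIdx N t + y)) ≤ ENNReal.ofReal (N * |s - t| - 3) ^ q := by
    intro x hx y hy
    refine antitone_rpow_of_neg hq0 (ENNReal.ofReal_le_ofReal ?_)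
    obtain ⟨a1, a2⟩ := cellIdx_bounds hN hs
    obtain ⟨b1, b2⟩ := cellIdx_bounds hN ht
    have e : (N : ℝ) * |s - t| = |N * s - N * t| := by
      rw [← mul_sub, abs_mul, Nat.abs_cast]
    have := abs_sub_abs_le_abs_sub ((N : ℝ) * s - N * t) (cellIdx N s + x - (cellIdx N t + y))
    -- The discrepancy combines four offsets in [0,1], two with each sign, so 3 is a safe bound.
    have h3 : |(N : ℝ) * s - N * t - (cellIdx N s + x - (cellIdx N t + y))| ≤ 3 := by
      rw [abs_le]
      constructor <;> linarith [hx.1, hx.2, hy.1, hy.2]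
    linarith
  calc ∫⁻ x in Ioc 0 1, ∫⁻ y in Ioc 0 1, riesz q (cellIdx N s + x - (cellIdx N t + y))
      ≤ ∫⁻ _ in Ioc (0 : ℝ) 1, ∫⁻ _ in Ioc (0 : ℝ) 1, ENNReal.ofReal (N * |s - t| - 3) ^ q := by
        refine setLIntegral_mono' measurableSet_Ioc fun x hx => ?_
        exact setLIntegral_mono' measurableSet_Ioc fun y hy => hb x hx y hy
    _ = _ := by simp

/-- In each square one energy is kept at macroscopic scale and the other is rescaled to unit cells,
which absorbs the factor N^(q+2). The rescaled energy is uniformly bounded and tends to zero off the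
diagonal, so dominated convergence applies with a multiple of the integrable Riesz kernel as
majorant. -/
lemma tendsto_sum_sq_cell_riesz {q : ℝ} (hq : -1 < q) (hq0 : q < 0) :
    Tendsto (fun N : ℕ => ENNReal.ofReal ((N : ℝ) ^ (q + 2)) *
      ∑ i ∈ Finset.range N, ∑ j ∈ Finset.range N,
        (∫⁻ u in cell N i, ∫⁻ v in cell N j, riesz q (u - v)) *
          ∫⁻ u in cell N i, ∫⁻ v in cell N j, riesz q (u - v)) atTop (𝓝 0) := by
  obtain ⟨C, hC, hCle⟩ := exists_lintegral_riesz_sub_le hq hq0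
  obtain ⟨Q, hQ⟩ : ∃ Q : ℕ → ℕ → ℝ≥0∞, ∀ i j, Q i j =
      ∫⁻ x in Ioc 0 1, ∫⁻ y in Ioc 0 1, riesz q (i + x - (j + y)) := ⟨_, fun _ _ => rfl⟩
  have hQC : ∀ i j, Q i j ≤ C := by
    intro i j
    calc Q i j ≤ ∫⁻ _ in Ioc (0 : ℝ) 1, C := by
          rw [hQ]
          refine lintegral_mono fun x => ?_
          simpa only [sub_sub] using hCle (i + x - j)
      _ = C := by simp
  have hQt : ∀ i j, Q i j ≠ ∞ := fun i j => ((hQC i j).trans_lt hC.lt_top).ne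
  have hmr : Measurable fun z : ℝ × ℝ => riesz q (z.1 - z.2) :=
    (measurable_riesz q).comp (measurable_fst.sub measurable_snd)
  have hFm : ∀ N, Measurable fun z : ℝ × ℝ =>
      riesz q (z.1 - z.2) * Q (cellIdx N z.1) (cellIdx N z.2) := fun N =>
    hmr.mul (measurable_comp_cellIdx Q N)
  have hkey : ∀ᶠ N : ℕ in atTop,
      ∫⁻ z, riesz q (z.1 - z.2) * Q (cellIdx N z.1) (cellIdx N z.2)
        ∂((volume.restrict (Ioc (0 : ℝ) 1)).prod (volume.restrict (Ioc (0 : ℝ) 1))) =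
      ENNReal.ofReal ((N : ℝ) ^ (q + 2)) *
      ∑ i ∈ Finset.range N, ∑ j ∈ Finset.range N,
        (∫⁻ u in cell N i, ∫⁻ v in cell N j, riesz q (u - v)) *
          ∫⁻ u in cell N i, ∫⁻ v in cell N j, riesz q (u - v) := by
    filter_upwards [eventually_ne_atTop 0] with N hN
    rw [lintegral_prod _ (hFm N).aemeasurable, Finset.mul_sum]
    rw [← sum_lintegral_cell hN fun i u => ∫⁻ v in Ioc 0 1, riesz q (u - v) * Q i (cellIdx N v)]
    refine Finset.sum_congr rfl fun i _ => ?_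
    have e : ∀ u, ∫⁻ v in Ioc 0 1, riesz q (u - v) * Q i (cellIdx N v) =
        ∑ j ∈ Finset.range N, ∫⁻ v in cell N j, riesz q (u - v) * Q i j := fun u =>
      (sum_lintegral_cell hN fun j v => riesz q (u - v) * Q i j).symm
    have e2 : ∀ u j, ∫⁻ v in cell N j, riesz q (u - v) * Q i j =
        (∫⁻ v in cell N j, riesz q (u - v)) * Q i j := fun u j =>
      lintegral_mul_const' _ _ (hQt i j)
    simp_rw [e, e2]
    have mr : ∀ j, Measurable fun u => ∫⁻ v in cell N j, riesz q (u - v) := fun j =>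
      hmr.lintegral_prod_right'
    rw [lintegral_finsetSum _ fun j _ => (mr j).mul_const _, Finset.mul_sum]
    refine Finset.sum_congr rfl fun j _ => ?_
    rw [lintegral_mul_const' _ _ (hQt i j), mul_left_comm]
    congr 1
    rw [lintegral_cell_cell_riesz hN, ← mul_assoc, ofReal_rpow_mul_rpow hN, hQ]
    simp
  refine Tendsto.congr' hkey ?_
  have hlim := tendsto_lintegral_of_dominated_convergence
    (μ := (volume.restrict (Ioc (0 : ℝ) 1)).prod (volume.restrict (Ioc (0 : ℝ) 1)))
    (F := fun N z => riesz q (z.1 - z.2) * Q (cellIdx N z.1) (cellIdx N z.2))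
    (f := fun _ => 0) (fun z => riesz q (z.1 - z.2) * C) hFm
    (fun N => ae_of_all _ fun z => mul_le_mul_right (hQC _ _) _) ?_ ?_
  · simpa using hlim
  · rw [lintegral_mul_const' _ _ hC, lintegral_prod _ hmr.aemeasurable,
      lintegral_lintegral_riesz hq]
    exact ENNReal.mul_ne_top ENNReal.ofReal_ne_top hC
  · filter_upwards [ae_prod_mem_Ioc_ne] with z hz
    have hfin : riesz q (z.1 - z.2) ≠ ∞ := by
      rw [riesz_of_ne (sub_ne_zero.2 hz.2.symm)]
      exact ENNReal.ofReal_ne_top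
    have := ENNReal.Tendsto.const_mul
      (tendsto_lintegral_riesz_cellIdx hq0 hz.1.1.1 hz.1.2.1 hz.2.symm) (Or.inr hfin)
    simpa only [mul_zero, hQ] using this

end CellEnergy

/-! ### Bounding four-cycles by the AM-GM inequality. -/

section Cycles

lemma two_mul_le_mul_self_add (x y : ℝ≥0∞) : 2 * (x * y) ≤ x * x + y * y := by
  rcases le_total x y with h | h
  · obtain ⟨c, rfl⟩ := exists_add_of_le h
    calc 2 * (x * (x + c)) ≤ 2 * (x * (x + c)) + c * c := le_self_add
      _ = _ := by ring
  · obtain ⟨c, rfl⟩ := exists_add_of_le h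
    calc 2 * ((y + c) * y) ≤ 2 * ((y + c) * y) + c * c := le_self_add
      _ = _ := by ring

lemma measurable_riesz_sub {γ : Type*} [MeasurableSpace γ] {f g : γ → ℝ} (q : ℝ)
    (hf : Measurable f) (hg : Measurable g) : Measurable fun c => riesz q (f c - g c) :=
  (measurable_riesz q).comp (hf.sub hg)

variable {ν₁ ν₂ : Measure ℝ} [SFinite ν₁] [SFinite ν₂]

/-- Every link joins the two measures. Grouping opposite links and applying 2fg ≤ f² + g² leaves
squares in which the four variables are matched in disjoint pairs, so each integral is the product
of two energies. -/
lemma lintegral_crossing_cycle_le (p : ℝ) :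
    ∫⁻ u, ∫⁻ v, ∫⁻ u', ∫⁻ v', riesz p (u - v) * riesz p (u' - v') *
      (riesz p (u - u') * riesz p (v - v')) ∂ν₁ ∂ν₂ ∂ν₂ ∂ν₁ ≤
    (∫⁻ u, ∫⁻ v, riesz (2 * p) (u - v) ∂ν₂ ∂ν₁) * ∫⁻ u, ∫⁻ v, riesz (2 * p) (u - v) ∂ν₂ ∂ν₁ := by
  set E := ∫⁻ u, ∫⁻ v, riesz (2 * p) (u - v) ∂ν₂ ∂ν₁ with hE
  have m2 : Measurable fun z : ℝ × ℝ => riesz (2 * p) (z.1 - z.2) :=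
    measurable_riesz_sub _ measurable_fst measurable_snd
  have mi : ∀ ν : Measure ℝ, SFinite ν → Measurable fun u => ∫⁻ v, riesz (2 * p) (u - v) ∂ν :=
    fun ν _ => m2.lintegral_prod_right'
  have mc : ∀ u, Measurable fun v => riesz (2 * p) (u - v) := fun u =>
    measurable_riesz_sub _ measurable_const measurable_id
  have hE' : ∫⁻ v, ∫⁻ u, riesz (2 * p) (v - u) ∂ν₁ ∂ν₂ = E := by
    rw [hE, lintegral_lintegral_swap m2.aemeasurable]
    simp_rw [riesz_sub_comm (2 * p)]
  have s1 : ∫⁻ u, ∫⁻ v, ∫⁻ u', ∫⁻ v', riesz (2 * p) (u - v) * riesz (2 * p) (u' - v')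
      ∂ν₁ ∂ν₂ ∂ν₂ ∂ν₁ = E * E := by
    simp_rw [lintegral_const_mul _ (mc _), lintegral_const_mul _ (mi ν₁ inferInstance), hE',
      lintegral_mul_const _ (mc _), lintegral_mul_const _ (mi ν₂ inferInstance)]
    rfl
  have s2 : ∫⁻ u, ∫⁻ v, ∫⁻ u', ∫⁻ v', riesz (2 * p) (u - u') * riesz (2 * p) (v - v')
      ∂ν₁ ∂ν₂ ∂ν₂ ∂ν₁ = E * E := by
    simp_rw [lintegral_const_mul _ (mc _), lintegral_mul_const _ (mc _),
      lintegral_const_mul _ (mi ν₁ inferInstance), hE',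
      lintegral_mul_const _ (mi ν₂ inferInstance)]
    rfl
  have hle : 2 * ∫⁻ u, ∫⁻ v, ∫⁻ u', ∫⁻ v', riesz p (u - v) * riesz p (u' - v') *
      (riesz p (u - u') * riesz p (v - v')) ∂ν₁ ∂ν₂ ∂ν₂ ∂ν₁ ≤ E * E + E * E := by
    set f : (ℝ × ℝ) × (ℝ × ℝ) → ℝ≥0∞ := fun z => riesz p (z.1.1 - z.1.2) * riesz p (z.2.1 - z.2.2)
    set g : (ℝ × ℝ) × (ℝ × ℝ) → ℝ≥0∞ := fun z => riesz p (z.1.1 - z.2.1) * riesz p (z.1.2 - z.2.2)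
    have mf : Measurable f := (measurable_riesz_sub _ measurable_fst.fst measurable_fst.snd).mul
      (measurable_riesz_sub _ measurable_snd.fst measurable_snd.snd)
    have mg : Measurable g := (measurable_riesz_sub _ measurable_fst.fst measurable_snd.fst).mul
      (measurable_riesz_sub _ measurable_fst.snd measurable_snd.snd)
    have ef : ∀ z, f z * f z =
        riesz (2 * p) (z.1.1 - z.1.2) * riesz (2 * p) (z.2.1 - z.2.2) := fun z => by
      simp only [f, ← riesz_mul_self]; ring
    have eg : ∀ z, g z * g z =
        riesz (2 * p) (z.1.1 - z.2.1) * riesz (2 * p) (z.1.2 - z.2.2) := fun z => by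
      simp only [g, ← riesz_mul_self]; ring
    have hf := lintegral_prod_prod (ν₁ := ν₁) (ν₂ := ν₂) (ν₃ := ν₂) (ν₄ := ν₁) (mf.mul mf)
    have hg := lintegral_prod_prod (ν₁ := ν₁) (ν₂ := ν₂) (ν₃ := ν₂) (ν₄ := ν₁) (mg.mul mg)
    have hfg := lintegral_prod_prod (ν₁ := ν₁) (ν₂ := ν₂) (ν₃ := ν₂) (ν₄ := ν₁) (mf.mul mg)
    simp only [Pi.mul_apply, ef, eg] at hf hg
    rw [s1] at hf
    rw [s2] at hg
    simp only [Pi.mul_apply, f, g] at hfg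
    rw [← hfg]
    nth_rw 1 [← hf]
    rw [← hg, ← lintegral_const_mul' _ _ (by simp), ← lintegral_add_left]
    · refine lintegral_mono fun z => ?_
      rw [← ef, ← eg]
      exact two_mul_le_mul_self_add (f z) (g z)
    · simp_rw [← ef]
      exact mf.mul mf
  rw [← two_mul] at hle
  exact (ENNReal.mul_le_mul_iff_right (by simp) (by simp)).1 hle

/-- AM-GM is applied only to the two links across, the links inside being kept as weights. In each
half two variables become free and integrate to potentials, and the two halves agree by exchanging
(u, u') with (v, v'). For small cells the links across are nearly equal, so nothing is lost in the
limit. -/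
lemma lintegral_inner_cycle_le (p : ℝ) :
    ∫⁻ u, ∫⁻ v, ∫⁻ u', ∫⁻ v', riesz p (u - v) * riesz p (u' - v') *
      (riesz p (u - u') * riesz p (v - v')) ∂ν₂ ∂ν₂ ∂ν₁ ∂ν₁ ≤
    ∫⁻ u, ∫⁻ u', (∫⁻ v, riesz p (u - v) ∂ν₁) * (∫⁻ v', riesz p (u' - v') ∂ν₂) *
      riesz (2 * p) (u - u') ∂ν₂ ∂ν₁ := by
  set W₁ : ℝ → ℝ≥0∞ := fun u => ∫⁻ v, riesz p (u - v) ∂ν₁ with hW₁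
  set W₂ : ℝ → ℝ≥0∞ := fun u => ∫⁻ v, riesz p (u - v) ∂ν₂ with hW₂
  have mp : Measurable fun z : ℝ × ℝ => riesz p (z.1 - z.2) :=
    measurable_riesz_sub _ measurable_fst measurable_snd
  have m2 : Measurable fun z : ℝ × ℝ => riesz (2 * p) (z.1 - z.2) :=
    measurable_riesz_sub _ measurable_fst measurable_snd
  have mW₁ : Measurable W₁ := mp.lintegral_prod_right'
  have mW₂ : Measurable W₂ := mp.lintegral_prod_right'
  have mcp : ∀ u, Measurable fun v => riesz p (u - v) := fun u =>
    measurable_riesz_sub _ measurable_const measurable_id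
  have mc2 : ∀ u, Measurable fun v => riesz (2 * p) (u - v) := fun u =>
    measurable_riesz_sub _ measurable_const measurable_id
  have mWr : ∀ u, Measurable fun u' => W₂ u' * riesz (2 * p) (u - u') := fun u => mW₂.mul (mc2 u)
  have mA : Measurable fun u => ∫⁻ u', W₂ u' * riesz (2 * p) (u - u') ∂ν₂ := by
    have : Measurable fun z : ℝ × ℝ => W₂ z.2 * riesz (2 * p) (z.1 - z.2) :=
      (mW₂.comp measurable_snd).mul m2
    exact this.lintegral_prod_right'
  set B := ∫⁻ u, ∫⁻ u', W₁ u * W₂ u' * riesz (2 * p) (u - u') ∂ν₂ ∂ν₁ with hB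
  have hB' : B = ∫⁻ u, W₁ u * ∫⁻ u', W₂ u' * riesz (2 * p) (u - u') ∂ν₂ ∂ν₁ := by
    refine lintegral_congr fun u => ?_
    simp_rw [mul_assoc]
    rw [lintegral_const_mul _ (mWr u)]
  have s1 : ∫⁻ u, ∫⁻ v, ∫⁻ u', ∫⁻ v', riesz p (u - v) * riesz p (u' - v') * riesz (2 * p) (u - u')
      ∂ν₂ ∂ν₂ ∂ν₁ ∂ν₁ = B := by
    rw [hB']
    refine lintegral_congr fun u => ?_
    rw [hW₁, ← lintegral_mul_const _ (mcp u)]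
    refine lintegral_congr fun v => ?_
    rw [← lintegral_const_mul _ (mWr u)]
    refine lintegral_congr fun u' => ?_
    rw [lintegral_mul_const _ ((mcp u').const_mul _), lintegral_const_mul _ (mcp u'), mul_assoc]
  -- This is the other half; the order of integration is changed so that u and u' become the free
  -- variables.
  have s2 : ∫⁻ u, ∫⁻ v, ∫⁻ u', ∫⁻ v', riesz p (u - v) * riesz p (u' - v') * riesz (2 * p) (v - v')
      ∂ν₂ ∂ν₂ ∂ν₁ ∂ν₁ = B := by
    have e1 : ∀ u v, ∫⁻ u', ∫⁻ v', riesz p (u - v) * riesz p (u' - v') * riesz (2 * p) (v - v')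
        ∂ν₂ ∂ν₂ = riesz p (u - v) * ∫⁻ v', W₂ v' * riesz (2 * p) (v - v') ∂ν₂ := by
      intro u v
      rw [lintegral_lintegral_swap, ← lintegral_const_mul _ (mWr v)]
      · refine lintegral_congr fun v' => ?_
        have : ∀ u', riesz p (u - v) * riesz p (u' - v') * riesz (2 * p) (v - v') =
            riesz p (u - v) * riesz (2 * p) (v - v') * riesz p (v' - u') := fun u' => by
          rw [riesz_sub_comm p u' v']; ring
        simp_rw [this]
        rw [lintegral_const_mul _ (mcp v')]
        simp only [hW₂]
        ring
      · exact ((mp.const_mul _).mul ((mc2 v).comp measurable_snd)).aemeasurable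
    simp_rw [e1]
    rw [lintegral_lintegral_swap, hB']
    · refine lintegral_congr fun v => ?_
      simp_rw [riesz_sub_comm p _ v]
      rw [lintegral_mul_const _ (mcp v)]
    · exact (mp.mul (mA.comp measurable_snd)).aemeasurable
  set f : (ℝ × ℝ) × (ℝ × ℝ) → ℝ≥0∞ := fun z => riesz p (z.1.1 - z.1.2) * riesz p (z.2.1 - z.2.2)
    with hf
  have mf : Measurable f := (measurable_riesz_sub _ measurable_fst.fst measurable_fst.snd).mul
    (measurable_riesz_sub _ measurable_snd.fst measurable_snd.snd)
  have mx : ∀ q, Measurable fun z : (ℝ × ℝ) × (ℝ × ℝ) => riesz q (z.1.1 - z.2.1) := fun q =>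
    measurable_riesz_sub _ measurable_fst.fst measurable_snd.fst
  have my : ∀ q, Measurable fun z : (ℝ × ℝ) × (ℝ × ℝ) => riesz q (z.1.2 - z.2.2) := fun q =>
    measurable_riesz_sub _ measurable_fst.snd measurable_snd.snd
  have h1 := lintegral_prod_prod (ν₁ := ν₁) (ν₂ := ν₁) (ν₃ := ν₂) (ν₄ := ν₂) (mf.mul (mx (2 * p)))
  have h2 := lintegral_prod_prod (ν₁ := ν₁) (ν₂ := ν₁) (ν₃ := ν₂) (ν₄ := ν₂) (mf.mul (my (2 * p)))
  have h3 := lintegral_prod_prod (ν₁ := ν₁) (ν₂ := ν₁) (ν₃ := ν₂) (ν₄ := ν₂)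
    (mf.mul ((mx p).mul (my p)))
  simp only [Pi.mul_apply, hf] at h1 h2 h3
  rw [s1] at h1
  rw [s2] at h2
  have hle : 2 * ∫⁻ u, ∫⁻ v, ∫⁻ u', ∫⁻ v', riesz p (u - v) * riesz p (u' - v') *
      (riesz p (u - u') * riesz p (v - v')) ∂ν₂ ∂ν₂ ∂ν₁ ∂ν₁ ≤ B + B := by
    rw [← h3]
    nth_rw 1 [← h1]
    have mfx : Measurable fun z : (ℝ × ℝ) × (ℝ × ℝ) => riesz p (z.1.1 - z.1.2) *
        riesz p (z.2.1 - z.2.2) * riesz (2 * p) (z.1.1 - z.2.1) := mf.mul (mx (2 * p))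
    rw [← h2, ← lintegral_const_mul' _ _ (by simp), ← lintegral_add_left mfx]
    refine lintegral_mono fun z => ?_
    dsimp only
    rw [← mul_add, mul_left_comm, ← riesz_mul_self, ← riesz_mul_self]
    gcongr
    exact two_mul_le_mul_self_add _ _
  rw [← two_mul] at hle
  exact (ENNReal.mul_le_mul_iff_right (by simp) (by simp)).1 hle

end Cycles

/-! ### Asymptotics of the sums of four-cycles and triangles. -/

section Limits

/-- The Riesz potential of the unit interval. -/
noncomputable def rieszPotential (p x : ℝ) : ℝ≥0∞ := ∫⁻ z in Ioc 0 1, riesz p (x - z)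

lemma measurable_rieszPotential (p : ℝ) : Measurable (rieszPotential p) := by
  have : Measurable fun z : ℝ × ℝ => riesz p (z.1 - z.2) :=
    measurable_riesz_sub _ measurable_fst measurable_snd
  exact this.lintegral_prod_right'

lemma lintegral_cell_rescale {N : ℕ} (hN : N ≠ 0) (p s x : ℝ) :
    ∫⁻ v in cell N (cellIdx N s), riesz p (rescale N s x - v) =
      ENNReal.ofReal ((N : ℝ) ^ (-p - 1)) * rieszPotential p x := by
  rw [rescale, lintegral_cell_riesz hN]
  simp only [add_sub_add_left_eq_sub, rieszPotential]

/-- Lebesgue measure on `(0,1]⁴`, with coordinates grouped in pairs. -/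
noncomputable def cubeMeasure : Measure ((ℝ × ℝ) × (ℝ × ℝ)) :=
  ((volume.restrict (Ioc 0 1)).prod (volume.restrict (Ioc 0 1))).prod
    ((volume.restrict (Ioc 0 1)).prod (volume.restrict (Ioc 0 1)))

lemma lintegral_cubeMeasure {Φ : (ℝ × ℝ) × (ℝ × ℝ) → ℝ≥0∞} (hΦ : Measurable Φ) :
    ∫⁻ z, Φ z ∂cubeMeasure = ∫⁻ a in Ioc 0 1, ∫⁻ b in Ioc 0 1, ∫⁻ c in Ioc 0 1, ∫⁻ d in Ioc 0 1,
      Φ ((a, b), (c, d)) :=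
  lintegral_prod_prod hΦ

lemma ae_cubeMeasure_mem :
    ∀ᵐ z ∂cubeMeasure, (z.1.1 ∈ Ioc (0 : ℝ) 1 ∧ z.1.2 ∈ Ioc (0 : ℝ) 1) ∧
      (z.2.1 ∈ Ioc (0 : ℝ) 1 ∧ z.2.2 ∈ Ioc (0 : ℝ) 1) := by
  have h := ae_prod_mem_Ioc_ne
  filter_upwards [Measure.quasiMeasurePreserving_fst.ae h,
    Measure.quasiMeasurePreserving_snd.ae h] with z h1 h2 using ⟨h1.1, h2.1⟩

/-- A reverse Fatou principle: when two sequences have a constant finite sum, a lower bound on the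
liminf of one is an upper bound on the limsup of the other. -/
lemma limsup_le_of_add_eq {a b : ℕ → ℝ≥0∞} {A B c : ℝ≥0∞} (hc : c ≠ ∞)
    (hab : ∀ᶠ N in atTop, a N + b N = c) (hAB : A + B = c) (hb : B ≤ liminf b atTop) :
    limsup a atTop ≤ A := by
  have hBt : B ≠ ∞ := ne_top_of_le_ne_top hc (hAB ▸ le_add_self)
  have hA : A = c - B := by rw [← hAB, ENNReal.add_sub_cancel_right hBt]
  have e : a =ᶠ[atTop] fun N => c - b N := by
    filter_upwards [hab] with N hN
    have : b N ≠ ∞ := ne_top_of_le_ne_top hc (hN ▸ le_add_self)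
    rw [← hN, ENNReal.add_sub_cancel_right this]
  rw [limsup_congr e, hA, ENNReal.limsup_const_sub atTop b hc]
  exact tsub_le_tsub_left hb c

/-- Rescaled interaction of two pairs of neighbouring points. -/
lemma limsup_lintegral_potential_le {p : ℝ} (hp : -(1 / 2) < p) (hp0 : p < 0) :
    limsup (fun N => ∫⁻ z, rieszPotential p z.1.2 * rieszPotential p z.2.2 *
        riesz (2 * p) (rescale N z.1.1 z.1.2 - rescale N z.2.1 z.2.2) ∂cubeMeasure) atTop ≤
      ENNReal.ofReal (2 / ((p + 1) * (p + 2))) * ENNReal.ofReal (2 / ((p + 1) * (p + 2))) *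
        ENNReal.ofReal (2 / ((2 * p + 1) * (2 * p + 2))) := by
  obtain ⟨C, hC, hCle⟩ := exists_lintegral_riesz_sub_le (q := p) (by linarith) hp0
  set κ := ENNReal.ofReal (2 / ((p + 1) * (p + 2))) with hκ
  set J := ENNReal.ofReal (2 / ((2 * p + 1) * (2 * p + 2))) with hJ
  set ω := rieszPotential p with hω
  have hωC : ∀ x, ω x ≤ C := fun x => hCle x
  have mω : Measurable ω := measurable_rieszPotential p
  have hωκ : ∫⁻ x in Ioc 0 1, ω x = κ := lintegral_lintegral_riesz (by linarith)
  have hJe : ∫⁻ x in Ioc 0 1, ∫⁻ y in Ioc 0 1, riesz (2 * p) (x - y) = J :=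
    lintegral_lintegral_riesz (by linarith)
  have mτ : ∀ N, Measurable fun z : (ℝ × ℝ) × (ℝ × ℝ) =>
      riesz (2 * p) (rescale N z.1.1 z.1.2 - rescale N z.2.1 z.2.2) := fun N =>
    measurable_riesz_sub _ ((measurable_rescale N).comp measurable_fst)
      ((measurable_rescale N).comp measurable_snd)
  have mωω : Measurable fun z : (ℝ × ℝ) × (ℝ × ℝ) => ω z.1.2 * ω z.2.2 :=
    (mω.comp measurable_fst.snd).mul (mω.comp measurable_snd.snd)
  have m1 : Measurable fun z : (ℝ × ℝ) × (ℝ × ℝ) => riesz (2 * p) (z.1.1 - z.2.1) :=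
    measurable_riesz_sub _ measurable_fst.fst measurable_snd.fst
  have mω1 : Measurable fun z : (ℝ × ℝ) × (ℝ × ℝ) =>
      ω z.1.2 * ω z.2.2 * riesz (2 * p) (z.1.1 - z.2.1) := mωω.mul m1
  have mωτ : ∀ N, Measurable fun z : (ℝ × ℝ) × (ℝ × ℝ) => ω z.1.2 * ω z.2.2 *
      riesz (2 * p) (rescale N z.1.1 z.1.2 - rescale N z.2.1 z.2.2) := fun N => mωω.mul (mτ N)
  have hle : ∀ z : (ℝ × ℝ) × (ℝ × ℝ), ω z.1.2 * ω z.2.2 ≤ C * C := fun z =>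
    mul_le_mul' (hωC _) (hωC _)
  have hCC : C * C ≠ ∞ := ENNReal.mul_ne_top hC hC
  have mD : Measurable fun z : (ℝ × ℝ) × (ℝ × ℝ) => C * C - ω z.1.2 * ω z.2.2 :=
    measurable_const.sub mωω
  have hA : ∫⁻ z, ω z.1.2 * ω z.2.2 * riesz (2 * p) (z.1.1 - z.2.1) ∂cubeMeasure = κ * κ * J := by
    rw [lintegral_cubeMeasure mω1]
    have e1 : ∀ a b c : ℝ, ∫⁻ d in Ioc 0 1, ω b * ω d * riesz (2 * p) (a - c) =
        ω b * (κ * riesz (2 * p) (a - c)) := by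
      intro a b c
      rw [← hωκ, ← lintegral_mul_const _ mω, ← lintegral_const_mul _ (mω.mul_const _)]
      simp only [mul_assoc]
    have mc : ∀ a : ℝ, Measurable fun c => riesz (2 * p) (a - c) := fun a =>
      measurable_riesz_sub _ measurable_const measurable_id
    have e2 : ∀ a b : ℝ, ∫⁻ c in Ioc 0 1, ω b * (κ * riesz (2 * p) (a - c)) =
        ω b * (κ * ∫⁻ c in Ioc 0 1, riesz (2 * p) (a - c)) := by
      intro a b
      rw [lintegral_const_mul _ ((mc a).const_mul κ), lintegral_const_mul _ (mc a)]
    simp_rw [e1, e2]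
    have e3 : ∀ a : ℝ, ∫⁻ b in Ioc 0 1, ω b * (κ * ∫⁻ c in Ioc 0 1, riesz (2 * p) (a - c)) =
        κ * κ * ∫⁻ c in Ioc 0 1, riesz (2 * p) (a - c) := by
      intro a
      rw [lintegral_mul_const _ mω, hωκ, mul_assoc]
    simp_rw [e3]
    rw [lintegral_const_mul' _ _ (ENNReal.mul_ne_top ENNReal.ofReal_ne_top ENNReal.ofReal_ne_top),
      hJe]
  have hone : ∫⁻ z, riesz (2 * p) (z.1.1 - z.2.1) ∂cubeMeasure = J := by
    rw [lintegral_cubeMeasure m1, ← hJe]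
    simp
  -- Without the weights the rescaled integral is only a reparametrization of the whole unit square
  -- by cells, so it does not depend on N. This supplies the constant sum.
  have htotal : ∀ N ≠ 0, ∫⁻ z, riesz (2 * p) (rescale N z.1.1 z.1.2 - rescale N z.2.1 z.2.2)
      ∂cubeMeasure = J := by
    intro N hN
    rw [lintegral_cubeMeasure (mτ N), ← hJe]
    refine Eq.trans ?_ ((lintegral_eq_sum_cell hN _).trans (sum_lintegral_cell_eq hN
      fun _ u => ∫⁻ v in Ioc 0 1, riesz (2 * p) (u - v))).symm
    refine lintegral_congr fun a => lintegral_congr fun b => ?_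
    exact ((lintegral_eq_sum_cell hN _).trans (sum_lintegral_cell_eq hN
      fun _ v => riesz (2 * p) (rescale N a b - v))).symm
  -- Fatou's lemma bounds from below, so it is applied with the complementary weight, nonnegative
  -- because the potential is bounded by C.
  refine limsup_le_of_add_eq
    (b := fun N => ∫⁻ z, (C * C - ω z.1.2 * ω z.2.2) *
      riesz (2 * p) (rescale N z.1.1 z.1.2 - rescale N z.2.1 z.2.2) ∂cubeMeasure)
    (B := ∫⁻ z, (C * C - ω z.1.2 * ω z.2.2) * riesz (2 * p) (z.1.1 - z.2.1) ∂cubeMeasure)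
    (c := C * C * J) (ENNReal.mul_ne_top hCC ENNReal.ofReal_ne_top) ?_ ?_ ?_
  · filter_upwards [eventually_ne_atTop 0] with N hN
    rw [← lintegral_add_left (mωτ N), ← htotal N hN, ← lintegral_const_mul _ (mτ N)]
    refine lintegral_congr fun z => ?_
    rw [← add_mul, add_tsub_cancel_of_le (hle z)]
  · rw [← hA, ← lintegral_add_left mω1, ← hone, ← lintegral_const_mul _ m1]
    refine lintegral_congr fun z => ?_
    rw [← add_mul, add_tsub_cancel_of_le (hle z)]
  · refine le_trans (lintegral_mono_ae ?_) (lintegral_liminf_le fun N => mD.mul (mτ N))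
    filter_upwards [ae_cubeMeasure_mem] with z hz
    have h1 := (tendsto_rescale hz.1.1.1 hz.1.2).sub (tendsto_rescale hz.2.1.1 hz.2.2)
    have h2 := ((continuous_riesz (2 * p)).tendsto _).comp h1
    have h3 := ENNReal.Tendsto.const_mul (a := C * C - ω z.1.2 * ω z.2.2) h2
      (Or.inr (ne_top_of_le_ne_top hCC tsub_le_self))
    exact h3.liminf_eq.ge

/-- The sum over pairs of cells of the energies of the cycles made of two links inside the cells
and two links across. -/
lemma limsup_sum_inner_cycle_le {p : ℝ} (hp : -(1 / 2) < p) (hp0 : p < 0) :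
    limsup (fun N : ℕ => ENNReal.ofReal ((N : ℝ) ^ (2 * p + 2)) *
      ∑ i ∈ Finset.range N, ∑ j ∈ Finset.range N,
        ∫⁻ u in cell N i, ∫⁻ v in cell N i, ∫⁻ u' in cell N j, ∫⁻ v' in cell N j,
          riesz p (u - v) * riesz p (u' - v') * (riesz p (u - u') * riesz p (v - v'))) atTop ≤
      ENNReal.ofReal (2 / ((p + 1) * (p + 2))) * ENNReal.ofReal (2 / ((p + 1) * (p + 2))) *
        ENNReal.ofReal (2 / ((2 * p + 1) * (2 * p + 2))) := by
  refine le_trans (limsup_le_limsup ?_) (limsup_lintegral_potential_le hp hp0)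
  filter_upwards [eventually_ne_atTop 0] with N hN
  have hN' : (0 : ℝ) < N := by positivity
  set W : ℕ → ℝ → ℝ≥0∞ := fun i u => ∫⁻ v in cell N i, riesz p (u - v) with hW
  have mW : ∀ i, Measurable (W i) := by
    intro i
    have : Measurable fun z : ℝ × ℝ => riesz p (z.1 - z.2) :=
      measurable_riesz_sub _ measurable_fst measurable_snd
    exact this.lintegral_prod_right'
  have h1 : ∑ i ∈ Finset.range N, ∑ j ∈ Finset.range N,
        ∫⁻ u in cell N i, ∫⁻ v in cell N i, ∫⁻ u' in cell N j, ∫⁻ v' in cell N j,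
          riesz p (u - v) * riesz p (u' - v') * (riesz p (u - u') * riesz p (v - v')) ≤
      ∑ i ∈ Finset.range N, ∑ j ∈ Finset.range N,
        ∫⁻ u in cell N i, ∫⁻ u' in cell N j, W i u * W j u' * riesz (2 * p) (u - u') :=
    Finset.sum_le_sum fun i _ => Finset.sum_le_sum fun j _ => lintegral_inner_cycle_le p
  have h2 : ∑ i ∈ Finset.range N, ∑ j ∈ Finset.range N,
        ∫⁻ u in cell N i, ∫⁻ u' in cell N j, W i u * W j u' * riesz (2 * p) (u - u') =
      ∫⁻ s in Ioc 0 1, ∫⁻ x in Ioc 0 1, ∫⁻ t in Ioc 0 1, ∫⁻ y in Ioc 0 1,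
        W (cellIdx N s) (rescale N s x) * W (cellIdx N t) (rescale N t y) *
          riesz (2 * p) (rescale N s x - rescale N t y) := by
    rw [← sum_lintegral_cell_eq hN fun i u => ∫⁻ t in Ioc 0 1, ∫⁻ y in Ioc 0 1,
        W i u * W (cellIdx N t) (rescale N t y) * riesz (2 * p) (u - rescale N t y)]
    refine Finset.sum_congr rfl fun i _ => ?_
    rw [← lintegral_finsetSum]
    · refine lintegral_congr fun u => ?_
      exact sum_lintegral_cell_eq hN fun j u' => W i u * W j u' * riesz (2 * p) (u - u')
    · intro j _
      have : Measurable fun z : ℝ × ℝ => W i z.1 * W j z.2 * riesz (2 * p) (z.1 - z.2) :=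
        (((mW i).comp measurable_fst).mul ((mW j).comp measurable_snd)).mul
          (measurable_riesz_sub _ measurable_fst measurable_snd)
      exact this.lintegral_prod_right'
  refine (mul_le_mul_right (h1.trans_eq h2) _).trans_eq ?_
  have mω := measurable_rieszPotential p
  have mint : Measurable fun z : (ℝ × ℝ) × (ℝ × ℝ) =>
      rieszPotential p z.1.2 * rieszPotential p z.2.2 *
        riesz (2 * p) (rescale N z.1.1 z.1.2 - rescale N z.2.1 z.2.2) :=
    ((mω.comp measurable_fst.snd).mul (mω.comp measurable_snd.snd)).mul
      (measurable_riesz_sub _ ((measurable_rescale N).comp measurable_fst)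
        ((measurable_rescale N).comp measurable_snd))
  rw [lintegral_cubeMeasure mint]
  have e : ∀ a b c d : ℝ, ENNReal.ofReal ((N : ℝ) ^ (2 * p + 2)) *
      (W (cellIdx N a) (rescale N a b) * W (cellIdx N c) (rescale N c d) *
          riesz (2 * p) (rescale N a b - rescale N c d)) =
      rieszPotential p b * rieszPotential p d *
        riesz (2 * p) (rescale N a b - rescale N c d) := by
    intro a b c d
    simp only [hW, lintegral_cell_rescale hN]
    -- Each of the two inner potentials scales as N^(-p-1), which the prefactor compensates exactly.
    have : ENNReal.ofReal ((N : ℝ) ^ (2 * p + 2)) * (ENNReal.ofReal ((N : ℝ) ^ (-p - 1)) *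
        ENNReal.ofReal ((N : ℝ) ^ (-p - 1))) = 1 := by
      rw [ofReal_rpow_mul_rpow hN, ofReal_rpow_mul_rpow hN]
      ring_nf
      simp
    calc _ = (ENNReal.ofReal ((N : ℝ) ^ (2 * p + 2)) * (ENNReal.ofReal ((N : ℝ) ^ (-p - 1)) *
        ENNReal.ofReal ((N : ℝ) ^ (-p - 1)))) * (rieszPotential p b * rieszPotential p d *
        riesz (2 * p) (rescale N a b - rescale N c d)) := by ring
      _ = _ := by rw [this, one_mul]
  simp_rw [← lintegral_const_mul' _ _ (ENNReal.ofReal_ne_top (r := (N : ℝ) ^ (2 * p + 2))), e]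

/-- The sum over cells of the energies of the triangles with two vertices in the cell. -/
lemma le_liminf_sum_triangle {p : ℝ} (hp : -(1 / 2) < p) :
    ENNReal.ofReal (2 / ((p + 1) * (p + 2))) * ENNReal.ofReal (2 / ((2 * p + 1) * (2 * p + 2))) ≤
      liminf (fun N : ℕ => ENNReal.ofReal ((N : ℝ) ^ (p + 1)) *
      ∑ i ∈ Finset.range N, ∫⁻ u in cell N i, ∫⁻ v in cell N i, ∫⁻ w in Ioc 0 1,
          riesz p (u - v) * (riesz p (u - w) * riesz p (v - w))) atTop := by
  have m1 : Measurable fun z : (ℝ × ℝ) × (ℝ × ℝ) => riesz p (z.1.2 - z.2.1) :=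
    measurable_riesz_sub _ measurable_fst.snd measurable_snd.fst
  have m2 : Measurable fun z : (ℝ × ℝ) × (ℝ × ℝ) => riesz (2 * p) (z.1.1 - z.2.2) :=
    measurable_riesz_sub _ measurable_fst.fst measurable_snd.snd
  have m12 : Measurable fun z : (ℝ × ℝ) × (ℝ × ℝ) => riesz p (z.1.2 - z.2.1) *
      riesz (2 * p) (z.1.1 - z.2.2) := m1.mul m2
  have mN : ∀ N, Measurable fun z : (ℝ × ℝ) × (ℝ × ℝ) => riesz p (z.1.2 - z.2.1) *
      (riesz p (rescale N z.1.1 z.1.2 - z.2.2) * riesz p (rescale N z.1.1 z.2.1 - z.2.2)) := by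
    intro N
    refine m1.mul ((measurable_riesz_sub _ ((measurable_rescale N).comp measurable_fst)
      measurable_snd.snd).mul (measurable_riesz_sub _ ((measurable_rescale N).comp
      (measurable_fst.fst.prodMk measurable_snd.fst)) measurable_snd.snd))
  have hlim : ∫⁻ z, riesz p (z.1.2 - z.2.1) * riesz (2 * p) (z.1.1 - z.2.2) ∂cubeMeasure =
      ENNReal.ofReal (2 / ((p + 1) * (p + 2))) *
        ENNReal.ofReal (2 / ((2 * p + 1) * (2 * p + 2))) := by
    have mc : ∀ q a : ℝ, Measurable fun c => riesz q (a - c) := fun q a =>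
      measurable_riesz_sub _ measurable_const measurable_id
    have mi : ∀ q : ℝ, Measurable (rieszPotential q) := measurable_rieszPotential
    have hi : ∀ q : ℝ, -1 < q → ∫⁻ b in Ioc 0 1, rieszPotential q b =
        ENNReal.ofReal (2 / ((q + 1) * (q + 2))) := fun q hq => lintegral_lintegral_riesz hq
    rw [lintegral_cubeMeasure m12]
    have e1 : ∀ a b c : ℝ, ∫⁻ d in Ioc 0 1, riesz p (b - c) * riesz (2 * p) (a - d) =
        riesz p (b - c) * rieszPotential (2 * p) a := fun a b c =>
      lintegral_const_mul _ (mc _ _)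
    have e2 : ∀ a b : ℝ, ∫⁻ c in Ioc 0 1, riesz p (b - c) * rieszPotential (2 * p) a =
        rieszPotential p b * rieszPotential (2 * p) a := fun a b =>
      lintegral_mul_const _ (mc _ _)
    simp_rw [e1, e2, lintegral_mul_const _ (mi p), hi p (by linarith),
      lintegral_const_mul _ (mi (2 * p)), hi (2 * p) (by linarith)]
  have hev : ∀ᶠ N : ℕ in atTop, ∫⁻ z, riesz p (z.1.2 - z.2.1) *
      (riesz p (rescale N z.1.1 z.1.2 - z.2.2) * riesz p (rescale N z.1.1 z.2.1 - z.2.2))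
        ∂cubeMeasure = ENNReal.ofReal ((N : ℝ) ^ (p + 1)) *
      ∑ i ∈ Finset.range N, ∫⁻ u in cell N i, ∫⁻ v in cell N i, ∫⁻ w in Ioc 0 1,
          riesz p (u - v) * (riesz p (u - w) * riesz p (v - w)) := by
    filter_upwards [eventually_ne_atTop 0] with N hN
    rw [lintegral_cubeMeasure (mN N), sum_lintegral_cell_eq hN fun i u => ∫⁻ v in cell N i,
      ∫⁻ w in Ioc 0 1, riesz p (u - v) * (riesz p (u - w) * riesz p (v - w))]
    rw [← lintegral_const_mul' _ _ ENNReal.ofReal_ne_top]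
    refine lintegral_congr fun a => ?_
    rw [← lintegral_const_mul' _ _ ENNReal.ofReal_ne_top]
    refine lintegral_congr fun b => ?_
    rw [lintegral_cell hN, ← mul_assoc, mul_comm (ENNReal.ofReal _), ofReal_inv_mul_rpow hN,
      ← lintegral_const_mul' _ _ ENNReal.ofReal_ne_top]
    refine lintegral_congr fun c => ?_
    rw [← lintegral_const_mul' _ _ ENNReal.ofReal_ne_top]
    refine lintegral_congr fun d => ?_
    change _ = _ * (riesz p (rescale N a b - rescale N a c) * (riesz p (rescale N a b - d) *
      riesz p (rescale N a c - d)))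
    have : riesz p (rescale N a b - rescale N a c) =
        ENNReal.ofReal ((N : ℝ) ^ (-p)) * riesz p (b - c) := by
      rw [rescale, rescale, sub_div_riesz hN, add_sub_add_left_eq_sub]
    rw [this, ← mul_assoc (ENNReal.ofReal _), ← mul_assoc (ENNReal.ofReal _),
      ofReal_rpow_mul_rpow hN]
    simp
  rw [← liminf_congr hev, ← hlim]
  -- Fatou's lemma: the two vertices in the cell converge to the same macroscopic point, so the two
  -- long links merge into one of exponent 2p, while the rescaled short link does not depend on N.
  refine le_trans (lintegral_mono_ae ?_) (lintegral_liminf_le mN)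
  -- The diagonals are discarded because continuity of multiplication in `ℝ≥0∞` needs finite
  -- factors.
  have hne : ∀ᵐ z ∂cubeMeasure, z.1.2 ≠ z.2.1 ∧ z.1.1 ≠ z.2.2 := by
    have h := ae_prod_mem_Ioc_ne
    filter_upwards [(QuasiMeasurePreserving.prodMap Measure.quasiMeasurePreserving_snd
      Measure.quasiMeasurePreserving_fst).ae h, (QuasiMeasurePreserving.prodMap Measure.quasiMeasurePreserving_fst
      Measure.quasiMeasurePreserving_snd).ae h] with z h1 h2 using ⟨h1.2.symm, h2.2.symm⟩
  filter_upwards [ae_cubeMeasure_mem, hne] with z hz hz'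
  have hfin : ∀ q x : ℝ, x ≠ 0 → riesz q x ≠ ∞ := fun q x hx => by
    rw [riesz_of_ne hx]; exact ENNReal.ofReal_ne_top
  have h1 := ((continuous_riesz p).tendsto _).comp
    ((tendsto_rescale hz.1.1.1 hz.1.2).sub_const z.2.2)
  have h2 := ((continuous_riesz p).tendsto _).comp
    ((tendsto_rescale hz.1.1.1 hz.2.1).sub_const z.2.2)
  have h12 := hfin p _ (sub_ne_zero.2 hz'.2)
  have h3 := ENNReal.Tendsto.const_mul (a := riesz p (z.1.2 - z.2.1))
    (ENNReal.Tendsto.mul h1 (Or.inr h12) h2 (Or.inr h12))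
    (Or.inr (hfin p _ (sub_ne_zero.2 hz'.1)))
  rw [← riesz_mul_self p (z.1.1 - z.2.2)]
  exact h3.liminf_eq.ge

end Limits

/-! ### The Rosenblatt kernel as a mixture with Riesz overlaps. -/

section RosenblattKernel

/-- The constant `θ` such that the overlap of the profiles at times `u`, `v` is
`θ |u - v| ^ (H - 1)`. -/
noncomputable def overlapConst (H : ℝ) : ℝ := rosenblattConst H * (H * (H + 1) / 2)

lemma overlapConst_pos {H : ℝ} (hH : 1 / 2 < H) : 0 < overlapConst H := by
  have := rosenblattConst_pos hH
  have : 0 < H := by linarith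
  rw [overlapConst]
  positivity

lemma sq_overlapConst {H : ℝ} (hH : 1 / 2 < H) : overlapConst H ^ 2 = H * (2 * H - 1) / 2 := by
  have h0 : 0 < H := by linarith
  rw [overlapConst, rosenblattConst, mul_pow, div_pow, mul_pow, Real.sq_sqrt (by linarith),
    Real.sq_sqrt h0.le]
  field_simp

/-- This is the Volterra identity at h = (H+1)/2, where 2h - 2 = H - 1 and h(2h-1) = H(H+1)/2; the
two factors √d(H) combine to d(H). -/
lemma overlap_rosenblattVolterra {H u v : ℝ} (hH : 1 / 2 < H) (hH1 : H < 1)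
    (hu : u ∈ Ioc (0 : ℝ) 1) (hv : v ∈ Ioc (0 : ℝ) 1) (huv : u ≠ v) :
    overlap (rosenblattVolterra H) u v =
      ENNReal.ofReal (overlapConst H) * riesz (H - 1) (u - v) := by
  have hd := (rosenblattConst_pos hH).le
  have e : ∀ y, rosenblattVolterra H u y * rosenblattVolterra H v y =
      ENNReal.ofReal (rosenblattConst H) * (ENNReal.ofReal (volterra ((H + 1) / 2) u y) *
        ENNReal.ofReal (volterra ((H + 1) / 2) v y)) := by
    intro y
    rw [rosenblattVolterra, rosenblattVolterra, ENNReal.ofReal_mul (Real.sqrt_nonneg _),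
      ENNReal.ofReal_mul (Real.sqrt_nonneg _), mul_mul_mul_comm,
      ← ENNReal.ofReal_mul (Real.sqrt_nonneg _), Real.mul_self_sqrt hd]
  simp_rw [overlap, e]
  rw [lintegral_const_mul' _ _ ENNReal.ofReal_ne_top, lintegral_volterra_mul (by linarith)
    (by linarith) hu hv huv, riesz_of_ne (sub_ne_zero.2 huv),
    ← ENNReal.ofReal_mul hd, ← ENNReal.ofReal_mul (overlapConst_pos hH).le, overlapConst,
    show 2 * ((H + 1) / 2) - 2 = H - 1 by ring]
  congr 1
  ring

lemma ae_restrict_mem_ne {S : Set ℝ} (hS : MeasurableSet S) (hS1 : S ⊆ Ioc 0 1) (u : ℝ) :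
    ∀ᵐ v ∂(volume.restrict S), v ∈ Ioc (0 : ℝ) 1 ∧ v ≠ u := by
  filter_upwards [ae_restrict_mem hS, Measure.ae_ne (volume.restrict S) u] with v hv hvu
    using ⟨hS1 hv, hvu⟩

variable {H : ℝ} {S S' T T' : Set ℝ}

/-- The overlap is known only for distinct times, which suffices since the diagonal is null;
squaring it doubles the exponent. -/
lemma lintegral_diagMix_rosenblatt_mul (hH : 1 / 2 < H) (hH1 : H < 1)
    (hS : MeasurableSet S) (hS1 : S ⊆ Ioc 0 1) (hT : MeasurableSet T) (hT1 : T ⊆ Ioc 0 1) :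
    ∫⁻ y, diagMix (rosenblattVolterra H) S y * diagMix (rosenblattVolterra H) T y ∂squareMeasure =
      ENNReal.ofReal (overlapConst H) ^ 2 * ∫⁻ u in S, ∫⁻ v in T, riesz (2 * (H - 1)) (u - v) := by
  rw [lintegral_diagMix_mul (measurable_rosenblattVolterra H)]
  simp_rw [← lintegral_const_mul' _ _ (ENNReal.pow_ne_top (n := 2)
    (ENNReal.ofReal_ne_top (r := overlapConst H)))]
  refine lintegral_congr_ae ?_
  filter_upwards [ae_restrict_mem hS] with u hu
  refine lintegral_congr_ae ?_
  filter_upwards [ae_restrict_mem_ne hT hT1 u] with v hv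
  rw [overlap_rosenblattVolterra hH hH1 (hS1 hu) hv.1 hv.2.symm, ← riesz_mul_self]
  ring

lemma lintegral_lcomp_diagMix_rosenblatt_mul_diagMix (hH : 1 / 2 < H) (hH1 : H < 1)
    (hS : MeasurableSet S) (hS1 : S ⊆ Ioc 0 1) (hS' : MeasurableSet S') (hS1' : S' ⊆ Ioc 0 1)
    (hT : MeasurableSet T) (hT1 : T ⊆ Ioc 0 1) :
    ∫⁻ y, lcomp (diagMix (rosenblattVolterra H) S) (diagMix (rosenblattVolterra H) S') y *
        diagMix (rosenblattVolterra H) T y ∂squareMeasure =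
      ENNReal.ofReal (overlapConst H) ^ 3 * ∫⁻ u in S, ∫⁻ v in S', ∫⁻ w in T,
        riesz (H - 1) (u - v) * (riesz (H - 1) (u - w) * riesz (H - 1) (v - w)) := by
  rw [lintegral_lcomp_mul_diagMix (measurable_rosenblattVolterra H)]
  simp_rw [← lintegral_const_mul' _ _ (ENNReal.pow_ne_top (n := 3)
    (ENNReal.ofReal_ne_top (r := overlapConst H)))]
  refine lintegral_congr_ae ?_
  filter_upwards [ae_restrict_mem hS] with u hu
  refine lintegral_congr_ae ?_
  filter_upwards [ae_restrict_mem_ne hS' hS1' u] with v hv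
  refine lintegral_congr_ae ?_
  filter_upwards [ae_restrict_mem_ne hT hT1 u, ae_restrict_mem_ne hT hT1 v] with w hw hw'
  rw [overlap_rosenblattVolterra hH hH1 (hS1 hu) hv.1 hv.2.symm,
    overlap_rosenblattVolterra hH hH1 (hS1 hu) hw.1 hw.2.symm,
    overlap_rosenblattVolterra hH hH1 hv.1 hw.1 hw'.2.symm]
  ring

lemma lintegral_lcomp_diagMix_rosenblatt_mul_lcomp (hH : 1 / 2 < H) (hH1 : H < 1)
    (hS : MeasurableSet S) (hS1 : S ⊆ Ioc 0 1) (hS' : MeasurableSet S') (hS1' : S' ⊆ Ioc 0 1)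
    (hT : MeasurableSet T) (hT1 : T ⊆ Ioc 0 1) (hT' : MeasurableSet T') (hT1' : T' ⊆ Ioc 0 1) :
    ∫⁻ y, lcomp (diagMix (rosenblattVolterra H) S) (diagMix (rosenblattVolterra H) S') y *
        lcomp (diagMix (rosenblattVolterra H) T) (diagMix (rosenblattVolterra H) T') y
        ∂squareMeasure =
      ENNReal.ofReal (overlapConst H) ^ 4 * ∫⁻ u in S, ∫⁻ v in S', ∫⁻ u' in T, ∫⁻ v' in T',
        riesz (H - 1) (u - v) * riesz (H - 1) (u' - v') *
          (riesz (H - 1) (u - u') * riesz (H - 1) (v - v')) := by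
  rw [lintegral_lcomp_mul_lcomp (measurable_rosenblattVolterra H)]
  simp_rw [← lintegral_const_mul' _ _ (ENNReal.pow_ne_top (n := 4)
    (ENNReal.ofReal_ne_top (r := overlapConst H)))]
  refine lintegral_congr_ae ?_
  filter_upwards [ae_restrict_mem hS] with u hu
  refine lintegral_congr_ae ?_
  filter_upwards [ae_restrict_mem_ne hS' hS1' u] with v hv
  refine lintegral_congr_ae ?_
  filter_upwards [ae_restrict_mem_ne hT hT1 u] with u' hu'
  refine lintegral_congr_ae ?_
  filter_upwards [ae_restrict_mem_ne hT' hT1' v, ae_restrict_mem_ne hT' hT1' u'] with v' hv' hv''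
  rw [overlap_rosenblattVolterra hH hH1 (hS1 hu) hv.1 hv.2.symm,
    overlap_rosenblattVolterra hH hH1 hu'.1 hv'.1 hv''.2.symm,
    overlap_rosenblattVolterra hH hH1 (hS1 hu) hu'.1 hu'.2.symm,
    overlap_rosenblattVolterra hH hH1 hv.1 hv'.1 hv'.2.symm]
  ring

lemma ae_squareMeasure_mem : ∀ᵐ y ∂squareMeasure, y ∈ Ioc (0 : ℝ) 1 ×ˢ Ioc (0 : ℝ) 1 := by
  have h : ∀ᵐ x ∂unitMeasure, x ∈ Ioc (0 : ℝ) 1 := by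
    rw [unitMeasure, ← restrict_Ioc_eq_restrict_Icc]
    exact ae_restrict_mem measurableSet_Ioc
  rw [squareMeasure_eq_prod]
  filter_upwards [Measure.quasiMeasurePreserving_fst.ae h, Measure.quasiMeasurePreserving_snd.ae h]
    with y h1 h2 using ⟨h1, h2⟩

/-- The mixture has finite L² norm, because the exponent 2(H-1) exceeds -1 when H > 1/2, and is
therefore finite almost everywhere. -/
lemma ae_diagMix_rosenblatt_ne_top (hH : 1 / 2 < H) (hH1 : H < 1) (hS : MeasurableSet S)
    (hS1 : S ⊆ Ioc 0 1) : ∀ᵐ y ∂squareMeasure, diagMix (rosenblattVolterra H) S y ≠ ∞ := by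
  have hm := measurable_diagMix (measurable_rosenblattVolterra H) S
  have h : ∫⁻ y, diagMix (rosenblattVolterra H) S y * diagMix (rosenblattVolterra H) S y
      ∂squareMeasure ≠ ∞ := by
    rw [lintegral_diagMix_rosenblatt_mul hH hH1 hS hS1 hS hS1]
    refine ENNReal.mul_ne_top (ENNReal.pow_ne_top ENNReal.ofReal_ne_top) (ne_top_of_le_ne_top ?_
      ((lintegral_mono fun u => lintegral_mono_set hS1).trans (lintegral_mono_set hS1)))
    rw [lintegral_lintegral_riesz (by linarith)]
    exact ENNReal.ofReal_ne_top
  filter_upwards [ae_lt_top (hm.mul hm) h] with y hy htop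
  simp [htop] at hy

/-- The mixture is additive over adjacent time intervals; a.e. finiteness allows the subtraction to
be carried out on real values. -/
lemma isRealVersion_rosenblattKernel_sub (hH : 1 / 2 < H) (hH1 : H < 1) {s t : ℝ} (hs : 0 ≤ s)
    (hst : s ≤ t) (ht : t ≤ 1) :
    IsRealVersion (fun y => rosenblattKernel H t y - rosenblattKernel H s y)
      (diagMix (rosenblattVolterra H) (Ioc s t)) := by
  filter_upwards [ae_squareMeasure_mem, ae_diagMix_rosenblatt_ne_top hH hH1 measurableSet_Ioc
    (Ioc_subset_Ioc le_rfl (hst.trans ht) : Ioc 0 s ⊆ Ioc 0 1), ae_diagMix_rosenblatt_ne_top hH hH1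
    measurableSet_Ioc (Ioc_subset_Ioc hs ht : Ioc s t ⊆ Ioc 0 1)] with y hy h1 h2
  have hadd : diagMix (rosenblattVolterra H) (Ioc 0 t) y =
      diagMix (rosenblattVolterra H) (Ioc 0 s) y + diagMix (rosenblattVolterra H) (Ioc s t) y := by
    rw [diagMix, ← Ioc_union_Ioc_eq_Ioc hs hst, lintegral_union measurableSet_Ioc
      (Ioc_disjoint_Ioc_of_le le_rfl)]
    rfl
  have e : rosenblattKernel H t y - rosenblattKernel H s y =
      (diagMix (rosenblattVolterra H) (Ioc s t) y).toReal := by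
    rw [rosenblattKernel_eq hH hy, rosenblattKernel_eq hH hy]
    change (diagMix _ _ y).toReal - (diagMix _ _ y).toReal = _
    rw [hadd, ENNReal.toReal_add h1 h2, add_sub_cancel_left]
  rw [e]
  exact ⟨ENNReal.toReal_nonneg, ENNReal.ofReal_toReal h2⟩

lemma isRealVersion_rosenblattKernel (hH : 1 / 2 < H) (hH1 : H < 1) {t : ℝ} (ht : t ≤ 1) :
    IsRealVersion (rosenblattKernel H t) (diagMix (rosenblattVolterra H) (Ioc 0 t)) := by
  filter_upwards [ae_squareMeasure_mem, ae_diagMix_rosenblatt_ne_top hH hH1 measurableSet_Ioc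
    (Ioc_subset_Ioc le_rfl ht : Ioc 0 t ⊆ Ioc 0 1)] with y hy h1
  rw [rosenblattKernel_eq hH hy]
  exact ⟨ENNReal.toReal_nonneg, ENNReal.ofReal_toReal h1⟩

end RosenblattKernel

/-! ### Moments of the squared increments in terms of cycle energies. -/

section Variation

/-- A nonnegative sequence tends to zero as soon as an upper bound does. Only the limsup of the term
with positive sign and the liminf of the subtracted one matter, and the constants are assumed to
balance. -/
lemma tendsto_zero_of_limsup_of_liminf {E : ℕ → ℝ} {a b c : ℕ → ℝ≥0∞} {K₀ K₁ K₂ K₃ β γ : ℝ}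
    (hK₂ : 0 ≤ K₂) (hK₃ : 0 ≤ K₃) (hβ : 0 ≤ β) (hE0 : ∀ N, 0 ≤ E N)
    (hE : ∀ᶠ N in atTop, E N ≤ K₁ * (a N).toReal + K₂ * (b N).toReal - K₃ * (c N).toReal + K₀)
    (ha : Tendsto a atTop (𝓝 0)) (hb : limsup b atTop ≤ ENNReal.ofReal β)
    (hc : ENNReal.ofReal γ ≤ liminf c atTop) (hct : ∀ᶠ N in atTop, c N ≠ ∞)
    (hK : K₂ * β - K₃ * γ + K₀ = 0) : Tendsto E atTop (𝓝 0) := by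
  rw [Metric.tendsto_atTop']
  intro ε hε
  have ha' : Tendsto (fun N => K₁ * (a N).toReal) atTop (𝓝 0) := by
    have := ((ENNReal.tendsto_toReal ENNReal.zero_ne_top).comp ha).const_mul K₁
    simpa using this
  -- The errors in b and c together cost at most ε/2 and the vanishing term costs the other half;
  -- the extra 1 keeps the denominator positive.
  set δ := ε / (2 * (K₂ + K₃ + 1)) with hδ
  have hS : 0 < K₂ + K₃ + 1 := by positivity
  have hδ0 : 0 < δ := by positivity
  have hδe : (K₂ + K₃ + 1) * δ = ε / 2 := by rw [hδ]; field_simp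
  have e1 : ∀ᶠ N in atTop, K₁ * (a N).toReal < ε / 2 := ha'.eventually_lt_const (by positivity)
  have e2 : ∀ᶠ N in atTop, (b N).toReal ≤ β + δ := by
    have h : limsup b atTop < ENNReal.ofReal (β + δ) :=
      hb.trans_lt ((ENNReal.ofReal_lt_ofReal_iff (by positivity)).2 (by linarith))
    filter_upwards [eventually_lt_of_limsup_lt h] with N hN
    exact ENNReal.toReal_le_of_le_ofReal (by positivity) hN.le
  have e3 : ∀ᶠ N in atTop, γ - δ ≤ (c N).toReal := by
    rcases le_or_gt (γ - δ) 0 with h0 | h0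
    · exact Eventually.of_forall fun N => h0.trans ENNReal.toReal_nonneg
    · have h : ENNReal.ofReal (γ - δ) < liminf c atTop :=
        ((ENNReal.ofReal_lt_ofReal_iff (by linarith)).2 (by linarith)).trans_le hc
      filter_upwards [eventually_lt_of_lt_liminf h, hct] with N hN hNt
      exact (ENNReal.ofReal_le_iff_le_toReal hNt).1 hN.le
  obtain ⟨M, hM⟩ := eventually_atTop.1 (hE.and (e1.and (e2.and e3)))
  refine ⟨M, fun N hN => ?_⟩
  obtain ⟨h0, h1, h2, h3⟩ := hM N hN.le
  rw [Real.dist_eq, sub_zero, abs_of_nonneg (hE0 N)]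
  have h4 := mul_le_mul_of_nonneg_left h2 hK₂
  have h5 := mul_le_mul_of_nonneg_left h3 hK₃
  nlinarith

variable {Ω : Type*} [MeasurableSpace Ω] {P : Measure Ω}

lemma memLp_two_sq {X : Ω → ℝ} (h : MemLp X 4 P) : MemLp (fun ω => X ω ^ 2) 2 P := by
  have : ENNReal.HolderTriple 4 4 2 := ⟨by
    rw [← two_mul, show (4 : ℝ≥0∞) = 2 * 2 by norm_num,
      ENNReal.mul_inv (by simp) (by simp), ← mul_assoc, ENNReal.mul_inv_cancel (by simp) (by simp),
      one_mul]⟩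
  have h2 : MemLp (fun ω => X ω * X ω) 2 P := h.mul h
  simpa only [sq] using h2

lemma integral_sq_sum_sub {ι : Type*} (s : Finset ι) {U : ι → Ω → ℝ} {Y : Ω → ℝ}
    (hU : ∀ i ∈ s, MemLp (U i) 2 P) (hY : MemLp Y 2 P) (c : ℝ) :
    ∫ ω, (c * ∑ i ∈ s, U i ω - Y ω) * (c * ∑ i ∈ s, U i ω - Y ω) ∂P =
      c ^ 2 * ∑ i ∈ s, ∑ j ∈ s, ∫ ω, U i ω * U j ω ∂P - 2 * c * ∑ i ∈ s, ∫ ω, U i ω * Y ω ∂P +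
        ∫ ω, Y ω * Y ω ∂P := by
  have iUU : ∀ i ∈ s, ∀ j ∈ s, Integrable (fun ω => U i ω * U j ω) P := fun i hi j hj =>
    (hU i hi).integrable_mul (hU j hj)
  have iUY : ∀ i ∈ s, Integrable (fun ω => U i ω * Y ω) P := fun i hi =>
    (hU i hi).integrable_mul hY
  have iYY : Integrable (fun ω => Y ω * Y ω) P := hY.integrable_mul hY
  have iA : Integrable (fun ω => c ^ 2 * ∑ i ∈ s, ∑ j ∈ s, U i ω * U j ω) P :=
    (integrable_finsetSum _ fun i hi => integrable_finsetSum _ fun j hj =>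
      iUU i hi j hj).const_mul _
  have iB : Integrable (fun ω => 2 * c * ∑ i ∈ s, U i ω * Y ω) P :=
    (integrable_finsetSum _ fun i hi => iUY i hi).const_mul _
  have e : ∀ ω, (c * ∑ i ∈ s, U i ω - Y ω) * (c * ∑ i ∈ s, U i ω - Y ω) =
      c ^ 2 * ∑ i ∈ s, ∑ j ∈ s, U i ω * U j ω - 2 * c * ∑ i ∈ s, U i ω * Y ω + Y ω * Y ω := by
    intro ω
    rw [← Finset.sum_mul_sum, ← Finset.sum_mul]
    ring
  simp_rw [e]
  have iAB : Integrable (fun ω => c ^ 2 * ∑ i ∈ s, ∑ j ∈ s, U i ω * U j ω -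
      2 * c * ∑ i ∈ s, U i ω * Y ω) P := iA.sub iB
  rw [integral_add iAB iYY, integral_sub iA iB, integral_const_mul, integral_const_mul,
    integral_finsetSum _ iUY, integral_finsetSum _ fun i hi => integrable_finsetSum _ fun j hj =>
      iUU i hi j hj]
  congr 3
  exact Finset.sum_congr rfl fun i hi => integral_finsetSum _ fun j hj => iUU i hi j hj

/-- Finiteness of the energies needs no separate estimate: each is, up to a positive factor, the
image of a real number. -/
lemma eq_pow_mul_toReal {x θ : ℝ} {k : ℕ} {e : ℝ≥0∞} (hθ : 0 < θ) (hx : 0 ≤ x)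
    (h : ENNReal.ofReal x = ENNReal.ofReal θ ^ k * e) : x = θ ^ k * e.toReal ∧ e ≠ ∞ := by
  constructor
  · rw [← ENNReal.toReal_ofReal hx, h, ENNReal.toReal_mul, ENNReal.toReal_pow,
      ENNReal.toReal_ofReal hθ.le]
  · rintro rfl
    rw [ENNReal.mul_top (pow_ne_zero _ (ENNReal.ofReal_pos.2 hθ).ne')] at h
    exact ENNReal.ofReal_ne_top h

variable {H : ℝ} {W Z : I → Ω → ℝ}

lemma isSymmDoubleWiener_of_isRosenblattProcess (hZ : IsRosenblattProcess H W P Z) (t : I) :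
    IsSymmDoubleWiener W P (rosenblattKernel H t) (Z t) :=
  (hZ t).isSymmDoubleWiener (rosenblattKernel_swap H t)

/-- The energy of the interaction of the cells `i` and `j`. -/
noncomputable def cellEnergy (p : ℝ) (N i j : ℕ) : ℝ≥0∞ :=
  ∫⁻ u in cell N i, ∫⁻ v in cell N j, riesz (2 * p) (u - v)

/-- The energy of the cycles with two links inside the cells `i`, `j` and two links across. -/
noncomputable def cycleEnergy (p : ℝ) (N i j : ℕ) : ℝ≥0∞ :=
  ∫⁻ u in cell N i, ∫⁻ v in cell N i, ∫⁻ u' in cell N j, ∫⁻ v' in cell N j,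
    riesz p (u - v) * riesz p (u' - v') * (riesz p (u - u') * riesz p (v - v'))

/-- The energy of the triangles with two vertices in the cell `i`. -/
noncomputable def triangleEnergy (p : ℝ) (N i : ℕ) : ℝ≥0∞ :=
  ∫⁻ u in cell N i, ∫⁻ v in cell N i, ∫⁻ w in Ioc 0 1,
    riesz p (u - v) * (riesz p (u - w) * riesz p (v - w))

/-- The kernel of the `i`-th increment of the Rosenblatt process. -/
noncomputable def incrKernel (H : ℝ) (N i : ℕ) (y : ℝ × ℝ) : ℝ :=
  rosenblattKernel H (((i : ℝ) + 1) / N) y - rosenblattKernel H ((i : ℝ) / N) y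

lemma isSymmDoubleWiener_incr [IsProbabilityMeasure P] (hW : IsBrownianUnit W P)
    (hZ : IsRosenblattProcess H W P Z) {N : ℕ} (i : Fin N) :
    IsSymmDoubleWiener W P (incrKernel H N i)
      (fun ω => Z (gridPoint N i.succ) ω - Z (gridPoint N i.castSucc) ω) := by
  have h := (isSymmDoubleWiener_of_isRosenblattProcess hZ (gridPoint N i.succ)).sub hW
    (isSymmDoubleWiener_of_isRosenblattProcess hZ (gridPoint N i.castSucc))
  have e1 : ((gridPoint N i.succ : I) : ℝ) = ((i : ℝ) + 1) / N := by simp [gridPoint]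
  have e2 : ((gridPoint N i.castSucc : I) : ℝ) = (i : ℝ) / N := by simp [gridPoint]
  rw [e1, e2] at h
  exact h

lemma isRealVersion_incrKernel (hH : 1 / 2 < H) (hH1 : H < 1) {N i : ℕ} (hi : i < N) :
    IsRealVersion (incrKernel H N i) (diagMix (rosenblattVolterra H) (cell N i)) := by
  have hN : (0 : ℝ) < N := by exact_mod_cast (Nat.zero_le i).trans_lt hi
  refine isRealVersion_rosenblattKernel_sub hH hH1 (by positivity) (by gcongr; simp)
    ((div_le_one hN).2 ?_)
  exact_mod_cast hi

/-- This is 2θ²J = 1, the normalization of the variance of `Z 1`; it also fixes the variance of the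
increments and the final balance of constants. -/
lemma energyConst_eq (hH : 1 / 2 < H) :
    2 * overlapConst H ^ 2 * (2 / ((2 * (H - 1) + 1) * (2 * (H - 1) + 2))) = 1 := by
  have h1 : 2 * H - 1 ≠ 0 := by linarith
  have h2 : H ≠ 0 := by linarith
  rw [sq_overlapConst hH, show 2 * (H - 1) + 1 = 2 * H - 1 by ring,
    show 2 * (H - 1) + 2 = 2 * H by ring]
  field_simp

lemma energyConst_nonneg (hH : 1 / 2 < H) :
    0 ≤ 2 / ((2 * (H - 1) + 1) * (2 * (H - 1) + 2)) := by
  have h1 : 0 < 2 * (H - 1) + 1 := by linarith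
  have h2 : 0 < 2 * (H - 1) + 2 := by linarith
  positivity

variable [IsProbabilityMeasure P]

lemma memLp_four_incr (hW : IsBrownianUnit W P) (hZ : IsRosenblattProcess H W P Z) {N : ℕ}
    (i : Fin N) :
    MemLp (fun ω => Z (gridPoint N i.succ) ω - Z (gridPoint N i.castSucc) ω) 4 P :=
  ((isSymmDoubleWiener_incr hW hZ i).moments hW (isSymmDoubleWiener_incr hW hZ i)).1

lemma memLp_quadVariation (hW : IsBrownianUnit W P) (hZ : IsRosenblattProcess H W P Z) (N : ℕ) :
    MemLp (quadVariation P Z N) 2 P := by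
  have h : ∀ i : Fin N, MemLp (fun ω =>
      (Z (gridPoint N i.succ) ω - Z (gridPoint N i.castSucc) ω) ^ 2 /
        (∫ ω', (Z (gridPoint N i.succ) ω' - Z (gridPoint N i.castSucc) ω') ^ 2 ∂P) - 1) 2 P := by
    intro i
    simp_rw [div_eq_mul_inv]
    exact ((memLp_two_sq (memLp_four_incr hW hZ i)).mul_const _).sub (memLp_const 1)
  exact (memLp_finsetSum Finset.univ fun i _ => h i).const_mul (1 / (N : ℝ))

lemma integral_incrKernel_mul (hH : 1 / 2 < H) (hH1 : H < 1) (hW : IsBrownianUnit W P)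
    (hZ : IsRosenblattProcess H W P Z) {N : ℕ} (i j : Fin N) :
    ∫ y, incrKernel H N i y * incrKernel H N j y ∂squareMeasure =
        overlapConst H ^ 2 * (cellEnergy (H - 1) N i j).toReal ∧ cellEnergy (H - 1) N i j ≠ ∞ := by
  have h := (isRealVersion_incrKernel hH hH1 i.2).ofReal_integral_mul
    (isRealVersion_incrKernel hH hH1 j.2) (isSymmDoubleWiener_incr hW hZ i).1
    (isSymmDoubleWiener_incr hW hZ j).1
  rw [lintegral_diagMix_rosenblatt_mul hH hH1 (measurableSet_cell N i) (cell_subset i.2)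
    (measurableSet_cell N j) (cell_subset j.2)] at h
  exact eq_pow_mul_toReal (overlapConst_pos hH) h.1 h.2

lemma integral_comp_incrKernel_mul (hH : 1 / 2 < H) (hH1 : H < 1) (hW : IsBrownianUnit W P)
    (hZ : IsRosenblattProcess H W P Z) {N : ℕ} (i j : Fin N) :
    ∫ y, comp (incrKernel H N i) (incrKernel H N i) y *
      comp (incrKernel H N j) (incrKernel H N j) y ∂squareMeasure =
        overlapConst H ^ 4 * (cycleEnergy (H - 1) N i j).toReal ∧
      cycleEnergy (H - 1) N i j ≠ ∞ := by
  have ri := isRealVersion_incrKernel hH hH1 i.2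
  have rj := isRealVersion_incrKernel hH hH1 j.2
  have mi := (isSymmDoubleWiener_incr hW hZ i).1
  have mj := (isSymmDoubleWiener_incr hW hZ j).1
  have h := (ri.comp ri mi mi).ofReal_integral_mul (rj.comp rj mj mj) (memLp_comp mi mi)
    (memLp_comp mj mj)
  rw [lintegral_lcomp_diagMix_rosenblatt_mul_lcomp hH hH1 (measurableSet_cell N i)
    (cell_subset i.2) (measurableSet_cell N i) (cell_subset i.2) (measurableSet_cell N j)
    (cell_subset j.2) (measurableSet_cell N j) (cell_subset j.2)] at h
  exact eq_pow_mul_toReal (overlapConst_pos hH) h.1 h.2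

/-- In this contraction every link joins different cells, so it is of the order of the squared cell
energy and needs only an upper bound. -/
lemma integral_comp_incrKernel_mul_swap_le (hH : 1 / 2 < H) (hH1 : H < 1)
    (hW : IsBrownianUnit W P) (hZ : IsRosenblattProcess H W P Z) {N : ℕ} (i j : Fin N) :
    ∫ y, comp (incrKernel H N i) (incrKernel H N j) y *
      comp (incrKernel H N j) (incrKernel H N i) y ∂squareMeasure ≤
        overlapConst H ^ 4 * (cellEnergy (H - 1) N i j).toReal ^ 2 := by
  have ri := isRealVersion_incrKernel hH hH1 i.2
  have rj := isRealVersion_incrKernel hH hH1 j.2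
  have mi := (isSymmDoubleWiener_incr hW hZ i).1
  have mj := (isSymmDoubleWiener_incr hW hZ j).1
  have h := (ri.comp rj mi mj).ofReal_integral_mul (rj.comp ri mj mi) (memLp_comp mi mj)
    (memLp_comp mj mi)
  rw [lintegral_lcomp_diagMix_rosenblatt_mul_lcomp hH hH1 (measurableSet_cell N i)
    (cell_subset i.2) (measurableSet_cell N j) (cell_subset j.2) (measurableSet_cell N j)
    (cell_subset j.2) (measurableSet_cell N i) (cell_subset i.2)] at h
  rw [(eq_pow_mul_toReal (overlapConst_pos hH) h.1 h.2).1]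
  have ht := (integral_incrKernel_mul hH hH1 hW hZ i j).2
  have := overlapConst_pos hH
  rw [sq, ← ENNReal.toReal_mul]
  gcongr
  · exact ENNReal.mul_ne_top ht ht
  · exact lintegral_crossing_cycle_le (H - 1)

lemma integral_comp_incrKernel_mul_kernel (hH : 1 / 2 < H) (hH1 : H < 1)
    (hW : IsBrownianUnit W P) (hZ : IsRosenblattProcess H W P Z) {N : ℕ} (i : Fin N) :
    ∫ y, comp (incrKernel H N i) (incrKernel H N i) y * rosenblattKernel H 1 y ∂squareMeasure =
        overlapConst H ^ 3 * (triangleEnergy (H - 1) N i).toReal ∧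
      triangleEnergy (H - 1) N i ≠ ∞ := by
  have ri := isRealVersion_incrKernel hH hH1 i.2
  have mi := (isSymmDoubleWiener_incr hW hZ i).1
  have h := (ri.comp ri mi mi).ofReal_integral_mul (isRealVersion_rosenblattKernel hH hH1 le_rfl)
    (memLp_comp mi mi) (hZ 1).1
  rw [lintegral_lcomp_diagMix_rosenblatt_mul_diagMix hH hH1 (measurableSet_cell N i)
    (cell_subset i.2) (measurableSet_cell N i) (cell_subset i.2) measurableSet_Ioc
    subset_rfl] at h
  exact eq_pow_mul_toReal (overlapConst_pos hH) h.1 h.2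

lemma integral_rosenblatt_one_sq (hH : 1 / 2 < H) (hH1 : H < 1) (hW : IsBrownianUnit W P)
    (hZ : IsRosenblattProcess H W P Z) : ∫ ω, Z 1 ω * Z 1 ω ∂P = 1 := by
  have hs := isSymmDoubleWiener_of_isRosenblattProcess hZ 1
  have r1 := isRealVersion_rosenblattKernel hH hH1 (t := 1) le_rfl
  have h := r1.ofReal_integral_mul r1 (hZ 1).1 (hZ 1).1
  rw [lintegral_diagMix_rosenblatt_mul hH hH1 measurableSet_Ioc subset_rfl measurableSet_Ioc
    subset_rfl, lintegral_lintegral_riesz (by linarith)] at h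
  have h' := (eq_pow_mul_toReal (overlapConst_pos hH) h.1 h.2).1
  have hpos := energyConst_nonneg hH
  rw [(hs.moments hW hs).2.2.1]
  rw [ENNReal.toReal_ofReal hpos] at h'
  rw [← energyConst_eq hH, mul_assoc]
  exact congrArg _ h'

/-- Self-similarity and stationarity at second order: a cell energy with itself scales as
N^(-2(H-1)-2) and does not depend on the cell. -/
lemma integral_incr_sq (hH : 1 / 2 < H) (hH1 : H < 1) (hW : IsBrownianUnit W P)
    (hZ : IsRosenblattProcess H W P Z) {N : ℕ} (i : Fin N) :
    ∫ ω, (Z (gridPoint N i.succ) ω - Z (gridPoint N i.castSucc) ω) ^ 2 ∂P =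
      (N : ℝ) ^ (-(2 * H)) := by
  have hN : N ≠ 0 := by have := i.2; omega
  have hs := isSymmDoubleWiener_incr hW hZ i
  have hpos := energyConst_nonneg hH
  simp_rw [sq]
  rw [(hs.moments hW hs).2.2.1, (integral_incrKernel_mul hH hH1 hW hZ i i).1, cellEnergy,
    lintegral_cell_self_riesz hN (by linarith), ENNReal.toReal_mul, ENNReal.toReal_ofReal hpos,
    ENNReal.toReal_ofReal (by positivity)]
  have := energyConst_eq hH
  rw [show -(2 * (H - 1)) - 2 = -(2 * H) by ring]
  linear_combination ((N : ℝ) ^ (-(2 * H))) * this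

/-- Centring removes the product of the two variances from the fourth moment. The coefficient 24 is
8 from the squared covariance plus 16 from the crossing contraction; 32 belongs to the inner
contraction. -/
lemma integral_incr_sq_sub_mul_le (hH : 1 / 2 < H) (hH1 : H < 1) (hW : IsBrownianUnit W P)
    (hZ : IsRosenblattProcess H W P Z) {N : ℕ} (i j : Fin N) :
    ∫ ω, ((Z (gridPoint N i.succ) ω - Z (gridPoint N i.castSucc) ω) ^ 2 - (N : ℝ) ^ (-(2 * H))) *
        ((Z (gridPoint N j.succ) ω - Z (gridPoint N j.castSucc) ω) ^ 2 - (N : ℝ) ^ (-(2 * H))) ∂P ≤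
      overlapConst H ^ 4 * (24 * (cellEnergy (H - 1) N i j).toReal ^ 2 +
        32 * (cycleEnergy (H - 1) N i j).toReal) := by
  have hi := isSymmDoubleWiener_incr hW hZ i
  have hj := isSymmDoubleWiener_incr hW hZ j
  have vi := integral_incr_sq hH hH1 hW hZ i
  have vj := integral_incr_sq hH hH1 hW hZ j
  have si := memLp_two_sq (memLp_four_incr hW hZ i)
  have sj := memLp_two_sq (memLp_four_incr hW hZ j)
  obtain ⟨-, -, ei, -, -⟩ := hi.moments hW hi
  obtain ⟨-, -, ej, -, -⟩ := hj.moments hW hj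
  obtain ⟨-, -, -, -, eij⟩ := hi.moments hW hj
  set X := fun ω => Z (gridPoint N i.succ) ω - Z (gridPoint N i.castSucc) ω
  set Y := fun ω => Z (gridPoint N j.succ) ω - Z (gridPoint N j.castSucc) ω
  set v := (N : ℝ) ^ (-(2 * H))
  have iXY : Integrable (fun ω => X ω ^ 2 * Y ω ^ 2) P := si.integrable_mul sj
  have iX : Integrable (fun ω => X ω ^ 2) P := si.integrable one_le_two
  have iY : Integrable (fun ω => Y ω ^ 2) P := sj.integrable one_le_two
  have hexp : ∫ ω, (X ω ^ 2 - v) * (Y ω ^ 2 - v) ∂P = ∫ ω, X ω ^ 2 * Y ω ^ 2 ∂P - v ^ 2 := by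
    have e : ∀ ω, (X ω ^ 2 - v) * (Y ω ^ 2 - v) =
        X ω ^ 2 * Y ω ^ 2 - (v * X ω ^ 2 + v * Y ω ^ 2 - v ^ 2) := fun ω => by ring
    have i1 : Integrable (fun ω => v * X ω ^ 2 + v * Y ω ^ 2) P :=
      (iX.const_mul v).add (iY.const_mul v)
    have i2 : Integrable (fun ω => v * X ω ^ 2 + v * Y ω ^ 2 - v ^ 2) P :=
      i1.sub (integrable_const _)
    simp_rw [e]
    rw [integral_sub iXY i2, integral_sub i1 (integrable_const _),
      integral_add (iX.const_mul v) (iY.const_mul v), integral_const_mul, integral_const_mul,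
      vi, vj]
    simp
    ring
  simp_rw [← sq] at ei ej
  rw [vi] at ei
  rw [vj] at ej
  change ∫ ω, (X ω ^ 2 - v) * (Y ω ^ 2 - v) ∂P ≤ _
  rw [hexp, eij, (integral_incrKernel_mul hH hH1 hW hZ i j).1,
    (integral_comp_incrKernel_mul hH hH1 hW hZ i j).1]
  simp_rw [← sq]
  have hD := integral_comp_incrKernel_mul_swap_le hH hH1 hW hZ i j
  -- One factor v is replaced by twice the squared norm of each kernel, so that the disconnected
  -- term cancels.
  rw [sq v]
  nth_rw 1 [ei]
  nth_rw 1 [ej]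
  linarith

/-- The centring constant is irrelevant because `Z 1` has mean zero; what remains is a third moment.
-/
lemma integral_incr_sq_sub_mul_rosenblatt (hH : 1 / 2 < H) (hH1 : H < 1)
    (hW : IsBrownianUnit W P) (hZ : IsRosenblattProcess H W P Z) {N : ℕ} (i : Fin N) (v : ℝ) :
    ∫ ω, ((Z (gridPoint N i.succ) ω - Z (gridPoint N i.castSucc) ω) ^ 2 - v) * Z 1 ω ∂P =
      8 * (overlapConst H ^ 3 * (triangleEnergy (H - 1) N i).toReal) := by
  have hi := isSymmDoubleWiener_incr hW hZ i
  have hs := isSymmDoubleWiener_of_isRosenblattProcess hZ 1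
  have si := memLp_two_sq (memLp_four_incr hW hZ i)
  have i1 : Integrable (fun ω =>
      (Z (gridPoint N i.succ) ω - Z (gridPoint N i.castSucc) ω) ^ 2 * Z 1 ω) P :=
    si.integrable_mul (hZ 1).2.1
  have i2 := (hZ 1).2.1.integrable one_le_two
  simp_rw [sub_mul]
  rw [integral_sub i1 (i2.const_mul v), integral_const_mul, (hs.moments hW hs).2.1, mul_zero,
    sub_zero, (hi.moments hW hs).2.2.2.1]
  congr 1
  exact (integral_comp_incrKernel_mul_kernel hH hH1 hW hZ i).1

end Variation

/-! ### Expansion of the L² distance and balance of constants. -/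

section Main

variable {Ω : Type*} [MeasurableSpace Ω] {P : Measure Ω} {H : ℝ} {W Z : I → Ω → ℝ}

/-- The normalizing variances all equal N^(-2H), so the prefactor becomes N^(1-H) · N^(-1) · N^(2H)
= N^H. -/
lemma renormalized_quadVariation_eq [IsProbabilityMeasure P] (hH : 1 / 2 < H) (hH1 : H < 1)
    (hW : IsBrownianUnit W P) (hZ : IsRosenblattProcess H W P Z) {N : ℕ} (hN : N ≠ 0) (ω : Ω) :
    (N : ℝ) ^ (1 - H) * quadVariation P Z N ω / (4 * rosenblattConst H) =
      (N : ℝ) ^ H / (4 * rosenblattConst H) * ∑ i : Fin N,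
        ((Z (gridPoint N i.succ) ω - Z (gridPoint N i.castSucc) ω) ^ 2 -
          (N : ℝ) ^ (-(2 * H))) := by
  have hN' : (0 : ℝ) < N := by positivity
  have hd := (rosenblattConst_pos hH).ne'
  have hp : (N : ℝ) ^ (-(2 * H)) ≠ 0 := (Real.rpow_pos_of_pos hN' _).ne'
  have e1 : (N : ℝ) ^ (1 - H) * (1 / N) = (N : ℝ) ^ H * (N : ℝ) ^ (-(2 * H)) := by
    rw [one_div, ← Real.rpow_neg_one, ← Real.rpow_add hN', ← Real.rpow_add hN']
    ring_nf
  have e2 : ∀ x : ℝ, x / (N : ℝ) ^ (-(2 * H)) - 1 =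
      (x - (N : ℝ) ^ (-(2 * H))) / (N : ℝ) ^ (-(2 * H)) := fun x => by
    field_simp
  simp only [quadVariation, integral_incr_sq hH hH1 hW hZ, e2]
  rw [← Finset.sum_div, ← mul_assoc, e1]
  field_simp

/-- Expanding the square with prefactor N^H/(4d) yields the coefficients 24/16 = 3/2, 32/16 = 2 and
2·8/4 = 4. The exponents are written in terms of H - 1 so as to match the limit lemmas at p = H - 1
and q = 2p. -/
lemma integral_sq_renormalized_le [IsProbabilityMeasure P] (hH : 1 / 2 < H) (hH1 : H < 1)
    (hW : IsBrownianUnit W P) (hZ : IsRosenblattProcess H W P Z) {N : ℕ} (hN : N ≠ 0) :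
    ∫ ω, ((N : ℝ) ^ (1 - H) * quadVariation P Z N ω / (4 * rosenblattConst H) - Z 1 ω) *
      ((N : ℝ) ^ (1 - H) * quadVariation P Z N ω / (4 * rosenblattConst H) - Z 1 ω) ∂P ≤
    3 / 2 * overlapConst H ^ 4 / rosenblattConst H ^ 2 *
      (ENNReal.ofReal ((N : ℝ) ^ (2 * (H - 1) + 2)) * ∑ i ∈ Finset.range N, ∑ j ∈ Finset.range N,
        cellEnergy (H - 1) N i j * cellEnergy (H - 1) N i j).toReal +
    2 * overlapConst H ^ 4 / rosenblattConst H ^ 2 *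
      (ENNReal.ofReal ((N : ℝ) ^ (2 * (H - 1) + 2)) * ∑ i ∈ Finset.range N, ∑ j ∈ Finset.range N,
        cycleEnergy (H - 1) N i j).toReal -
    4 * overlapConst H ^ 3 / rosenblattConst H *
      (ENNReal.ofReal ((N : ℝ) ^ (H - 1 + 1)) * ∑ i ∈ Finset.range N,
        triangleEnergy (H - 1) N i).toReal + 1 := by
  have hN' : (0 : ℝ) < N := by positivity
  have hd := rosenblattConst_pos hH
  set d := rosenblattConst H with hdd
  set θ := overlapConst H with hθ
  set U : Fin N → Ω → ℝ := fun i ω =>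
    (Z (gridPoint N i.succ) ω - Z (gridPoint N i.castSucc) ω) ^ 2 - (N : ℝ) ^ (-(2 * H)) with hU
  have mU : ∀ i ∈ Finset.univ, MemLp (U i) 2 P := fun i _ =>
    (memLp_two_sq (memLp_four_incr hW hZ i)).sub (memLp_const _)
  have hlhs := integral_sq_sum_sub Finset.univ mU (hZ 1).2.1 ((N : ℝ) ^ H / (4 * d))
  have e0 : ∀ ω, (N : ℝ) ^ (1 - H) * quadVariation P Z N ω / (4 * d) =
      (N : ℝ) ^ H / (4 * d) * ∑ i, U i ω := renormalized_quadVariation_eq hH hH1 hW hZ hN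
  simp_rw [e0]
  rw [hlhs, integral_rosenblatt_one_sq hH hH1 hW hZ]
  have hUU : ∀ i j : Fin N, ∫ ω, U i ω * U j ω ∂P ≤
      θ ^ 4 * (24 * (cellEnergy (H - 1) N i j).toReal ^ 2 +
        32 * (cycleEnergy (H - 1) N i j).toReal) := integral_incr_sq_sub_mul_le hH hH1 hW hZ
  have hUZ : ∀ i : Fin N, ∫ ω, U i ω * Z 1 ω ∂P =
      8 * (θ ^ 3 * (triangleEnergy (H - 1) N i).toReal) := fun i =>
    integral_incr_sq_sub_mul_rosenblatt hH hH1 hW hZ i _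
  have hEt : ∀ i j : Fin N, cellEnergy (H - 1) N i j ≠ ∞ := fun i j =>
    (integral_incrKernel_mul hH hH1 hW hZ i j).2
  have hBt : ∀ i j : Fin N, cycleEnergy (H - 1) N i j ≠ ∞ := fun i j =>
    (integral_comp_incrKernel_mul hH hH1 hW hZ i j).2
  have hCt : ∀ i : Fin N, triangleEnergy (H - 1) N i ≠ ∞ := fun i =>
    (integral_comp_incrKernel_mul_kernel hH hH1 hW hZ i).2
  have eA : (ENNReal.ofReal ((N : ℝ) ^ (2 * (H - 1) + 2)) * ∑ i ∈ Finset.range N,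
      ∑ j ∈ Finset.range N, cellEnergy (H - 1) N i j * cellEnergy (H - 1) N i j).toReal =
      (N : ℝ) ^ (2 * H) * ∑ i : Fin N, ∑ j : Fin N, (cellEnergy (H - 1) N i j).toReal ^ 2 := by
    simp only [Finset.sum_range]
    rw [ENNReal.toReal_mul, ENNReal.toReal_ofReal (by positivity),
      ENNReal.toReal_sum fun i _ => ENNReal.sum_ne_top.2 fun j _ =>
        ENNReal.mul_ne_top (hEt i j) (hEt i j)]
    congr 1
    · ring_nf
    refine Finset.sum_congr rfl fun i _ => ?_
    rw [ENNReal.toReal_sum fun j _ => ENNReal.mul_ne_top (hEt i j) (hEt i j)]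
    exact Finset.sum_congr rfl fun j _ => by rw [ENNReal.toReal_mul, sq]
  have eB : (ENNReal.ofReal ((N : ℝ) ^ (2 * (H - 1) + 2)) * ∑ i ∈ Finset.range N,
      ∑ j ∈ Finset.range N, cycleEnergy (H - 1) N i j).toReal =
      (N : ℝ) ^ (2 * H) * ∑ i : Fin N, ∑ j : Fin N, (cycleEnergy (H - 1) N i j).toReal := by
    simp only [Finset.sum_range]
    rw [ENNReal.toReal_mul, ENNReal.toReal_ofReal (by positivity),
      ENNReal.toReal_sum fun i _ => ENNReal.sum_ne_top.2 fun j _ => hBt i j]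
    congr 1
    · ring_nf
    exact Finset.sum_congr rfl fun i _ => ENNReal.toReal_sum fun j _ => hBt i j
  have eC : (ENNReal.ofReal ((N : ℝ) ^ (H - 1 + 1)) * ∑ i ∈ Finset.range N,
      triangleEnergy (H - 1) N i).toReal =
      (N : ℝ) ^ H * ∑ i : Fin N, (triangleEnergy (H - 1) N i).toReal := by
    simp only [Finset.sum_range]
    rw [ENNReal.toReal_mul, ENNReal.toReal_ofReal (by positivity), sub_add_cancel,
      ENNReal.toReal_sum fun i _ => hCt i]
  rw [eA, eB, eC]
  have hpow : (N : ℝ) ^ (2 * H) = (N : ℝ) ^ H * (N : ℝ) ^ H := by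
    rw [← Real.rpow_add hN', two_mul]
  have h1 : ∑ i, ∑ j, ∫ ω, U i ω * U j ω ∂P ≤
      θ ^ 4 * (24 * ∑ i : Fin N, ∑ j : Fin N, (cellEnergy (H - 1) N i j).toReal ^ 2 +
        32 * ∑ i : Fin N, ∑ j : Fin N, (cycleEnergy (H - 1) N i j).toReal) := by
    refine (Finset.sum_le_sum fun i _ => Finset.sum_le_sum fun j _ => hUU i j).trans_eq ?_
    simp only [← Finset.mul_sum, Finset.sum_add_distrib]
  have h2 : ∑ i, ∫ ω, U i ω * Z 1 ω ∂P =
      8 * (θ ^ 3 * ∑ i : Fin N, (triangleEnergy (H - 1) N i).toReal) := by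
    simp only [hUZ, ← Finset.mul_sum]
  rw [h2, hpow]
  set A := ∑ i : Fin N, ∑ j : Fin N, (cellEnergy (H - 1) N i j).toReal ^ 2
  set B := ∑ i : Fin N, ∑ j : Fin N, (cycleEnergy (H - 1) N i j).toReal
  set C := ∑ i : Fin N, (triangleEnergy (H - 1) N i).toReal
  set M := (N : ℝ) ^ H
  calc (M / (4 * d)) ^ 2 * ∑ i, ∑ j, ∫ ω, U i ω * U j ω ∂P -
        2 * (M / (4 * d)) * (8 * (θ ^ 3 * C)) + 1
      ≤ (M / (4 * d)) ^ 2 * (θ ^ 4 * (24 * A + 32 * B)) -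
        2 * (M / (4 * d)) * (8 * (θ ^ 3 * C)) + 1 := by gcongr
    _ = _ := by field_simp; ring

lemma tendsto_integral_sq_renormalized [IsProbabilityMeasure P] (hH : 1 / 2 < H) (hH1 : H < 1)
    (hW : IsBrownianUnit W P) (hZ : IsRosenblattProcess H W P Z) :
    Tendsto (fun N : ℕ => ∫ ω,
      ((N : ℝ) ^ (1 - H) * quadVariation P Z N ω / (4 * rosenblattConst H) - Z 1 ω) *
      ((N : ℝ) ^ (1 - H) * quadVariation P Z N ω / (4 * rosenblattConst H) - Z 1 ω) ∂P)
      atTop (𝓝 0) := by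
  have hd := rosenblattConst_pos hH
  have hθ := overlapConst_pos hH
  have hκ : 0 ≤ 2 / ((H - 1 + 1) * (H - 1 + 2)) := by
    have : 0 < H - 1 + 1 := by linarith
    have : 0 < H - 1 + 2 := by linarith
    positivity
  have hJ := energyConst_nonneg hH
  have hb := limsup_sum_inner_cycle_le (p := H - 1) (by linarith) (by linarith)
  have hc := le_liminf_sum_triangle (p := H - 1) (by linarith)
  rw [← ENNReal.ofReal_mul hκ, ← ENNReal.ofReal_mul (mul_nonneg hκ hκ)] at hb
  rw [← ENNReal.ofReal_mul hκ] at hc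
  refine tendsto_zero_of_limsup_of_liminf (by positivity) (by positivity)
    (mul_nonneg (mul_nonneg hκ hκ) hJ) (fun N => integral_nonneg fun ω => mul_self_nonneg _) ?_
    (tendsto_sum_sq_cell_riesz (q := 2 * (H - 1)) (by linarith) (by linarith)) hb hc ?_ ?_
    (K₀ := 1) (K₁ := 3 / 2 * overlapConst H ^ 4 / rosenblattConst H ^ 2)
    (K₂ := 2 * overlapConst H ^ 4 / rosenblattConst H ^ 2)
    (K₃ := 4 * overlapConst H ^ 3 / rosenblattConst H)
  · filter_upwards [eventually_ne_atTop 0] with N hN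
    exact integral_sq_renormalized_le hH hH1 hW hZ hN
  · refine Eventually.of_forall fun N => ENNReal.mul_ne_top ENNReal.ofReal_ne_top ?_
    refine ENNReal.sum_ne_top.2 fun i hi => ?_
    exact (integral_comp_incrKernel_mul_kernel hH hH1 hW hZ ⟨i, Finset.mem_range.1 hi⟩).2
  · have hE := energyConst_eq hH
    set J := 2 / ((2 * (H - 1) + 1) * (2 * (H - 1) + 2))
    -- The identity θκ = d explains the factor d(H) in the normalization of the theorem.
    have hθκ : overlapConst H * (2 / ((H - 1 + 1) * (H - 1 + 2))) = rosenblattConst H := by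
      have h1 : H ≠ 0 := by linarith
      have h2 : H + 1 ≠ 0 := by linarith
      rw [overlapConst, sub_add_cancel, show H - 1 + 2 = H + 1 by ring]
      field_simp
    set κ := 2 / ((H - 1 + 1) * (H - 1 + 2))
    set θ := overlapConst H
    -- With θκ = d and 2θ²J = 1 the four-cycles contribute 1 and the triangles -2, which together
    -- with the second moment 1 of `Z 1` gives zero.
    have e1 : 2 * θ ^ 4 / rosenblattConst H ^ 2 * (κ * κ * J) = 1 := by
      rw [← hθκ] at hd ⊢
      have h1 : κ ≠ 0 := by rintro h; simp [h] at hd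
      rw [← hE]
      field_simp
    have e2 : 4 * θ ^ 3 / rosenblattConst H * (κ * J) = 2 := by
      rw [← hθκ] at hd ⊢
      have h1 : κ ≠ 0 := by rintro h; simp [h] at hd
      rw [show (2 : ℝ) = 2 * (2 * θ ^ 2 * J) by rw [hE]; norm_num]
      field_simp
      ring
    rw [e1, e2]
    norm_num

lemma tendsto_eLpNorm_of_tendsto_integral_sq {F : ℕ → Ω → ℝ} (hF : ∀ N, MemLp (F N) 2 P)
    (h : Tendsto (fun N => ∫ ω, F N ω * F N ω ∂P) atTop (𝓝 0)) :
    Tendsto (fun N => eLpNorm (F N) 2 P) atTop (𝓝 0) := by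
  have h1 : Tendsto (fun N => eLpNorm (F N) 2 P ^ 2) atTop (𝓝 0) := by
    simp_rw [← integral_mul_self_eq_eLpNorm (hF _)]
    simpa [Function.comp_def] using (ENNReal.continuous_ofReal.tendsto 0).comp h
  have h2 := ((ENNReal.continuous_rpow_const (y := 1 / 2)).tendsto 0).comp h1
  rw [ENNReal.zero_rpow_of_pos (by norm_num)] at h2
  refine h2.congr fun N => ?_
  rw [Function.comp_apply, ← ENNReal.rpow_two, ← ENNReal.rpow_mul]
  norm_num

end Main

end RosenblattVariation

theorem theorem3p2 {Ω : Type*} [MeasurableSpace Ω] (P : Measure Ω) [IsProbabilityMeasure P]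
    (H : ℝ) (hH : 1 / 2 < H) (hH1 : H < 1) (W Z : I → Ω → ℝ)
    (hW : RosenblattVariation.IsBrownianUnit W P)
    (hZ : RosenblattVariation.IsRosenblattProcess H W P Z) :
    (∀ N : ℕ, MemLp (RosenblattVariation.quadVariation P Z N) 2 P) ∧ MemLp (Z 1) 2 P ∧
      Tendsto (fun N : ℕ => eLpNorm (fun ω =>
        (N : ℝ) ^ (1 - H) * RosenblattVariation.quadVariation P Z N ω /
          (4 * RosenblattVariation.rosenblattConst H) - Z 1 ω) 2 P) atTop (𝓝 0) := by
  have hV := RosenblattVariation.memLp_quadVariation hW hZ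
  have hZ1 := (hZ 1).2.1
  refine ⟨hV, hZ1, RosenblattVariation.tendsto_eLpNorm_of_tendsto_integral_sq (fun N => ?_)
    (RosenblattVariation.tendsto_integral_sq_renormalized hH hH1 hW hZ)⟩
  simp_rw [mul_div_right_comm]
  exact ((hV N).const_mul _).sub hZ1
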